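/- All manifolds are smooth, finite-dimensional, without boundary, Hausdorff and $\sigma$-compact; all structures are smooth. **Conventions.** For an almost complex structure $J$ put $N_J(X,Y)=[JX,JY]-J[JX,Y]-J[X,JY]-[X,Y]$. A *minimal connection* of $J$ is a linear connection $\nabla$ on the tangent bundle with $\nabla J=0$ and torsion $T_\nabla=\frac14N_J$. A submanifold $L$ of $(M,J)$ is *pseudoholomorphic* (PH) if $TL$ is $J$-invariant; it then carries the induced almost complex structure $J|_L$. Its normal bundle is $N_LM=TM|_L/TL$, with projection $\chi:TM|_L\to N_LM$. *NB-I.* Near any point of a PH submanifold $L\subset(M,J)$ there is a minimal connection $\nabla$ for which $L$ is totally geodesic (parallel transport along $L$ preserves $TL$). It induces the connection $\hat\nabla_u[\theta]=[\nabla_u\theta]$ on $N_LM$, where $[\theta]=\chi(\theta|_L)$. The NB-I structure on the total space of $N_LM$ is the sum of $J|_L$ on the horizontal spaces of $\hat\nabla$ and of the quotient structure induced by $J$ on the vertical spaces. *NB-II.* Let $\varphi$ be a smooth map to $M$, defined near a point of the zero section of $N_LM$, that is the inclusion $L\subset M$ on the zero section and whose fibrewise derivative along the zero section is a right inverse of $\chi$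 with $J$-invariant image. The NB-II structure is $\lim_{t\to0}(\varphi\circ R^t)^*J$, where $R^t$ is the dilatation $a\mapsto ta$ of the fibres. *PH vector bundles.* Let $\pi:E\to L$ be a real vector bundle over an almost complex manifold $(L,J)$. An almost complex structure $\hat J$ on the total space $E$ makes it a *PH vector bundle* if $\pi_*\hat J=J\pi_*$, $\hat J$ restricts to a constant complex structure on each fibre, and there is a linear connection on $E$ whose horizontal lift $T_{\pi(a)}L\to T_aE$ is complex linear for all $a\in E$. Such a $\hat J$ is *normally integrable* if $N_{\hat J}(v,w)=0$ whenever $w$ is vertical. A *normally integrable form* (n.i.f.) of $\hat J$ is a normally integrable PH vector bundle structure $J_0$ on $E\to(L,J)$ with $$\hat J=J_0+\tfrac12J_0N_{\hat J}(r,\cdot),$$ where $r$ is the radius vector field, $r_a=a\in E_{\pi(a)}\subset T_aE$. **Theorem.** 1. Let $(E,\hat J,\pi)$ be a PH vector bundle over $(L,J)$. Then the zero section $L\subset E$ is a PH submanifold of $(E,\hat J)$ with induced structure $J$ and with normal bundle canonically identified with $E$; the structure $\hat J$ has exactly one n.i.f. $J_0$; the NB-I structure of the zero section $L\subset (E,\hat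 J)$ is well defined; and it coincides with $J_0$. 2. Consequently, let $L\subset(M,J)$ be any embedded PH submanifold. Then the NB-I and NB-II structures on $N_LM$ are well defined, NB-II is a PH vector bundle structure over $(L,J|_L)$, and its unique n.i.f. is NB-I. -/

import Mathlib

open Bundle Manifold Filter Topology VectorField
open scoped ContDiff

noncomputable section

/-! ## Almost complex structures, Nijenhuis tensor, minimal connections -/

section AlmostComplex

variable {E : Type*} [NormedAddCommGroup E] [NormedSpace ℝ E]
  {H : Type*} [TopologicalSpace H]

/-- A smooth almost complex structure on the manifold `M`: a smooth field `J` of endomorphisms of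
the tangent spaces with `J ∘ J = -1`. -/
@[ext]
structure AlmostComplexStructure (I : ModelWithCorners ℝ E H) (M : Type*) [TopologicalSpace M]
    [ChartedSpace H M] [IsManifold I ∞ M] where
  /-- the endomorphism field -/
  toFun : Π x : M, TangentSpace I x →L[ℝ] TangentSpace I x
  sq_eq_neg : ∀ (x : M) (v : TangentSpace I x), toFun x (toFun x v) = -v
  contMDiff_toFun : ContMDiff I (I.prod 𝓘(ℝ, E →L[ℝ] E)) ∞
    (fun x : M ↦ (⟨x, toFun x⟩ :
      TotalSpace (E →L[ℝ] E) fun x : M ↦ TangentSpace I x →L[ℝ] TangentSpace I x))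

instance (I : ModelWithCorners ℝ E H) (M : Type*) [TopologicalSpace M]
    [ChartedSpace H M] [IsManifold I ∞ M] : CoeFun (AlmostComplexStructure I M)
    (fun _ ↦ Π x : M, TangentSpace I x →L[ℝ] TangentSpace I x) :=
  ⟨AlmostComplexStructure.toFun⟩

variable {I : ModelWithCorners ℝ E H} {M : Type*} [TopologicalSpace M] [ChartedSpace H M]
  [IsManifold I ∞ M]

/-- The expression `[JX, JY] - J[JX, Y] - J[X, JY] - [X, Y]` for two vector fields. -/
def nijenhuisField (J : AlmostComplexStructure I M) (X Y : Π x : M, TangentSpace I x) (x : M) :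
    TangentSpace I x :=
  mlieBracket I (fun y ↦ J y (X y)) (fun y ↦ J y (Y y)) x
    - J x (mlieBracket I (fun y ↦ J y (X y)) Y x)
    - J x (mlieBracket I X (fun y ↦ J y (Y y)) x)
    - mlieBracket I X Y x

/-- Applying an almost complex structure to a vector field that is differentiable at `x` gives a
vector field that is differentiable at `x`. -/
theorem AlmostComplexStructure.mdifferentiableAt_apply (J : AlmostComplexStructure I M)
    {X : Π x : M, TangentSpace I x} {x : M} (hX : MDiffAt (T% X) x) :
    MDiffAt (T% (fun y ↦ J y (X y))) x :=
  MDifferentiableAt.clm_bundle_apply (F₁ := E) (F₂ := E)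
    (E₁ := fun x : M ↦ TangentSpace I x) (E₂ := fun x : M ↦ TangentSpace I x)
    (b := fun x : M ↦ x)
    ((J.contMDiff_toFun.contMDiffAt (x := x)).mdifferentiableAt (by simp)) hX

theorem nijenhuisField_swap (J : AlmostComplexStructure I M) (X Y : Π x : M, TangentSpace I x)
    (x : M) : nijenhuisField J Y X x = -nijenhuisField J X Y x := by
  simp only [nijenhuisField]
  rw [mlieBracket_swap_apply, mlieBracket_swap_apply (W := X), mlieBracket_swap_apply (V := Y),
    mlieBracket_swap_apply (V := Y) (W := X)]
  simp only [map_neg]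
  module

variable [FiniteDimensional ℝ E]

theorem nijenhuisField_tensorial_left (J : AlmostComplexStructure I M) (x : M)
    (Y : Π x : M, TangentSpace I x) :
    TensorialAt I E (fun X ↦ nijenhuisField J X Y x) x where
  smul {f X} hf hX := by
    have e : (fun y ↦ J y ((f • X) y)) = f • fun y ↦ J y (X y) := by ext y; simp
    simp only [nijenhuisField]
    rw [e, mlieBracket_smul_left hf (J.mdifferentiableAt_apply hX),
      mlieBracket_smul_left hf hX, mlieBracket_smul_left hf hX,
      mlieBracket_smul_left hf (J.mdifferentiableAt_apply hX)]
    simp only [map_add, map_smul, J.sq_eq_neg]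
    module
  add {X X'} hX hX' := by
    have e : (fun y ↦ J y ((X + X') y)) = (fun y ↦ J y (X y)) + fun y ↦ J y (X' y) := by
      ext y; simp
    have hJ := J.mdifferentiableAt_apply hX
    have hJ' := J.mdifferentiableAt_apply hX'
    simp only [nijenhuisField]
    rw [e, mlieBracket_add_left hJ hJ', mlieBracket_add_left hX hX',
      mlieBracket_add_left hX hX', mlieBracket_add_left hJ hJ']
    simp only [map_add]
    module

/-- The Nijenhuis tensor `N_J`, evaluated on two tangent vectors at `x` by extending them to
vector fields that are smooth near `x`. By `nijenhuis_apply` below, the result does not depend on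
the extension. -/
def nijenhuis (J : AlmostComplexStructure I M) (x : M) (u v : TangentSpace I x) :
    TangentSpace I x :=
  nijenhuisField J (FiberBundle.extend E u) (FiberBundle.extend E v) x

/-- The value of the Nijenhuis tensor may be computed with any vector fields that are
differentiable at the given point. -/
theorem nijenhuis_apply (J : AlmostComplexStructure I M) {x : M}
    {X Y : Π x : M, TangentSpace I x} (hX : MDiffAt (T% X) x) (hY : MDiffAt (T% Y) x) :
    nijenhuis J x (X x) (Y x) = nijenhuisField J X Y x := by
  have h {X X' Y : Π x : M, TangentSpace I x} (hX : MDiffAt (T% X) x) (hX' : MDiffAt (T% X') x)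
      (e : X x = X' x) :
      nijenhuisField J X Y x = nijenhuisField J X' Y x :=
    (nijenhuisField_tensorial_left J x Y).pointwise hX hX' e
  have hX' := FiberBundle.mdifferentiableAt_extend I E (X x)
  have hY' := FiberBundle.mdifferentiableAt_extend I E (Y x)
  unfold nijenhuis
  rw [h hX' hX (by simp), nijenhuisField_swap, h hY' hY (by simp), ← nijenhuisField_swap]

/-- `cov` is (on the open set `U`) a minimal connection of `J`: a smooth linear connection on the
tangent bundle with `∇J = 0` and torsion `N_J / 4`.
Here `cov Y x u` is `∇_u Y` at the point `x`. -/
structure IsMinimalConnectionOn (J : AlmostComplexStructure I M) (U : Set M)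
    (cov : (Π x : M, TangentSpace I x) → (Π x : M, TangentSpace I x →L[ℝ] TangentSpace I x)) :
    Prop where
  isCovariantDerivativeOn : IsCovariantDerivativeOn E cov U
  smooth : ContMDiffCovariantDerivativeOn E ∞ cov U
  complexLinear : ∀ x ∈ U, ∀ Y : Π x : M, TangentSpace I x, MDiffAt (T% Y) x →
    ∀ u : TangentSpace I x, cov (fun y ↦ J y (Y y)) x u = J x (cov Y x u)
  torsion : ∀ x ∈ U, ∀ X Y : Π x : M, TangentSpace I x, MDiffAt (T% X) x → MDiffAt (T% Y) x →
    cov Y x (X x) - cov X x (Y x) - mlieBracket I X Y x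
      = (1 / 4 : ℝ) • nijenhuis J x (X x) (Y x)

end AlmostComplex

/-! ## Pseudoholomorphic submanifolds and their normal bundles -/

section Submanifold

variable {EL : Type*} [NormedAddCommGroup EL] [NormedSpace ℝ EL]
  {HL : Type*} [TopologicalSpace HL] {IL : ModelWithCorners ℝ EL HL}
  {L : Type*} [TopologicalSpace L] [ChartedSpace HL L] [IsManifold IL ∞ L]
  {EM : Type*} [NormedAddCommGroup EM] [NormedSpace ℝ EM]
  {HM : Type*} [TopologicalSpace HM] {IM : ModelWithCorners ℝ EM HM}
  {M : Type*} [TopologicalSpace M] [ChartedSpace HM M] [IsManifold IM ∞ M]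

/-- `ι` embeds `L` into `(M, JM)` as a pseudoholomorphic submanifold, with induced structure `JL`:
`TL` is invariant under `JM`, and `JM` restricts to `JL` on `TL`. -/
structure IsPHSubmanifold (JL : AlmostComplexStructure IL L) (JM : AlmostComplexStructure IM M)
    (ι : L → M) : Prop where
  isSmoothEmbedding : IsSmoothEmbedding IL IM ∞ ι
  comm : ∀ (x : L) (u : TangentSpace IL x),
    mfderiv IL IM ι x (JL x u) = JM (ι x) (mfderiv IL IM ι x u)

/-- The submanifold `ι : L → M` is totally geodesic on `U` for the connection `cov`: the
covariant derivative in a direction tangent to `L` of a vector field that is tangent to `L` along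
`L` is again tangent to `L`; that is, parallel transport along `L` preserves `TL`. -/
def IsTotallyGeodesicOn (IL : ModelWithCorners ℝ EL HL) [IsManifold IL ∞ L] (ι : L → M) (U : Set M)
    (cov : (Π y : M, TangentSpace IM y) → (Π y : M, TangentSpace IM y →L[ℝ] TangentSpace IM y)) :
    Prop :=
  ∀ x : L, ι x ∈ U → ∀ X : Π y : M, TangentSpace IM y, MDiffAt (T% X) (ι x) →
    (∀ᶠ x' in 𝓝 x, X (ι x') ∈ (mfderiv IL IM ι x').range) →
    ∀ u : TangentSpace IL x,
      cov X (ι x) (mfderiv IL IM ι x u) ∈ (mfderiv IL IM ι x).range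

variable {F : Type*} [NormedAddCommGroup F] [NormedSpace ℝ F]
  {N : L → Type*} [TopologicalSpace (TotalSpace F N)]
  [∀ x, AddCommGroup (N x)] [∀ x, Module ℝ (N x)] [∀ x, TopologicalSpace (N x)]
  [FiberBundle F N] [VectorBundle ℝ F N] [ContMDiffVectorBundle ∞ F N IL]

/-- The smooth vector bundle `N` over `L`, together with the bundle map `χ : TM|_L → N`, is the
normal bundle of the submanifold `ι : L → M`: the map `χ` is smooth, and
`0 → TL → TM|_L → N → 0` is exact. (This determines `N` and `χ` up to a unique isomorphism.) -/
structure IsNormalBundle (IL : ModelWithCorners ℝ EL HL) (IM : ModelWithCorners ℝ EM HM)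
    [IsManifold IL ∞ L] [IsManifold IM ∞ M] (F : Type*) [NormedAddCommGroup F] [NormedSpace ℝ F]
    {N : L → Type*} [TopologicalSpace (TotalSpace F N)]
    [∀ x, AddCommGroup (N x)] [∀ x, Module ℝ (N x)] [∀ x, TopologicalSpace (N x)]
    [FiberBundle F N] [VectorBundle ℝ F N] [ContMDiffVectorBundle ∞ F N IL] (ι : L → M)
    (χ : Π x : L, TangentSpace IM (ι x) →L[ℝ] N x) : Prop where
  surjective : ∀ x, Function.Surjective (χ x)
  ker_eq : ∀ x, (χ x).ker = (mfderiv IL IM ι x).range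
  smooth : ∀ (U : Set M) (X : Π y : M, TangentSpace IM y), IsOpen U →
    ContMDiffOn IM IM.tangent ∞ (T% X) U →
    ContMDiffOn IL (IL.prod 𝓘(ℝ, F)) ∞
      (fun x ↦ (⟨x, χ x (X (ι x))⟩ : TotalSpace F N)) (ι ⁻¹' U)

/-- The vertical tangent vector at `a` in the direction `w`: the velocity at `t = 0` of the curve
`t ↦ a + t w` in the fibre through `a`. -/
def vert (IL : ModelWithCorners ℝ EL HL) (F : Type*) [NormedAddCommGroup F] [NormedSpace ℝ F]
    {N : L → Type*} [TopologicalSpace (TotalSpace F N)]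
    [∀ x, AddCommGroup (N x)] [∀ x, Module ℝ (N x)] [∀ x, TopologicalSpace (N x)]
    [FiberBundle F N] {x : L} (a w : N x) :
    TangentSpace (IL.prod 𝓘(ℝ, F)) (⟨x, a⟩ : TotalSpace F N) :=
  mfderiv 𝓘(ℝ, ℝ) (IL.prod 𝓘(ℝ, F)) (fun t : ℝ ↦ (⟨x, a + t • w⟩ : TotalSpace F N)) 0 (1 : ℝ)

/-- The horizontal lift, at the point `s x` of the total space, of the tangent vector `u` at `x`
for a connection whose covariant derivative of the section `s` in the direction `u` is `c`. It is
the velocity of `s` in the direction `u` minus the vertical vector `c`. For a linear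
connection, it depends on `s` only through the point `s x`. -/
def horizLift (IL : ModelWithCorners ℝ EL HL) (F : Type*) [NormedAddCommGroup F] [NormedSpace ℝ F]
    {N : L → Type*} [TopologicalSpace (TotalSpace F N)]
    [∀ x, AddCommGroup (N x)] [∀ x, Module ℝ (N x)] [∀ x, TopologicalSpace (N x)]
    [FiberBundle F N] (s : Π x : L, N x) (x : L) (u : TangentSpace IL x) (c : N x) :
    TangentSpace (IL.prod 𝓘(ℝ, F)) (⟨x, s x⟩ : TotalSpace F N) :=
  mfderiv IL (IL.prod 𝓘(ℝ, F)) (fun x' ↦ (⟨x', s x'⟩ : TotalSpace F N)) x u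
    - vert IL F (s x) c

/-- `K` is the NB-I structure on the total space of the normal bundle `(N, χ)` of the
pseudoholomorphic submanifold `ι : (L, JL) → (M, JM)`.

A minimal connection `∇` (defined near a given point of `L`) for which `L` is totally geodesic
induces the connection `∇̂_u [θ] = [∇_u θ]` on `N`, where `[θ] = χ(θ|_L)`. The structure `K` is
the sum of the quotient structure of `JM` on the vertical spaces and of `JL` on the horizontal
spaces of this connection. -/
def IsNBI [FiniteDimensional ℝ EM] (JL : AlmostComplexStructure IL L)
    (JM : AlmostComplexStructure IM M) (ι : L → M) (χ : Π x : L, TangentSpace IM (ι x) →L[ℝ] N x)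
    (K : AlmostComplexStructure (IL.prod 𝓘(ℝ, F)) (TotalSpace F N)) : Prop :=
  ∀ x₀ : L, ∃ U : Set M, IsOpen U ∧ ι x₀ ∈ U ∧
    ∃ cov : (Π y : M, TangentSpace IM y) →
        (Π y : M, TangentSpace IM y →L[ℝ] TangentSpace IM y),
      IsMinimalConnectionOn JM U cov ∧ IsTotallyGeodesicOn IL ι U cov ∧
      ∀ x : L, ι x ∈ U →
        (∀ (a : N x) (v : TangentSpace IM (ι x)),
          K ⟨x, a⟩ (vert IL F a (χ x v)) = vert IL F a (χ x (JM (ι x) v))) ∧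
        (∀ θ : Π y : M, TangentSpace IM y, MDiffAt (T% θ) (ι x) → ∀ u : TangentSpace IL x,
          K ⟨x, χ x (θ (ι x))⟩
              (horizLift IL F (fun x' ↦ χ x' (θ (ι x'))) x u
                (χ x (cov θ (ι x) (mfderiv IL IM ι x u))))
            = horizLift IL F (fun x' ↦ χ x' (θ (ι x'))) x (JL x u)
                (χ x (cov θ (ι x) (mfderiv IL IM ι x (JL x u)))))

/-- Let `φ` be a map from the total space of the normal bundle to `M`, and let `Φ_t` be the map
`b ↦ φ (t b)`. This is the structure `J_t = (Φ_t)^* JM`, evaluated on a tangent vector at `a`. In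
other words, it is the pullback `φ^* JM`, transformed by the dilatation `b ↦ t b`. -/
def dilatedStructure (IL : ModelWithCorners ℝ EL HL) (F : Type*) [NormedAddCommGroup F]
    [NormedSpace ℝ F]
    {N : L → Type*} [TopologicalSpace (TotalSpace F N)]
    [∀ x, AddCommGroup (N x)] [∀ x, Module ℝ (N x)] [∀ x, TopologicalSpace (N x)]
    [FiberBundle F N] (JM : AlmostComplexStructure IM M) (φ : TotalSpace F N → M) (t : ℝ)
    (a : TotalSpace F N) (v : TangentSpace (IL.prod 𝓘(ℝ, F)) a) :
    TangentSpace (IL.prod 𝓘(ℝ, F)) a :=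
  let Φ : TotalSpace F N → M := fun b ↦ φ ⟨b.1, t • b.2⟩
  (mfderiv (IL.prod 𝓘(ℝ, F)) IM Φ a).inverse
    (JM (Φ a) (mfderiv (IL.prod 𝓘(ℝ, F)) IM Φ a v))

/-- `φ` is a tubular map on the open set `O` of the total space of the normal bundle: it is
smooth, it is `ι` on the zero section, and along the zero section its fibrewise derivative
identifies `N` with a `JM`-invariant subbundle of `TM|_L` complementary to `TL` (in such a way that
composing with `χ` gives the identity of `N`). -/
structure IsTubularMapOn (IL : ModelWithCorners ℝ EL HL) [IsManifold IL ∞ L]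
    [ContMDiffVectorBundle ∞ F N IL] (JM : AlmostComplexStructure IM M) (ι : L → M)
    (χ : Π x : L, TangentSpace IM (ι x) →L[ℝ] N x) (O : Set (TotalSpace F N))
    (φ : TotalSpace F N → M) : Prop where
  smooth : ContMDiffOn (IL.prod 𝓘(ℝ, F)) IM ∞ φ O
  zero : ∀ x : L, zeroSection F N x ∈ O → φ (zeroSection F N x) = ι x
  proj : ∀ x : L, zeroSection F N x ∈ O → ∀ w : N x,
    χ x (mfderiv (IL.prod 𝓘(ℝ, F)) IM φ (zeroSection F N x) (vert IL F (0 : N x) w)) = w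
  invariant : ∀ x : L, zeroSection F N x ∈ O → ∀ w : N x, ∃ w' : N x,
    JM (φ (zeroSection F N x))
        (mfderiv (IL.prod 𝓘(ℝ, F)) IM φ (zeroSection F N x) (vert IL F (0 : N x) w))
      = mfderiv (IL.prod 𝓘(ℝ, F)) IM φ (zeroSection F N x) (vert IL F (0 : N x) w')

/-- `K` is the NB-II structure on the total space of the normal bundle `(N, χ)` of the
submanifold `ι : L → (M, JM)`: the limit, as `t → 0`, of the structures `J_t` obtained from `JM` by
a tubular map (defined near a given point of the zero section) and the dilatations of the fibres. -/
def IsNBII (JM : AlmostComplexStructure IM M) (ι : L → M)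
    (χ : Π x : L, TangentSpace IM (ι x) →L[ℝ] N x)
    (K : AlmostComplexStructure (IL.prod 𝓘(ℝ, F)) (TotalSpace F N)) : Prop :=
  ∀ x₀ : L, ∃ O : Set (TotalSpace F N), IsOpen O ∧ zeroSection F N x₀ ∈ O ∧
    ∃ φ : TotalSpace F N → M, IsTubularMapOn IL JM ι χ O φ ∧
      ∀ x : L, zeroSection F N x ∈ O → ∀ (a : N x)
        (v : TangentSpace (IL.prod 𝓘(ℝ, F)) (⟨x, a⟩ : TotalSpace F N)),
        Tendsto (fun t : ℝ ↦ dilatedStructure IL F JM φ t ⟨x, a⟩ v) (𝓝[≠] 0) (𝓝 (K ⟨x, a⟩ v))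

end Submanifold

/-! ## Pseudoholomorphic vector bundles and normally integrable forms -/

section PHBundle

variable {EL : Type*} [NormedAddCommGroup EL] [NormedSpace ℝ EL]
  {HL : Type*} [TopologicalSpace HL] {IL : ModelWithCorners ℝ EL HL}
  {L : Type*} [TopologicalSpace L] [ChartedSpace HL L] [IsManifold IL ∞ L]
  {F : Type*} [NormedAddCommGroup F] [NormedSpace ℝ F]
  {N : L → Type*} [TopologicalSpace (TotalSpace F N)]
  [∀ x, AddCommGroup (N x)] [∀ x, Module ℝ (N x)] [∀ x, TopologicalSpace (N x)]
  [∀ x, IsTopologicalAddGroup (N x)] [∀ x, ContinuousSMul ℝ (N x)]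
  [FiberBundle F N] [VectorBundle ℝ F N] [ContMDiffVectorBundle ∞ F N IL]

/-- The almost complex structure `K` on the total space makes `N` into a pseudoholomorphic vector
bundle over `(L, JL)`: the projection is pseudoholomorphic, `K` restricts to a complex structure
with constant coefficients on each fibre, and there is a smooth linear connection `D` on `N` whose
horizontal lift is complex linear. -/
structure IsPHVectorBundle (JL : AlmostComplexStructure IL L)
    (K : AlmostComplexStructure (IL.prod 𝓘(ℝ, F)) (TotalSpace F N)) : Prop where
  proj : ∀ (a : TotalSpace F N) (v : TangentSpace (IL.prod 𝓘(ℝ, F)) a),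
    mfderiv (IL.prod 𝓘(ℝ, F)) IL (TotalSpace.proj : TotalSpace F N → L) a (K a v)
      = JL a.proj (mfderiv (IL.prod 𝓘(ℝ, F)) IL (TotalSpace.proj : TotalSpace F N → L) a v)
  fiber : ∀ x : L, ∃ j : N x →L[ℝ] N x, (∀ w, j (j w) = -w) ∧
    ∀ a w : N x, K ⟨x, a⟩ (vert IL F a w) = vert IL F a (j w)
  connection : ∃ D : CovariantDerivative IL F N, D.ContMDiffCovariantDerivative ∞ ∧
    ∀ (s : Π x : L, N x) (x : L), MDiffAt (T% s) x → ∀ u : TangentSpace IL x,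
      K ⟨x, s x⟩ (horizLift IL F s x u (D s x u))
        = horizLift IL F s x (JL x u) (D s x (JL x u))

variable [FiniteDimensional ℝ EL] [FiniteDimensional ℝ F]

/-- The structure `K` on the total space of `N` is normally integrable: `N_K(v, w) = 0` whenever
`w` is vertical. -/
def IsNormallyIntegrable (K : AlmostComplexStructure (IL.prod 𝓘(ℝ, F)) (TotalSpace F N)) : Prop :=
  ∀ (x : L) (a w : N x) (v : TangentSpace (IL.prod 𝓘(ℝ, F)) (⟨x, a⟩ : TotalSpace F N)),
    nijenhuis K ⟨x, a⟩ v (vert IL F a w) = 0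

/-- `J₀` is the normally integrable form of the pseudoholomorphic vector bundle structure `K`:
a normally integrable pseudoholomorphic vector bundle structure with
`K = J₀ + (1/2) J₀ N_K(r, ·)`, where `r` is the radius vector field `r_a = vert a a`. -/
structure IsNormallyIntegrableForm (JL : AlmostComplexStructure IL L)
    (K J₀ : AlmostComplexStructure (IL.prod 𝓘(ℝ, F)) (TotalSpace F N)) : Prop where
  isPHVectorBundle : IsPHVectorBundle JL J₀
  isNormallyIntegrable : IsNormallyIntegrable J₀
  formula : ∀ (x : L) (a : N x)
    (v : TangentSpace (IL.prod 𝓘(ℝ, F)) (⟨x, a⟩ : TotalSpace F N)),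
    K ⟨x, a⟩ v = J₀ ⟨x, a⟩ v
      + (1 / 2 : ℝ) • J₀ ⟨x, a⟩ (nijenhuis K ⟨x, a⟩ (vert IL F a a) v)

/-- The canonical projection `T_{0_x} N → N_x` at a point `0_x` of the zero section, along the
tangent space of the zero section: the differential of the fibre coordinate of a local
trivialization at `0_x`, read in the fibre `N_x`. -/
def zeroSectionNormalProj (IL : ModelWithCorners ℝ EL HL) (F : Type*) [NormedAddCommGroup F]
    [NormedSpace ℝ F] (N : L → Type*) [TopologicalSpace (TotalSpace F N)]
    [∀ x, AddCommGroup (N x)] [∀ x, Module ℝ (N x)] [∀ x, TopologicalSpace (N x)]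
    [FiberBundle F N] [VectorBundle ℝ F N] (x : L) :
    TangentSpace (IL.prod 𝓘(ℝ, F)) (zeroSection F N x) →L[ℝ] N x :=
  ((trivializationAt F N x).symmL ℝ x).comp
    (mfderiv (IL.prod 𝓘(ℝ, F)) 𝓘(ℝ, F)
      (fun p : TotalSpace F N ↦ (trivializationAt F N x p).2) (zeroSection F N x))

end PHBundle

end

/-!
# The normal bundle structures of a pseudoholomorphic submanifold

All structures are compared in the coordinates `E_L × F` that a chart of `L` and a trivialization of
`N` give on the total space (`coordDom`, `totalDeriv`, `bundleEndo`).

*Pseudoholomorphic vector bundles.* In these coordinates, an almost complex structure `K` makes the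
bundle pseudoholomorphic exactly if it has the form `(u, w) ↦ (J u, C a u + j w)` at the point `a`
of the fibre, with `C` linear in `a` (`IsPHVectorBundle.isFiberLinearAt`). The converse
`isPHVectorBundle_of_isFiberLinearAt` needs a global connection: locally, the one with Christoffel
symbols `-½ j C` has a complex linear horizontal lift, and since this condition is affine, a
partition of unity glues the local connections. The Nijenhuis tensor of `K` with a vertical argument
`b` is vertical, is independent of `a`, and is an explicit expression `n b u` in the 1-jet of
`J, C, j` (`mixedNijenhuis`). Replacing `C` by `C - ½ j n` makes this expression vanish
(`mixedNijenhuis_integrableMixed`), and amounts to replacing `K` by `J₀ = K - ½ K N_K(r, ·)`. Since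
`N_K(r, ·)` is vertical and kills vertical vectors, `K` agrees on vertical vectors with any
normally integrable form of itself, so that `J₀` is the only one
(`IsPHVectorBundle.isNormallyIntegrableForm_iff`).

*NB-II.* A tubular map, read in coordinates, is an adapted parametrization of `M`: the submanifold
is `E_L × 0`, and `0 × F` is invariant along it. The limit of the dilated structures is the
linearization of the structure of `M` along `E_L × 0` (`tendsto_dilation`), which has the form
above, with `C` the normal derivative of the mixed block. It does not depend on the tubular map,
because `C` is determined by the normal part of `J[U, θ] - [JU, θ]`, for a vector field `U` tangent
to the submanifold at a point and any `θ` (`IsAdaptedParam.fiberCoord_bracket`,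
`IsAdaptedParam.blocks_eq`).

*NB-I.* For a minimal connection,
`J ∇_U θ - ∇_{JU} θ = J[U, θ] - [JU, θ] - ½ J N(θ, U)` (`IsMinimalConnectionOn.acs_cov_sub`). The
normal part of the right hand side is that of the NB-II structure with `C` replaced by `C - ½ j n`,
where `n` is computed from the linearization. Hence NB-I is the normally integrable form of NB-II,
and does not depend on the connection (`IsAdaptedParam.nbi_iff`).

*Existence.* The Christoffel symbols `minimalChristoffel` define a minimal connection in any local
parametrization; in an adapted one, the submanifold is totally geodesic. Tubular maps are
`x + S_x w` in a chart of `M`, with `S` the complex linear part of a right inverse of the projection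
to the normal bundle (`exists_isTubularMapOn`).

Finally, the identity is a tubular map of the zero section of a pseudoholomorphic vector bundle, and
the dilatations preserve the structure of the bundle, which is therefore its own NB-II structure. So
the statement about the zero section follows from the one about submanifolds (`exists_nbi_nbii`).
-/

set_option linter.unusedSectionVars false
set_option maxSynthPendingDepth 3

noncomputable section


/-! ### Local parametrizations of a manifold -/
section Param
variable {E : Type*} [NormedAddCommGroup E] [NormedSpace ℝ E]
  {H : Type*} [TopologicalSpace H] {I : ModelWithCorners ℝ E H}
  {M : Type*} [TopologicalSpace M] [ChartedSpace H M]
  {E' : Type*} [NormedAddCommGroup E'] [NormedSpace ℝ E']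

variable (I) in
/-- The differential of a map `ψ` from a normed space to a manifold. -/
def paramDeriv (ψ : E' → M) (z : E') : E' →L[ℝ] TangentSpace I (ψ z) :=
  mfderiv 𝓘(ℝ, E') I ψ z

variable (I) in
/-- The map `ψ` from a normed space to `M` is a local parametrization of `M` at `z`: it is smooth
near `z` with invertible differential. -/
structure IsParamAt (ψ : E' → M) (z : E') : Prop where
  eventually_smooth : ∀ᶠ y in 𝓝 z, ContMDiffAt 𝓘(ℝ, E') I ∞ ψ y
  inv : (paramDeriv I ψ z).IsInvertible

variable (I) in
/-- The differential at `x` of the extended chart centred at `p`. -/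
def chartDeriv (p x : M) : TangentSpace I x →L[ℝ] E :=
  mfderiv I 𝓘(ℝ, E) (extChartAt I p) x

theorem chartDeriv_isInvertible [IsManifold I ∞ M] {p x : M} (hx : x ∈ (extChartAt I p).source) :
    (chartDeriv I p x).IsInvertible :=
  isInvertible_mfderiv_extChartAt hx

variable (I) in
/-- A vector field read in a local parametrization. -/
def pullField (ψ : E' → M) (X : Π x : M, TangentSpace I x) (z : E') : E' :=
  (paramDeriv I ψ z).inverse (X (ψ z))

variable (I) in
/-- A field of endomorphisms of the tangent spaces, read in a local parametrization. -/
def pullEndo (ψ : E' → M) (J : Π x : M, TangentSpace I x →L[ℝ] TangentSpace I x) (z : E') :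
    E' →L[ℝ] E' :=
  (paramDeriv I ψ z).inverse ∘L J (ψ z) ∘L paramDeriv I ψ z

theorem pullEndo_apply (ψ : E' → M) (J : Π x : M, TangentSpace I x →L[ℝ] TangentSpace I x) (z v) :
    pullEndo I ψ J z v = (paramDeriv I ψ z).inverse (J (ψ z) (paramDeriv I ψ z v)) := rfl

namespace IsParamAt

variable {ψ : E' → M} {z : E'}

theorem smooth (h : IsParamAt I ψ z) : ContMDiffAt 𝓘(ℝ, E') I ∞ ψ z :=
  h.eventually_smooth.self_of_nhds

theorem mdifferentiableAt (h : IsParamAt I ψ z) : MDiffAt ψ z :=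
  h.smooth.mdifferentiableAt (by simp)

theorem deriv_inverse (h : IsParamAt I ψ z) (v) :
    paramDeriv I ψ z ((paramDeriv I ψ z).inverse v) = v := h.inv.self_apply_inverse v

theorem inverse_deriv (h : IsParamAt I ψ z) (v) :
    (paramDeriv I ψ z).inverse (paramDeriv I ψ z v) = v := h.inv.inverse_apply_self v

theorem deriv_pullEndo (h : IsParamAt I ψ z)
    (J : Π x : M, TangentSpace I x →L[ℝ] TangentSpace I x) (v : E') :
    paramDeriv I ψ z (pullEndo I ψ J z v) = J (ψ z) (paramDeriv I ψ z v) := h.deriv_inverse _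

theorem inverse_endo (h : IsParamAt I ψ z)
    (J : Π x : M, TangentSpace I x →L[ℝ] TangentSpace I x) (v : TangentSpace I (ψ z)) :
    (paramDeriv I ψ z).inverse (J (ψ z) v)
      = pullEndo I ψ J z ((paramDeriv I ψ z).inverse v) := by
  rw [pullEndo_apply, h.deriv_inverse]

theorem pullField_endo (h : IsParamAt I ψ z)
    (J : Π x : M, TangentSpace I x →L[ℝ] TangentSpace I x) (X : Π x : M, TangentSpace I x) :
    pullField I ψ (fun y ↦ J y (X y)) z = pullEndo I ψ J z (pullField I ψ X z) :=
  h.inverse_endo J _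

variable [IsManifold I ∞ M]

theorem hasFDerivAt_chart (h : MDiffAt ψ z) (p : M) (hp : ψ z ∈ (extChartAt I p).source) :
    HasFDerivAt (fun y ↦ extChartAt I p (ψ y)) (chartDeriv I p (ψ z) ∘L paramDeriv I ψ z) z := by
  have h1 := (mdifferentiableAt_extChartAt (I := I) (x := p) (y := ψ z)
    (by simpa using hp)).hasMFDerivAt
  exact (h1.comp z h.hasMFDerivAt).hasFDerivAt

theorem contDiffAt_chart (h : IsParamAt I ψ z) (p : M) (hp : ψ z ∈ (extChartAt I p).source) :
    ContDiffAt ℝ ∞ (fun y ↦ extChartAt I p (ψ y)) z := by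
  rw [← contMDiffAt_iff_contDiffAt]
  exact (contMDiffAt_extChartAt' (by simpa using hp)).comp z h.smooth

theorem fderiv_chart_isInvertible (h : IsParamAt I ψ z) (p : M)
    (hp : ψ z ∈ (extChartAt I p).source) :
    (fderiv ℝ (fun y ↦ extChartAt I p (ψ y)) z).IsInvertible := by
  rw [(hasFDerivAt_chart h.mdifferentiableAt p hp).fderiv]
  exact (chartDeriv_isInvertible hp).comp h.inv

theorem isInvertible_of_chart (hm : MDiffAt ψ z) (p : M)
    (hp : ψ z ∈ (extChartAt I p).source)
    (hi : (fderiv ℝ (fun y ↦ extChartAt I p (ψ y)) z).IsInvertible) :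
    (paramDeriv I ψ z).IsInvertible := by
  rw [(hasFDerivAt_chart hm p hp).fderiv] at hi
  have hc := chartDeriv_isInvertible hp
  have := hc.inverse.comp hi
  rwa [← ContinuousLinearMap.comp_assoc, hc.inverse_comp_self, ContinuousLinearMap.id_comp] at this

/-- A local parametrization at a point is a local parametrization at all nearby points. -/
protected theorem eventually [CompleteSpace E'] (h : IsParamAt I ψ z) :
    ∀ᶠ y in 𝓝 z, IsParamAt I ψ y := by
  have hsrc : ψ z ∈ (extChartAt I (ψ z)).source := mem_extChartAt_source _
  have hc := h.contDiffAt_chart (ψ z) hsrc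
  have h3 : ∀ᶠ y in 𝓝 z, (fderiv ℝ (fun y ↦ extChartAt I (ψ z) (ψ y)) y).IsInvertible := by
    have hcont : ContinuousAt (fderiv ℝ (fun y ↦ extChartAt I (ψ z) (ψ y))) z :=
      hc.continuousAt_fderiv (by simp)
    obtain ⟨e, he⟩ := h.fderiv_chart_isInvertible (ψ z) hsrc
    have := hcont.preimage_mem_nhds (he ▸ e.nhds)
    filter_upwards [this] with y hy
    obtain ⟨e', he'⟩ := hy
    exact ⟨e', he'⟩
  have h4 : ∀ᶠ y in 𝓝 z, ψ y ∈ (extChartAt I (ψ z)).source :=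
    h.smooth.continuousAt.preimage_mem_nhds (extChartAt_source_mem_nhds _)
  filter_upwards [h.eventually_smooth.eventually_nhds, h3, h4] with y h1 h3 h4
  exact ⟨h1, isInvertible_of_chart (h1.self_of_nhds.mdifferentiableAt (by simp)) (ψ z) h4 h3⟩

variable [CompleteSpace E']

theorem differentiableAt_pullField (h : IsParamAt I ψ z) {X : Π x : M, TangentSpace I x}
    (hX : MDiffAt (T% X) (ψ z)) : DifferentiableAt ℝ (pullField I ψ X) z := by
  have := hX.mpullback_vectorField h.smooth h.inv ENat.LEInfty.out
  have h2 : MDifferentiableAt 𝓘(ℝ, E') 𝓘(ℝ, E') (pullField I ψ X) z :=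
    ((contMDiff_snd_tangentBundle_modelSpace (n := ∞) E' 𝓘(ℝ, E')).contMDiffAt
      |>.mdifferentiableAt (by simp)).comp z this
  exact h2.differentiableAt

theorem contDiffAt_pullField (h : IsParamAt I ψ z) {X : Π x : M, TangentSpace I x}
    (hX : ContMDiffAt I I.tangent ∞ (T% X) (ψ z)) : ContDiffAt ℝ ∞ (pullField I ψ X) z := by
  have := hX.mpullback_vectorField_preimage (n := ∞) h.smooth h.inv (by simp)
  exact contMDiffAt_vectorSpace_iff_contDiffAt.1 this

theorem pullField_mlieBracket (h : IsParamAt I ψ z) {X Y : Π x : M, TangentSpace I x}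
    (hX : MDiffAt (T% X) (ψ z)) (hY : MDiffAt (T% Y) (ψ z)) :
    pullField I ψ (mlieBracket I X Y) z
      = fderiv ℝ (pullField I ψ Y) z (pullField I ψ X z)
        - fderiv ℝ (pullField I ψ X) z (pullField I ψ Y z) := by
  have : IsManifold I (minSmoothness ℝ 2) M := by
    rw [minSmoothness_of_isRCLikeNormedField]
    exact .of_le (n := ∞) ENat.LEInfty.out
  have h1 : pullField I ψ (mlieBracket I X Y) z
      = mlieBracket 𝓘(ℝ, E') (pullField I ψ X) (pullField I ψ Y) z :=
    mpullback_mlieBracket hX hY h.smooth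
      (by rw [minSmoothness_of_isRCLikeNormedField]; exact ENat.LEInfty.out)
  have h2 : (mlieBracketWithin 𝓘(ℝ, E') (pullField I ψ X) (pullField I ψ Y) Set.univ z : E')
      = lieBracketWithin ℝ (pullField I ψ X) (pullField I ψ Y) Set.univ z :=
    congrFun (mlieBracketWithin_eq_lieBracketWithin (𝕜 := ℝ) (V := pullField I ψ X)
      (W := pullField I ψ Y) (s := Set.univ)) z
  rw [lieBracketWithin_univ] at h2
  exact h1.trans h2

end IsParamAt

/-- Smoothness at `p` of a field `A` of endomorphisms of the tangent spaces. -/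
abbrev SmoothEndoAt (A : Π x : M, TangentSpace I x →L[ℝ] TangentSpace I x) (p : M)
    [IsManifold I ∞ M] : Prop :=
  ContMDiffAt I (I.prod 𝓘(ℝ, E →L[ℝ] E)) ∞
    (fun x : M ↦ (⟨x, A x⟩ :
      TotalSpace (E →L[ℝ] E) fun x : M ↦ TangentSpace I x →L[ℝ] TangentSpace I x)) p

variable [IsManifold I ∞ M]

theorem inCoordinates_endo {p x : M} (hx : x ∈ (extChartAt I p).source)
    (A : TangentSpace I x →L[ℝ] TangentSpace I x) :
    ContinuousLinearMap.inCoordinates E (TangentSpace I : M → Type _) E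
      (TangentSpace I : M → Type _) p x p x A
      = chartDeriv I p x ∘L A ∘L (chartDeriv I p x).inverse := by
  have hx' : x ∈ (chartAt H p).source := by simpa using hx
  have h1 : (trivializationAt E (TangentSpace I) p).continuousLinearMapAt ℝ x = chartDeriv I p x :=
    TangentBundle.continuousLinearMapAt_trivializationAt hx'
  have h2 : (trivializationAt E (TangentSpace I) p).symmL ℝ x = (chartDeriv I p x).inverse := by
    have hi := chartDeriv_isInvertible hx
    ext v
    refine (hi.inverse_apply_eq.2 ?_).symm
    rw [← h1]
    exact (Trivialization.continuousLinearMapAt_symmL _ (by simpa using hx') v).symm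
  rw [ContinuousLinearMap.inCoordinates, h1, h2]

namespace IsParamAt
variable {ψ : E' → M} {z : E'}

theorem pullEndo_eq (h : IsParamAt I ψ z) {p : M} (hp : ψ z ∈ (extChartAt I p).source)
    (A : Π x : M, TangentSpace I x →L[ℝ] TangentSpace I x) :
    pullEndo I ψ A z = (fderiv ℝ (fun y ↦ extChartAt I p (ψ y)) z).inverse
      ∘L ContinuousLinearMap.inCoordinates E (TangentSpace I : M → Type _) E
        (TangentSpace I : M → Type _) p (ψ z) p (ψ z) (A (ψ z))
      ∘L fderiv ℝ (fun y ↦ extChartAt I p (ψ y)) z := by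
  have hc := chartDeriv_isInvertible hp
  rw [inCoordinates_endo hp, (hasFDerivAt_chart h.mdifferentiableAt p hp).fderiv,
    hc.inverse_comp_of_left]
  ext v
  simp only [pullEndo, ContinuousLinearMap.comp_apply, hc.inverse_apply_self]

variable [CompleteSpace E']

theorem contDiffAt_pullEndo (h : IsParamAt I ψ z)
    {A : Π x : M, TangentSpace I x →L[ℝ] TangentSpace I x} (hA : SmoothEndoAt A (ψ z)) :
    ContDiffAt ℝ ∞ (pullEndo I ψ A) z := by
  have hsrc : ψ z ∈ (extChartAt I (ψ z)).source := mem_extChartAt_source _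
  have h1 := ((contMDiffAt_hom_bundle _).1 hA).2.comp z h.smooth
  rw [contMDiffAt_iff_contDiffAt] at h1
  have h2 : ContDiffAt ℝ ∞ (fderiv ℝ (fun y ↦ extChartAt I (ψ z) (ψ y))) z :=
    (h.contDiffAt_chart (ψ z) hsrc).fderiv_right (by simp)
  have h3 : ContDiffAt ℝ ∞ (fun y ↦ (fderiv ℝ (fun y ↦ extChartAt I (ψ z) (ψ y)) y).inverse) z :=
    (h.fderiv_chart_isInvertible (ψ z) hsrc).contDiffAt_map_inverse.comp z h2
  refine (h3.clm_comp (h1.clm_comp h2)).congr_of_eventuallyEq ?_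
  filter_upwards [h.eventually,
    h.smooth.continuousAt.preimage_mem_nhds (extChartAt_source_mem_nhds (I := I) (ψ z))]
    with y hy hy'
  exact hy.pullEndo_eq hy' A

/-- A field of endomorphisms that is smooth in a local parametrization with a smooth local inverse
`g` is smooth. -/
theorem smoothEndoAt_of_pullEndo (h : IsParamAt I ψ z)
    {A : Π x : M, TangentSpace I x →L[ℝ] TangentSpace I x} {g : M → E'} {p : M}
    (hg : ContMDiffAt I 𝓘(ℝ, E') ∞ g p) (hgp : g p = z) (hψg : ∀ᶠ x in 𝓝 p, ψ (g x) = x)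
    (hA : ContDiffAt ℝ ∞ (pullEndo I ψ A) z) : SmoothEndoAt A p := by
  have hp : ψ z = p := by rw [← hgp]; exact hψg.self_of_nhds
  have hsrc : ψ z ∈ (extChartAt I p).source := hp ▸ mem_extChartAt_source _
  refine (contMDiffAt_hom_bundle _).2 ⟨contMDiffAt_id, ?_⟩
  have h2 : ContDiffAt ℝ ∞ (fderiv ℝ (fun y ↦ extChartAt I p (ψ y))) z :=
    (h.contDiffAt_chart p hsrc).fderiv_right (by simp)
  have h3 : ContDiffAt ℝ ∞ (fun y ↦ (fderiv ℝ (fun y ↦ extChartAt I p (ψ y)) y).inverse) z :=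
    (h.fderiv_chart_isInvertible p hsrc).contDiffAt_map_inverse.comp z h2
  have h4 := (h2.clm_comp (hA.clm_comp h3)).contMDiffAt.comp_of_eq hg hgp
  refine h4.congr_of_eventuallyEq ?_
  have h5 := hg.continuousAt.eventually (hgp ▸ h.eventually)
  filter_upwards [hψg, h5, extChartAt_source_mem_nhds (I := I) p] with x hx1 hx2 hx3
  have h6 := hx2.pullEndo_eq (p := p) (by rwa [hx1]) A
  have hi := hx2.fderiv_chart_isInvertible p (by rwa [hx1])
  simp only [Function.comp_apply]
  rw [h6]
  ext v
  simp only [ContinuousLinearMap.comp_apply, hi.self_apply_inverse]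
  rw [hx1]

end IsParamAt

/-- The inverse of an extended chart is a local parametrization. -/
theorem isParamAt_extChartAt_symm [I.Boundaryless] (p : M) {z : E}
    (hz : z ∈ (extChartAt I p).target) : IsParamAt I (extChartAt I p).symm z where
  eventually_smooth := by
    filter_upwards [(isOpen_extChartAt_target (I := I) p).mem_nhds hz] with y hy
    exact (contMDiffOn_extChartAt_symm p).contMDiffAt ((isOpen_extChartAt_target p).mem_nhds hy)
  inv := by
    have := isInvertible_mfderivWithin_extChartAt_symm (I := I) hz
    rwa [I.range_eq_univ, mfderivWithin_univ] at this

theorem inverse_paramDeriv_extChartAt_symm [I.Boundaryless] {p : M} {z : E}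
    (hz : z ∈ (extChartAt I p).target) :
    (paramDeriv I (extChartAt I p).symm z).inverse = chartDeriv I p ((extChartAt I p).symm z) := by
  have h := isParamAt_extChartAt_symm p hz
  ext v
  refine h.inv.inverse_apply_eq.2 ?_
  have := mfderivWithin_extChartAt_symm_comp_mfderiv_extChartAt (I := I) hz
  rw [I.range_eq_univ, mfderivWithin_univ] at this
  exact (congrArg (fun f : TangentSpace I ((extChartAt I p).symm z) →L[ℝ] _ ↦ f v) this).symm

/-! ### The Nijenhuis tensor in a local parametrization -/

/-- The Nijenhuis tensor of a field `k` of endomorphisms of a vector space, on constant vector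
fields. -/
def flatNijenhuis (k : E' → E' →L[ℝ] E') (z u v : E') : E' :=
  fderiv ℝ k z (k z u) v - fderiv ℝ k z (k z v) u + k z (fderiv ℝ k z v u)
    - k z (fderiv ℝ k z u v)

namespace IsParamAt
variable {ψ : E' → M} {z : E'}

theorem pullEndo_sq (h : IsParamAt I ψ z) (J : AlmostComplexStructure I M) (v : E') :
    pullEndo I ψ J z (pullEndo I ψ J z v) = -v := by
  rw [pullEndo_apply, h.deriv_pullEndo, J.sq_eq_neg, map_neg, h.inverse_deriv]

variable [CompleteSpace E']

theorem contDiffAt_pullEndo_acs (h : IsParamAt I ψ z) (J : AlmostComplexStructure I M) :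
    ContDiffAt ℝ ∞ (pullEndo I ψ J) z :=
  h.contDiffAt_pullEndo (J.contMDiff_toFun _)

theorem differentiableAt_pullEndo (h : IsParamAt I ψ z) (J : AlmostComplexStructure I M) :
    DifferentiableAt ℝ (pullEndo I ψ J) z :=
  (h.contDiffAt_pullEndo_acs J).differentiableAt (by simp)

theorem fderiv_pullField_acs (h : IsParamAt I ψ z) (J : AlmostComplexStructure I M)
    {X : Π x : M, TangentSpace I x} (hX : MDiffAt (T% X) (ψ z)) (v : E') :
    fderiv ℝ (pullField I ψ (fun y ↦ J y (X y))) z v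
      = fderiv ℝ (pullEndo I ψ J) z v (pullField I ψ X z)
        + pullEndo I ψ J z (fderiv ℝ (pullField I ψ X) z v) := by
  have h1 : pullField I ψ (fun y ↦ J y (X y)) =ᶠ[𝓝 z]
      fun y ↦ pullEndo I ψ J y (pullField I ψ X y) := by
    filter_upwards [h.eventually] with y hy using hy.pullField_endo J X
  rw [h1.fderiv_eq, fderiv_clm_apply (h.differentiableAt_pullEndo J)
    (h.differentiableAt_pullField hX)]
  simp [add_comm]

theorem inverse_nijenhuis (h : IsParamAt I ψ z) (J : AlmostComplexStructure I M)
    (u v : TangentSpace I (ψ z)) :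
    (paramDeriv I ψ z).inverse (nijenhuis J (ψ z) u v)
      = flatNijenhuis (pullEndo I ψ J) z ((paramDeriv I ψ z).inverse u)
        ((paramDeriv I ψ z).inverse v) := by
  set X := FiberBundle.extend E u
  set Y := FiberBundle.extend E v
  have hX : MDiffAt (T% X) (ψ z) := FiberBundle.mdifferentiableAt_extend I E u
  have hY : MDiffAt (T% Y) (ψ z) := FiberBundle.mdifferentiableAt_extend I E v
  have hu : (paramDeriv I ψ z).inverse u = pullField I ψ X z := by simp [pullField, X]
  have hv : (paramDeriv I ψ z).inverse v = pullField I ψ Y z := by simp [pullField, Y]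
  have e : nijenhuis J (ψ z) u v = nijenhuisField J X Y (ψ z) := rfl
  have b1 := h.pullField_mlieBracket (J.mdifferentiableAt_apply hX) (J.mdifferentiableAt_apply hY)
  have b2 := h.pullField_mlieBracket (J.mdifferentiableAt_apply hX) hY
  have b3 := h.pullField_mlieBracket hX (J.mdifferentiableAt_apply hY)
  have b4 := h.pullField_mlieBracket hX hY
  rw [e, nijenhuisField]
  simp only [map_sub, h.inverse_endo]
  rw [hu, hv]
  simp only [pullField] at b1 b2 b3 b4
  rw [b1, b2, b3, b4]
  simp only [h.inverse_endo]
  simp only [← pullField.eq_1, h.fderiv_pullField_acs J hX, h.fderiv_pullField_acs J hY,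
    map_add, map_sub, h.pullEndo_sq J, flatNijenhuis]
  abel

end IsParamAt

theorem chartDeriv_mfderiv {E₂ : Type*} [NormedAddCommGroup E₂] [NormedSpace ℝ E₂]
    {H₂ : Type*} [TopologicalSpace H₂] {I₂ : ModelWithCorners ℝ E₂ H₂}
    {P : Type*} [TopologicalSpace P] [ChartedSpace H₂ P] {f : P → M} {y : P} {p : M}
    (hf : MDiffAt f y) (hy : f y ∈ (extChartAt I p).source) (v : TangentSpace I₂ y) :
    chartDeriv I p (f y) (mfderiv I₂ I f y v)
      = mfderiv I₂ 𝓘(ℝ, E) (fun x ↦ extChartAt I p (f x)) y v := by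
  have h1 := (mdifferentiableAt_extChartAt (I := I) (x := p) (y := f y)
    (by simpa using hy)).hasMFDerivAt
  have h2 := (h1.comp y hf.hasMFDerivAt).mfderiv
  exact (congrArg (fun g : TangentSpace I₂ y →L[ℝ] E ↦ g v) h2).symm

theorem chartDeriv_mfderiv_of_eq {E₂ : Type*} [NormedAddCommGroup E₂] [NormedSpace ℝ E₂]
    {H₂ : Type*} [TopologicalSpace H₂] {I₂ : ModelWithCorners ℝ E₂ H₂}
    {P : Type*} [TopologicalSpace P] [ChartedSpace H₂ P] {f : P → M} {y : P} {p x : M}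
    (hf : MDiffAt f y) (hx : f y = x) (hy : x ∈ (extChartAt I p).source) (v : TangentSpace I₂ y) :
    chartDeriv I p x (mfderiv I₂ I f y v : TangentSpace I (f y))
      = mfderiv I₂ 𝓘(ℝ, E) (fun x ↦ extChartAt I p (f x)) y v := by
  subst hx
  exact chartDeriv_mfderiv hf hy v

variable [I.Boundaryless]

theorem chartDeriv_endo {p x : M} (hx : x ∈ (extChartAt I p).source)
    (A : Π x : M, TangentSpace I x →L[ℝ] TangentSpace I x) (v : TangentSpace I x) :
    chartDeriv I p x (A x v)
      = pullEndo I (extChartAt I p).symm A (extChartAt I p x) (chartDeriv I p x v) := by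
  obtain ⟨z, hz, rfl⟩ : ∃ z ∈ (extChartAt I p).target, (extChartAt I p).symm z = x :=
    ⟨_, (extChartAt I p).map_source hx, (extChartAt I p).left_inv hx⟩
  rw [(extChartAt I p).right_inv hz, ← inverse_paramDeriv_extChartAt_symm hz,
    (isParamAt_extChartAt_symm p hz).inverse_endo]

theorem chartDeriv_nijenhuis [FiniteDimensional ℝ E] (J : AlmostComplexStructure I M) {p x : M}
    (hx : x ∈ (extChartAt I p).source) (u v : TangentSpace I x) :
    chartDeriv I p x (nijenhuis J x u v)
      = flatNijenhuis (pullEndo I (extChartAt I p).symm J) (extChartAt I p x)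
        (chartDeriv I p x u) (chartDeriv I p x v) := by
  have : CompleteSpace E := FiniteDimensional.complete ℝ E
  obtain ⟨z, hz, rfl⟩ : ∃ z ∈ (extChartAt I p).target, (extChartAt I p).symm z = x :=
    ⟨_, (extChartAt I p).map_source hx, (extChartAt I p).left_inv hx⟩
  rw [(extChartAt I p).right_inv hz, ← inverse_paramDeriv_extChartAt_symm hz,
    (isParamAt_extChartAt_symm p hz).inverse_nijenhuis]

/-- A field of endomorphisms is smooth if it is smooth in an extended chart. -/
theorem smoothEndoAt_of_chart [CompleteSpace E] {p x : M} (hx : x ∈ (extChartAt I p).source)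
    {A : Π x : M, TangentSpace I x →L[ℝ] TangentSpace I x}
    (hA : ContDiffAt ℝ ∞ (pullEndo I (extChartAt I p).symm A) (extChartAt I p x)) :
    SmoothEndoAt A x :=
  (isParamAt_extChartAt_symm p ((extChartAt I p).map_source hx)).smoothEndoAt_of_pullEndo
    (contMDiffAt_extChartAt' (by simpa using hx)) rfl
    (by filter_upwards [(isOpen_extChartAt_source p).mem_nhds hx] with y hy
        using (extChartAt I p).left_inv hy) hA

end Param


/-! ### Coordinates on the total space of a vector bundle -/
section TotalSpaceCoord
variable {EL : Type*} [NormedAddCommGroup EL] [NormedSpace ℝ EL]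
  {HL : Type*} [TopologicalSpace HL] {IL : ModelWithCorners ℝ EL HL}
  {L : Type*} [TopologicalSpace L] [ChartedSpace HL L]
  {F : Type*} [NormedAddCommGroup F] [NormedSpace ℝ F]
  {N : L → Type*} [TopologicalSpace (TotalSpace F N)]
  [∀ x, AddCommGroup (N x)] [∀ x, Module ℝ (N x)] [∀ x, TopologicalSpace (N x)]
  [FiberBundle F N]

variable (IL F N) in
/-- The points of the base over which both the chart and the trivialization centred at `x₀` are
defined. -/
def coordDom (x₀ : L) : Set L :=
  (extChartAt IL x₀).source ∩ (trivializationAt F N x₀).baseSet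

theorem isOpen_coordDom (x₀ : L) : IsOpen (coordDom IL F N x₀) :=
  (isOpen_extChartAt_source x₀).inter (trivializationAt F N x₀).open_baseSet

theorem mem_coordDom_self (x₀ : L) : x₀ ∈ coordDom IL F N x₀ :=
  ⟨mem_extChartAt_source x₀, FiberBundle.mem_baseSet_trivializationAt' x₀⟩

theorem mem_extChartAt_zeroSection_source {x₀ : L} {p : TotalSpace F N} :
    p ∈ (extChartAt (IL.prod 𝓘(ℝ, F)) (zeroSection F N x₀)).source ↔
      p.proj ∈ coordDom IL F N x₀ := by
  rw [FiberBundle.extChartAt]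
  simp only [coordDom, mfld_simps, PartialEquiv.trans_source, Trivialization.mem_source,
    Set.mem_inter_iff, Set.mem_preimage, Set.mem_prod, Set.mem_univ, and_true]
  constructor
  · rintro ⟨h1, h2⟩
    exact ⟨by simpa [Trivialization.coe_fst' _ h1] using h2, h1⟩
  · rintro ⟨h1, h2⟩
    exact ⟨h2, by simpa [Trivialization.coe_fst' _ h2] using h1⟩

variable (F N) in
/-- The differential at `p` of the chart of the total space that is given by the chart and the
trivialization centred at `x₀`. -/
def totalDeriv (IL : ModelWithCorners ℝ EL HL) (x₀ : L) (p : TotalSpace F N) :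
    TangentSpace (IL.prod 𝓘(ℝ, F)) p →L[ℝ] EL × F :=
  chartDeriv (IL.prod 𝓘(ℝ, F)) (zeroSection F N x₀) p

variable [VectorBundle ℝ F N]

variable (F) in
/-- The fibre coordinate over `x` of the trivialization centred at `x₀`. -/
def fiberCoord (x₀ x : L) : N x →L[ℝ] F := (trivializationAt F N x₀).continuousLinearMapAt ℝ x

variable (F N) in
/-- The inverse of the fibre coordinate over `x` of the trivialization centred at `x₀`. -/
def fiberCoordSymm (x₀ x : L) : F →L[ℝ] N x := (trivializationAt F N x₀).symmL ℝ x

theorem fiberCoord_symm {x₀ x : L} (hx : x ∈ coordDom IL F N x₀) (w : F) :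
    fiberCoord F x₀ x (fiberCoordSymm F N x₀ x w) = w :=
  (trivializationAt F N x₀).continuousLinearMapAt_symmL hx.2 w

theorem fiberCoordSymm_coord {x₀ x : L} (hx : x ∈ coordDom IL F N x₀) (w : N x) :
    fiberCoordSymm F N x₀ x (fiberCoord F x₀ x w) = w :=
  (trivializationAt F N x₀).symmL_continuousLinearMapAt hx.2 w

theorem trivializationAt_snd {x₀ x : L} (hx : x ∈ coordDom IL F N x₀) (a : N x) :
    (trivializationAt F N x₀ ⟨x, a⟩).2 = fiberCoord F x₀ x a := by
  rw [fiberCoord, Trivialization.continuousLinearMapAt_apply,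
    Trivialization.coe_linearMapAt_of_mem _ hx.2]

theorem extChartAt_zeroSection_apply {x₀ x : L} (hx : x ∈ coordDom IL F N x₀) (a : N x) :
    extChartAt (IL.prod 𝓘(ℝ, F)) (zeroSection F N x₀) ⟨x, a⟩
      = (extChartAt IL x₀ x, fiberCoord F x₀ x a) := by
  rw [← trivializationAt_snd hx, FiberBundle.extChartAt]
  have : (trivializationAt F N x₀ ⟨x, a⟩).1 = x := Trivialization.coe_fst' _ (by simpa using hx.2)
  simp [this]

theorem fiberCoord_injective {x₀ x : L} (hx : x ∈ coordDom IL F N x₀) :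
    Function.Injective (fiberCoord F x₀ x : N x →L[ℝ] F) :=
  Function.LeftInverse.injective (fiberCoordSymm_coord hx)

variable (F) in
/-- The section `s` in the trivialization centred at `x₀`. -/
def localSection (x₀ : L) (s : Π x, N x) (x : L) : F := fiberCoord F x₀ x (s x)

variable [IsManifold IL ∞ L] [ContMDiffVectorBundle ∞ F N IL]

theorem totalDeriv_isInvertible {x₀ : L} {p : TotalSpace F N}
    (hp : p.proj ∈ coordDom IL F N x₀) : (totalDeriv F N IL x₀ p).IsInvertible :=
  chartDeriv_isInvertible (mem_extChartAt_zeroSection_source.2 hp)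

variable [∀ x, IsTopologicalAddGroup (N x)] [∀ x, ContinuousSMul ℝ (N x)]

theorem mdifferentiableAt_fiberLine {x : L} (a w : N x) (t : ℝ) :
    MDifferentiableAt 𝓘(ℝ, ℝ) (IL.prod 𝓘(ℝ, F))
      (fun t : ℝ ↦ (⟨x, a + t • w⟩ : TotalSpace F N)) t := by
  refine ContMDiffAt.mdifferentiableAt (n := ∞) ?_ (by simp)
  refine ((trivializationAt F N x).contMDiffAt_iff ?_).2 ⟨contMDiffAt_const, ?_⟩
  · simp [Trivialization.mem_source, FiberBundle.mem_baseSet_trivializationAt' x]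
  · have : (fun t : ℝ ↦ (trivializationAt F N x ⟨x, a + t • w⟩).2)
        = fun t : ℝ ↦ fiberCoord F x x a + t • fiberCoord F x x w := by
      ext t
      rw [trivializationAt_snd (mem_coordDom_self (IL := IL) x), map_add, map_smul]
    rw [this, contMDiffAt_iff_contDiffAt]
    fun_prop

theorem totalDeriv_vert {x₀ x : L} (hx : x ∈ coordDom IL F N x₀) (a w : N x) :
    totalDeriv F N IL x₀ ⟨x, a⟩ (vert IL F a w) = (0, fiberCoord F x₀ x w) := by
  refine (chartDeriv_mfderiv_of_eq (mdifferentiableAt_fiberLine a w 0) (by simp)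
    (mem_extChartAt_zeroSection_source.2 hx) (1 : ℝ)).trans ?_
  have he : (fun t : ℝ ↦ extChartAt (IL.prod 𝓘(ℝ, F)) (zeroSection F N x₀) ⟨x, a + t • w⟩)
      = fun t : ℝ ↦ ((extChartAt IL x₀ x,
        fiberCoord F x₀ x a + t • fiberCoord F x₀ x w) : EL × F) := by
    ext1 t
    rw [extChartAt_zeroSection_apply hx, map_add, map_smul]
  have h : HasFDerivAt (fun t : ℝ ↦ ((extChartAt IL x₀ x,
      fiberCoord F x₀ x a + t • fiberCoord F x₀ x w) : EL × F))
      ((0 : ℝ →L[ℝ] EL).prod ((ContinuousLinearMap.id ℝ ℝ).smulRight (fiberCoord F x₀ x w))) 0 :=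
    (hasFDerivAt_const _ _).prodMk (((hasFDerivAt_id (𝕜 := ℝ) (0 : ℝ)).smul_const _).const_add _)
  rw [← he] at h
  have h' := congrArg (fun g : ℝ →L[ℝ] EL × F ↦ g 1) h.hasMFDerivAt.mfderiv
  refine h'.trans ?_
  simp

theorem mdifferentiableAt_section_iff_localSection {x₀ x : L} (hx : x ∈ coordDom IL F N x₀)
    {s : Π x, N x} :
    MDiffAt (T% s) x ↔ MDifferentiableAt IL 𝓘(ℝ, F) (localSection F x₀ s) x := by
  rw [(trivializationAt F N x₀).mdifferentiableAt_section_iff IL s hx.2]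
  refine Filter.EventuallyEq.mdifferentiableAt_iff ?_
  filter_upwards [(isOpen_coordDom (IL := IL) (F := F) (N := N) x₀).mem_nhds hx] with y hy
  exact trivializationAt_snd hy _

theorem totalDeriv_section {x₀ x : L} (hx : x ∈ coordDom IL F N x₀) {s : Π x, N x}
    (hs : MDiffAt (T% s) x) (u : TangentSpace IL x) :
    totalDeriv F N IL x₀ ⟨x, s x⟩
        (mfderiv IL (IL.prod 𝓘(ℝ, F)) (fun x' ↦ (⟨x', s x'⟩ : TotalSpace F N)) x u)
      = (chartDeriv IL x₀ x u, mvfderiv IL (localSection F x₀ s) x u) := by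
  have h1 := chartDeriv_mfderiv (p := zeroSection F N x₀) hs
    (mem_extChartAt_zeroSection_source.2 hx) u
  refine h1.trans ?_
  have h2 : (fun x' ↦ extChartAt (IL.prod 𝓘(ℝ, F)) (zeroSection F N x₀) ⟨x', s x'⟩) =ᶠ[𝓝 x]
      fun x' ↦ (extChartAt IL x₀ x', localSection F x₀ s x') := by
    filter_upwards [(isOpen_coordDom (IL := IL) (F := F) (N := N) x₀).mem_nhds hx] with y hy
    exact extChartAt_zeroSection_apply hy _
  have h3 := (mdifferentiableAt_extChartAt (I := IL) (x := x₀) (y := x)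
    (by simpa using hx.1)).hasMFDerivAt
  have h4 := ((mdifferentiableAt_section_iff_localSection hx).1 hs).hasMFDerivAt
  have h5' : HasMFDerivAt IL 𝓘(ℝ, EL × F)
      (fun x' ↦ (extChartAt IL x₀ x', localSection F x₀ s x')) x
      ((chartDeriv IL x₀ x).prod (mvfderiv IL (localSection F x₀ s) x)) :=
    ⟨h3.1.prodMk h4.1, h3.2.prodMk h4.2⟩
  have h5 := h5'.congr_of_eventuallyEq h2
  exact congrArg (fun g : TangentSpace IL x →L[ℝ] EL × F ↦ g u) h5.mfderiv

theorem totalDeriv_proj {x₀ : L} {p : TotalSpace F N} (hp : p.proj ∈ coordDom IL F N x₀)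
    (v : TangentSpace (IL.prod 𝓘(ℝ, F)) p) :
    chartDeriv IL x₀ p.proj
        (mfderiv (IL.prod 𝓘(ℝ, F)) IL (TotalSpace.proj : TotalSpace F N → L) p v)
      = (totalDeriv F N IL x₀ p v).1 := by
  have hd : MDifferentiableAt (IL.prod 𝓘(ℝ, F)) IL (TotalSpace.proj : TotalSpace F N → L) p :=
    (contMDiffAt_proj N (n := ∞)).mdifferentiableAt (by simp)
  refine (chartDeriv_mfderiv hd hp.1 v).trans ?_
  have h3 : HasMFDerivAt (IL.prod 𝓘(ℝ, F)) 𝓘(ℝ, EL × F)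
      (extChartAt (IL.prod 𝓘(ℝ, F)) (zeroSection F N x₀)) p (totalDeriv F N IL x₀ p) :=
    (mdifferentiableAt_extChartAt (I := IL.prod 𝓘(ℝ, F)) (x := zeroSection F N x₀) (y := p)
      (by simpa using mem_extChartAt_zeroSection_source.2 hp)).hasMFDerivAt
  have h4 := (hasFDerivAt_fst (𝕜 := ℝ) (E := EL) (F := F)
    (p := extChartAt (IL.prod 𝓘(ℝ, F)) (zeroSection F N x₀) p)).hasMFDerivAt.comp p h3
  have h5 : (fun x ↦ extChartAt IL x₀ (TotalSpace.proj x)) =ᶠ[𝓝 p]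
      Prod.fst ∘ extChartAt (IL.prod 𝓘(ℝ, F)) (zeroSection F N x₀) := by
    filter_upwards [(contMDiffAt_proj N (IB := IL) (n := ∞)).continuousAt.preimage_mem_nhds
      ((isOpen_coordDom (IL := IL) (F := F) (N := N) x₀).mem_nhds hp)] with y hy
    have := extChartAt_zeroSection_apply (IL := IL) hy y.2
    exact (congrArg Prod.fst this).symm
  exact congrArg (fun g : TangentSpace (IL.prod 𝓘(ℝ, F)) p →L[ℝ] EL ↦ g v)
    (h4.congr_of_eventuallyEq h5).mfderiv

end TotalSpaceCoord


/-! ### Fields of endomorphisms that are linear along the fibres -/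
section Flat
variable {EL : Type*} [NormedAddCommGroup EL] [NormedSpace ℝ EL]
  {F : Type*} [NormedAddCommGroup F] [NormedSpace ℝ F]

/-- The endomorphism `(u, w) ↦ (J u, c u + j w)` of a product. -/
def blockEndo (J : EL →L[ℝ] EL) (c : EL →L[ℝ] F) (j : F →L[ℝ] F) : EL × F →L[ℝ] EL × F :=
  (J ∘L ContinuousLinearMap.fst ℝ EL F).prod
    (c ∘L ContinuousLinearMap.fst ℝ EL F + j ∘L ContinuousLinearMap.snd ℝ EL F)

@[simp] theorem blockEndo_apply (J : EL →L[ℝ] EL) (c : EL →L[ℝ] F) (j : F →L[ℝ] F) (v : EL × F) :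
    blockEndo J c j v = (J v.1, c v.1 + j v.2) := rfl

/-- The part `EL → EL` of `κ` along the subspace `EL × 0`. -/
def baseBlock (κ : EL × F → EL × F →L[ℝ] EL × F) (z : EL) : EL →L[ℝ] EL :=
  ContinuousLinearMap.fst ℝ EL F ∘L κ (z, 0) ∘L ContinuousLinearMap.inl ℝ EL F

/-- The part `F → F` of `κ` along the subspace `EL × 0`. -/
def fiberBlock (κ : EL × F → EL × F →L[ℝ] EL × F) (z : EL) : F →L[ℝ] F :=
  ContinuousLinearMap.snd ℝ EL F ∘L κ (z, 0) ∘L ContinuousLinearMap.inr ℝ EL F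

/-- The derivative of the part `EL → F` of `κ` in the direction of `F`, along the subspace
`EL × 0`. -/
def mixedBlock (κ : EL × F → EL × F →L[ℝ] EL × F) (z : EL) : F →L[ℝ] EL →L[ℝ] F :=
  (ContinuousLinearMap.compL ℝ EL (EL × F) F (ContinuousLinearMap.snd ℝ EL F)) ∘L
    ((ContinuousLinearMap.compL ℝ EL (EL × F) (EL × F)).flip (ContinuousLinearMap.inl ℝ EL F)) ∘L
    fderiv ℝ κ (z, 0) ∘L ContinuousLinearMap.inr ℝ EL F

theorem baseBlock_apply (κ : EL × F → EL × F →L[ℝ] EL × F) (z u) :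
    baseBlock κ z u = (κ (z, 0) (u, 0)).1 := rfl

theorem fiberBlock_apply (κ : EL × F → EL × F →L[ℝ] EL × F) (z w) :
    fiberBlock κ z w = (κ (z, 0) (0, w)).2 := rfl

theorem mixedBlock_apply (κ : EL × F → EL × F →L[ℝ] EL × F) (z a u) :
    mixedBlock κ z a u = (fderiv ℝ κ (z, 0) (0, a) (u, 0)).2 := rfl

variable {κ : EL × F → EL × F →L[ℝ] EL × F} {z : EL}

theorem ContDiffAt.baseBlock (h : ContDiffAt ℝ ∞ κ (z, 0)) : ContDiffAt ℝ ∞ (baseBlock κ) z := by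
  have : ContDiffAt ℝ ∞ (fun z : EL ↦ κ (z, 0)) z := h.comp z (by fun_prop)
  exact contDiffAt_const.clm_comp (this.clm_comp contDiffAt_const)

theorem ContDiffAt.fiberBlock (h : ContDiffAt ℝ ∞ κ (z, 0)) :
    ContDiffAt ℝ ∞ (fiberBlock κ) z := by
  have : ContDiffAt ℝ ∞ (fun z : EL ↦ κ (z, 0)) z := h.comp z (by fun_prop)
  exact contDiffAt_const.clm_comp (this.clm_comp contDiffAt_const)

theorem ContDiffAt.mixedBlock (h : ContDiffAt ℝ ∞ κ (z, 0)) :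
    ContDiffAt ℝ ∞ (mixedBlock κ) z := by
  have : ContDiffAt ℝ ∞ (fun z : EL ↦ fderiv ℝ κ (z, 0)) z :=
    (h.fderiv_right (m := ∞) (by simp)).comp z (by fun_prop)
  exact contDiffAt_const.clm_comp (contDiffAt_const.clm_comp (this.clm_comp contDiffAt_const))

theorem ContDiffAt.blockEndo {G : Type*} [NormedAddCommGroup G] [NormedSpace ℝ G] {x : G}
    {n : WithTop ℕ∞}
    {J : G → EL →L[ℝ] EL} {c : G → EL →L[ℝ] F} {j : G → F →L[ℝ] F}
    (hJ : ContDiffAt ℝ n J x) (hc : ContDiffAt ℝ n c x) (hj : ContDiffAt ℝ n j x) :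
    ContDiffAt ℝ n (fun y ↦ blockEndo (J y) (c y) (j y)) x := by
  have e : (fun y ↦ _root_.blockEndo (J y) (c y) (j y)) = fun y ↦
      ContinuousLinearMap.inl ℝ EL F ∘L J y ∘L ContinuousLinearMap.fst ℝ EL F
      + ContinuousLinearMap.inr ℝ EL F ∘L (c y ∘L ContinuousLinearMap.fst ℝ EL F
        + j y ∘L ContinuousLinearMap.snd ℝ EL F) := by
    ext y v <;> simp
  rw [e]
  exact (contDiffAt_const.clm_comp (hJ.clm_comp contDiffAt_const)).add
    (contDiffAt_const.clm_comp ((hc.clm_comp contDiffAt_const).add (hj.clm_comp contDiffAt_const)))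

/-- A field of endomorphisms of `EL × F` that is linear along the fibres. -/
def linearModel (J : EL → EL →L[ℝ] EL) (C : EL → F →L[ℝ] EL →L[ℝ] F) (j : EL → F →L[ℝ] F)
    (q : EL × F) : EL × F →L[ℝ] EL × F :=
  blockEndo (J q.1) (C q.1 q.2) (j q.1)

/-- The tensor `n` of a field of endomorphisms that is linear along the fibres; its Nijenhuis
tensor takes `(0, b)` and `(u, w)` to `(0, n b u)`. -/
def mixedNijenhuis (J : EL → EL →L[ℝ] EL) (C : EL → F →L[ℝ] EL →L[ℝ] F) (j : EL → F →L[ℝ] F)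
    (z : EL) : F →L[ℝ] EL →L[ℝ] F :=
  C z ∘L j z - (fderiv ℝ j z ∘L J z).flip
    + (ContinuousLinearMap.compL ℝ EL F F (j z)) ∘L ((fderiv ℝ j z).flip - C z)

section Model
variable {J : EL → EL →L[ℝ] EL} {C : EL → F →L[ℝ] EL →L[ℝ] F} {j : EL → F →L[ℝ] F}

theorem mixedNijenhuis_apply (b u) :
    mixedNijenhuis J C j z b u = C z (j z b) u - fderiv ℝ j z (J z u) b
      + j z (fderiv ℝ j z u b - C z b u) := rfl

theorem ContDiffAt.linearModel (hJ : ContDiffAt ℝ ∞ J z) (hC : ContDiffAt ℝ ∞ C z)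
    (hj : ContDiffAt ℝ ∞ j z) (a : F) : ContDiffAt ℝ ∞ (linearModel J C j) (z, a) := by
  have h1 : ContDiffAt ℝ ∞ (fun q : EL × F ↦ J q.1) (z, a) := hJ.comp (z, a) contDiffAt_fst
  have h2 : ContDiffAt ℝ ∞ (fun q : EL × F ↦ C q.1) (z, a) := hC.comp (z, a) contDiffAt_fst
  have h3 : ContDiffAt ℝ ∞ (fun q : EL × F ↦ j q.1) (z, a) := hj.comp (z, a) contDiffAt_fst
  exact h1.blockEndo (h2.clm_apply contDiffAt_snd) h3

theorem ContDiffAt.mixedNijenhuis (hJ : ContDiffAt ℝ ∞ J z) (hC : ContDiffAt ℝ ∞ C z)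
    (hj : ContDiffAt ℝ ∞ j z) : ContDiffAt ℝ ∞ (mixedNijenhuis J C j) z := by
  have hd : ContDiffAt ℝ ∞ (fderiv ℝ j) z := hj.fderiv_right (by simp)
  have hflip {f : EL → EL →L[ℝ] F →L[ℝ] F} (hf : ContDiffAt ℝ ∞ f z) :
      ContDiffAt ℝ ∞ (fun y ↦ (f y).flip) z :=
    ((ContinuousLinearMap.flipₗᵢ ℝ EL F F).contDiff).contDiffAt.comp z hf
  have hc : ContDiffAt ℝ ∞ (fun y ↦ ContinuousLinearMap.compL ℝ EL F F (j y)) z :=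
    (ContinuousLinearMap.compL ℝ EL F F).contDiff.contDiffAt.comp z hj
  exact ((hC.clm_comp hj).sub (hflip (hd.clm_comp hJ))).add (hc.clm_comp ((hflip hd).sub hC))

theorem fderiv_linearModel (hJ : DifferentiableAt ℝ J z) (hC : DifferentiableAt ℝ C z)
    (hj : DifferentiableAt ℝ j z) (a : F) (v : EL × F) (y : EL × F) :
    fderiv ℝ (linearModel J C j) (z, a) v y
      = (fderiv ℝ J z v.1 y.1,
        fderiv ℝ C z v.1 a y.1 + C z v.2 y.1 + fderiv ℝ j z v.1 y.2) := by
  have h1 : HasFDerivAt (fun q : EL × F ↦ J q.1) (fderiv ℝ J z ∘L .fst ℝ EL F) (z, a) :=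
    HasFDerivAt.comp (z, a) (f := Prod.fst) (g := J) hJ.hasFDerivAt hasFDerivAt_fst
  have h2 : HasFDerivAt (fun q : EL × F ↦ C q.1) (fderiv ℝ C z ∘L .fst ℝ EL F) (z, a) :=
    HasFDerivAt.comp (z, a) (f := Prod.fst) (g := C) hC.hasFDerivAt hasFDerivAt_fst
  have h3 : HasFDerivAt (fun q : EL × F ↦ j q.1) (fderiv ℝ j z ∘L .fst ℝ EL F) (z, a) :=
    HasFDerivAt.comp (z, a) (f := Prod.fst) (g := j) hj.hasFDerivAt hasFDerivAt_fst
  have h4 := h2.clm_apply (hasFDerivAt_snd (𝕜 := ℝ) (E := EL) (F := F) (p := (z, a)))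
  have hd : DifferentiableAt ℝ (linearModel J C j) (z, a) := by
    have e : linearModel J C j = fun q ↦
        ContinuousLinearMap.inl ℝ EL F ∘L J q.1 ∘L ContinuousLinearMap.fst ℝ EL F
        + ContinuousLinearMap.inr ℝ EL F ∘L (C q.1 q.2 ∘L ContinuousLinearMap.fst ℝ EL F
          + j q.1 ∘L ContinuousLinearMap.snd ℝ EL F) := by
      ext y v <;> simp [linearModel]
    rw [e]
    have h1' := h1.differentiableAt
    have h3' := h3.differentiableAt
    have h4' := h4.differentiableAt
    fun_prop
  have e1 : fderiv ℝ (linearModel J C j) (z, a) v y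
      = fderiv ℝ (fun q ↦ linearModel J C j q y) (z, a) v := by
    rw [fderiv_clm_apply hd (by fun_prop)]
    simp
  rw [e1]
  have h5 : HasFDerivAt (fun q ↦ linearModel J C j q y) _ (z, a) :=
    (h1.clm_apply (hasFDerivAt_const y.1 (z, a))).prodMk
    ((h4.clm_apply (hasFDerivAt_const y.1 (z, a))).add
      (h3.clm_apply (hasFDerivAt_const y.2 (z, a))))
  rw [h5.fderiv]
  simp
  abel

/-- With a vertical argument `b`, the Nijenhuis tensor of a linear model is vertical, independent of
the point `a` of the fibre, and zero on vertical vectors. -/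
theorem flatNijenhuis_linearModel (hJ : DifferentiableAt ℝ J z) (hC : DifferentiableAt ℝ C z)
    (hj : DifferentiableAt ℝ j z) (a b : F) (v : EL × F) :
    flatNijenhuis (linearModel J C j) (z, a) (0, b) v = (0, mixedNijenhuis J C j z b v.1) := by
  simp only [flatNijenhuis, fderiv_linearModel hJ hC hj]
  simp [linearModel, mixedNijenhuis_apply]
  abel

/-- The corrected coefficient `C - ½ j n`, where `n` is the mixed tensor of `(J, C, j)`.
The mixed tensor of `(J, C - ½ j n, j)` vanishes. -/
def integrableMixed (J : EL → EL →L[ℝ] EL) (C : EL → F →L[ℝ] EL →L[ℝ] F) (j : EL → F →L[ℝ] F)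
    (z : EL) : F →L[ℝ] EL →L[ℝ] F :=
  C z - (1 / 2 : ℝ) • (ContinuousLinearMap.compL ℝ EL F F (j z)) ∘L mixedNijenhuis J C j z

theorem integrableMixed_apply (b u) : integrableMixed J C j z b u
    = C z b u - (1 / 2 : ℝ) • j z (mixedNijenhuis J C j z b u) := rfl

theorem ContDiffAt.integrableMixed (hJ : ContDiffAt ℝ ∞ J z) (hC : ContDiffAt ℝ ∞ C z)
    (hj : ContDiffAt ℝ ∞ j z) : ContDiffAt ℝ ∞ (integrableMixed J C j) z := by
  have hc : ContDiffAt ℝ ∞ (fun y ↦ ContinuousLinearMap.compL ℝ EL F F (j y)) z :=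
    (ContinuousLinearMap.compL ℝ EL F F).contDiff.contDiffAt.comp z hj
  exact hC.sub ((hc.clm_comp (hJ.mixedNijenhuis hC hj)).const_smul (1 / 2 : ℝ))

/-- The derivative of `j² = -1`. -/
theorem fderiv_anticomm (hj : DifferentiableAt ℝ j z)
    (h : ∀ᶠ y in 𝓝 z, ∀ w, j y (j y w) = -w) (u : EL) (w : F) :
    fderiv ℝ j z u (j z w) = -j z (fderiv ℝ j z u w) := by
  have h1 : (fun y ↦ j y (j y w)) =ᶠ[𝓝 z] fun _ ↦ -w := by
    filter_upwards [h] with y hy using hy w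
  have h2 := h1.fderiv_eq (𝕜 := ℝ)
  have hw : DifferentiableAt ℝ (fun y ↦ j y w) z := hj.clm_apply (by fun_prop)
  rw [fderiv_clm_apply hj hw, fderiv_clm_apply hj (by fun_prop)] at h2
  have h3 := congrArg (fun g : EL →L[ℝ] F ↦ g u) h2
  simp at h3
  rw [eq_neg_iff_add_eq_zero, add_comm]
  exact h3

/-- The tensor of the corrected field vanishes. -/
theorem mixedNijenhuis_integrableMixed (hj : DifferentiableAt ℝ j z)
    (h : ∀ᶠ y in 𝓝 z, ∀ w, j y (j y w) = -w) :
    mixedNijenhuis J (integrableMixed J C j) j z = 0 := by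
  have hz := h.self_of_nhds
  ext b u
  simp only [mixedNijenhuis_apply, integrableMixed_apply, map_sub, map_add, map_smul, hz,
    fderiv_anticomm hj h, map_neg, neg_apply, zero_apply]
  module

end Model
end Flat


/-! ### Linear connections in coordinates -/
section Connection
variable {EL : Type*} [NormedAddCommGroup EL] [NormedSpace ℝ EL]
  {HL : Type*} [TopologicalSpace HL] {IL : ModelWithCorners ℝ EL HL}
  {L : Type*} [TopologicalSpace L] [ChartedSpace HL L]
  {F : Type*} [NormedAddCommGroup F] [NormedSpace ℝ F]
  {N : L → Type*} [TopologicalSpace (TotalSpace F N)]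
  [∀ x, AddCommGroup (N x)] [∀ x, Module ℝ (N x)] [∀ x, TopologicalSpace (N x)]
  [FiberBundle F N] [VectorBundle ℝ F N] [IsManifold IL ∞ L] [ContMDiffVectorBundle ∞ F N IL]

theorem contMDiffAt_section_iff_localSection {x₀ x : L} (hx : x ∈ coordDom IL F N x₀)
    {s : Π x, N x} :
    ContMDiffAt IL (IL.prod 𝓘(ℝ, F)) ∞ (T% s) x ↔
      ContMDiffAt IL 𝓘(ℝ, F) ∞ (localSection F x₀ s) x := by
  refine ((trivializationAt F N x₀).contMDiffAt_section_iff hx.2).trans ?_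
  refine Filter.EventuallyEq.contMDiffAt_iff ?_
  filter_upwards [(isOpen_coordDom (IL := IL) (F := F) (N := N) x₀).mem_nhds hx] with y hy
  exact trivializationAt_snd hy _

variable [∀ x, IsTopologicalAddGroup (N x)] [∀ x, ContinuousSMul ℝ (N x)]

variable (IL) in
/-- The linear connection with Christoffel symbols `Γ` in the chart and the trivialization centred
at `x₀`. -/
def localConnection (x₀ : L) (Γ : EL → F →L[ℝ] EL →L[ℝ] F) (s : Π x, N x) (x : L) :
    TangentSpace IL x →L[ℝ] N x :=
  fiberCoordSymm F N x₀ x ∘L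
    (mvfderiv IL (localSection F x₀ s) x
      + Γ (extChartAt IL x₀ x) (localSection F x₀ s x) ∘L chartDeriv IL x₀ x)

variable {x₀ : L} {Γ : EL → F →L[ℝ] EL →L[ℝ] F}

theorem localConnection_apply (s : Π x, N x) (x : L) (u : TangentSpace IL x) :
    localConnection IL x₀ Γ s x u = fiberCoordSymm F N x₀ x
      (mvfderiv IL (localSection F x₀ s) x u
        + Γ (extChartAt IL x₀ x) (localSection F x₀ s x) (chartDeriv IL x₀ x u)) := rfl

theorem isCovariantDerivativeOn_localConnection :
    IsCovariantDerivativeOn F (localConnection (N := N) IL x₀ Γ) (coordDom IL F N x₀) where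
  add {s s' x} hs hs' hx := by
    have e : localSection F x₀ (s + s') = localSection F x₀ s + localSection F x₀ s' := by
      ext y; simp [localSection]
    ext u
    rw [localConnection_apply, e,
      mvfderiv_add ((mdifferentiableAt_section_iff_localSection hx).1 hs)
        ((mdifferentiableAt_section_iff_localSection hx).1 hs')]
    simp only [localConnection_apply, map_add, add_apply, Pi.add_apply]
    abel
  leibniz {s g x} hs hg hx := by
    have e : localSection F x₀ (g • s) = g • localSection F x₀ s := by
      ext y; simp [localSection]
    ext u
    have h1 := fiberCoordSymm_coord hx (s x)
    rw [localConnection_apply, e,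
      mvfderiv_smul hg ((mdifferentiableAt_section_iff_localSection hx).1 hs)]
    simp only [localConnection_apply, map_add, add_apply, Pi.smul_apply', map_smul, smul_apply,
      ContinuousLinearMap.smulRight_apply, localSection, h1, smul_add]
    abel

theorem fderiv_comp_extChartAt_symm [IL.Boundaryless] {x : L} (hx : x ∈ (extChartAt IL x₀).source)
    {f : L → F} (hf : MDifferentiableAt IL 𝓘(ℝ, F) f x) (v : EL) :
    fderiv ℝ (fun z ↦ f ((extChartAt IL x₀).symm z)) (extChartAt IL x₀ x) v
      = mvfderiv IL f x ((chartDeriv IL x₀ x).inverse v) := by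
  obtain ⟨z, hz, rfl⟩ : ∃ z ∈ (extChartAt IL x₀).target, (extChartAt IL x₀).symm z = x :=
    ⟨_, (extChartAt IL x₀).map_source hx, (extChartAt IL x₀).left_inv hx⟩
  have hp := isParamAt_extChartAt_symm x₀ hz
  rw [(extChartAt IL x₀).right_inv hz, ← inverse_paramDeriv_extChartAt_symm hz,
    hp.inv.inverse_inverse]
  have h1 : HasFDerivAt (fun z ↦ f ((extChartAt IL x₀).symm z))
      ((mvfderiv IL f ((extChartAt IL x₀).symm z)).comp
        (paramDeriv IL (extChartAt IL x₀).symm z)) z :=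
    (hf.hasMFDerivAt.comp z hp.mdifferentiableAt.hasMFDerivAt).hasFDerivAt
  rw [h1.fderiv]
  rfl

theorem inCoordinates_section {x : L} (hx : x ∈ coordDom IL F N x₀)
    (A : TangentSpace IL x →L[ℝ] N x) :
    ContinuousLinearMap.inCoordinates EL (TangentSpace IL : L → Type _) F N x₀ x x₀ x A
      = fiberCoord F x₀ x ∘L A ∘L (chartDeriv IL x₀ x).inverse := by
  have hx' : x ∈ (chartAt HL x₀).source := by simpa using hx.1
  have h1 : (trivializationAt EL (TangentSpace IL) x₀).continuousLinearMapAt ℝ x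
      = chartDeriv IL x₀ x :=
    TangentBundle.continuousLinearMapAt_trivializationAt hx'
  have h2 : (trivializationAt EL (TangentSpace IL) x₀).symmL ℝ x
      = (chartDeriv IL x₀ x).inverse := by
    have hi := chartDeriv_isInvertible hx.1
    ext v
    refine (hi.inverse_apply_eq.2 ?_).symm
    rw [← h1]
    exact (Trivialization.continuousLinearMapAt_symmL _ (by simpa using hx') v).symm
  rw [ContinuousLinearMap.inCoordinates, h2]
  rfl

theorem contMDiffOn_localConnection [IL.Boundaryless] {W : Set L} (hW : W ⊆ coordDom IL F N x₀)
    (hWo : IsOpen W) (hΓ : ∀ x ∈ W, ContDiffAt ℝ ∞ Γ (extChartAt IL x₀ x)) :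
    ContMDiffCovariantDerivativeOn F ∞ (localConnection (N := N) IL x₀ Γ) W where
  contMDiff {s} hs x hx := by
    refine ContMDiffAt.contMDiffWithinAt ?_
    have hm (y : L) (hy : y ∈ W) : ContMDiffAt IL 𝓘(ℝ, F) ∞ (localSection F x₀ s) y :=
      (contMDiffAt_section_iff_localSection (hW hy)).1 ((hs y hy).contMDiffAt (hWo.mem_nhds hy))
    have hc : ContDiffAt ℝ ∞ (fun z ↦ localSection F x₀ s ((extChartAt IL x₀).symm z))
        (extChartAt IL x₀ x) := by
      rw [← contMDiffAt_iff_contDiffAt]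
      refine ContMDiffAt.comp_of_eq (hm x hx) ?_ ((extChartAt IL x₀).left_inv (hW hx).1)
      exact (isParamAt_extChartAt_symm x₀ ((extChartAt IL x₀).map_source (hW hx).1)).smooth
    have hc' : ContDiffAt ℝ ∞ (fun z ↦ fderiv ℝ
        (fun z ↦ localSection F x₀ s ((extChartAt IL x₀).symm z)) z
        + Γ z (localSection F x₀ s ((extChartAt IL x₀).symm z))) (extChartAt IL x₀ x) :=
      (hc.fderiv_right (by simp)).add ((hΓ x hx).clm_apply hc)
    have h := hc'.contMDiffAt.comp x
      (contMDiffAt_extChartAt' (I := IL) (x := x₀) (by simpa using (hW hx).1))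
    refine (((trivializationAt (EL →L[ℝ] F) (fun x ↦ TangentSpace IL x →L[ℝ] N x)
      x₀).contMDiffAt_section_iff ?_)).2 ?_
    · simpa [hom_trivializationAt_baseSet, coordDom] using hW hx
    · refine h.congr_of_eventuallyEq ?_
      filter_upwards [hWo.mem_nhds hx] with y hy
      have e : ((trivializationAt (EL →L[ℝ] F) (fun x ↦ TangentSpace IL x →L[ℝ] N x)
        x₀) ⟨y, localConnection IL x₀ Γ s y⟩).2
        = ContinuousLinearMap.inCoordinates EL (TangentSpace IL : L → Type _) F N x₀ y x₀ y
          (localConnection IL x₀ Γ s y) := by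
        rw [hom_trivializationAt_apply]
      refine e.trans ?_
      rw [inCoordinates_section (hW hy)]
      ext v
      have hl := (extChartAt IL x₀).left_inv (hW hy).1
      have hi := chartDeriv_isInvertible (hW hy).1
      simp only [ContinuousLinearMap.comp_apply, localConnection_apply, fiberCoord_symm (hW hy),
        Function.comp_apply, add_apply, hi.self_apply_inverse, hl]
      rw [fderiv_comp_extChartAt_symm (hW hy).1 ((hm y hy).mdifferentiableAt (by simp))]

/-- Linear connections given on the sets of an open cover can be glued with a partition of unity;
at each point, the result is an affine combination of the given connections. -/
theorem exists_covariantDerivative_of_local [FiniteDimensional ℝ EL] [T2Space L]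
    [SigmaCompactSpace L] {κ : Type*} (W : κ → Set L) (hWo : ∀ i, IsOpen (W i))
    (hWc : Set.univ ⊆ ⋃ i, W i) (D : κ → (Π x, N x) → Π x, TangentSpace IL x →L[ℝ] N x)
    (hD : ∀ i, IsCovariantDerivativeOn F (D i) (W i))
    (hDs : ∀ i, ContMDiffCovariantDerivativeOn F ∞ (D i) (W i)) :
    ∃ D' : CovariantDerivative IL F N, D'.ContMDiffCovariantDerivative ∞ ∧
      ∀ x, ∃ (t : Finset κ) (f : κ → ℝ), ∑ i ∈ t, f i = 1 ∧ (∀ i ∈ t, x ∈ W i) ∧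
        ∀ s, D' s x = ∑ i ∈ t, f i • D i s x := by
  obtain ⟨ρ, hρ⟩ := SmoothPartitionOfUnity.exists_isSubordinate IL isClosed_univ W hWo hWc
  have hmem {x : L} {i : κ} (hi : i ∈ ρ.finsupport x) : x ∈ W i :=
    hρ i (subset_tsupport _ (by simpa using hi))
  have hsum (x : L) := ρ.sum_finsupport x (Set.mem_univ x)
  let cov (s : Π x, N x) (x : L) : TangentSpace IL x →L[ℝ] N x :=
    ∑ i ∈ ρ.finsupport x, ρ i x • D i s x
  have hcov : IsCovariantDerivativeOn F cov Set.univ :=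
    { add := fun {s s' x} hs hs' _ ↦ by
        simp only [cov, ← Finset.sum_add_distrib]
        refine Finset.sum_congr rfl fun i hi ↦ ?_
        rw [(hD i).add hs hs' (hmem hi), smul_add]
      leibniz := fun {s g x} hs hg _ ↦ by
        calc ∑ i ∈ ρ.finsupport x, ρ i x • D i (g • s) x
            = ∑ i ∈ ρ.finsupport x, (g x • ρ i x • D i s x
              + ρ i x • (d% g x).smulRight (s x)) := by
              refine Finset.sum_congr rfl fun i hi ↦ ?_
              rw [(hD i).leibniz hs hg (hmem hi)]
              module
          _ = _ := by
              rw [Finset.sum_add_distrib, ← Finset.smul_sum, ← Finset.sum_smul, hsum, one_smul] }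
  refine ⟨⟨cov, hcov⟩, ⟨⟨fun {s} hs x _ ↦ ?_⟩⟩, fun x ↦ ⟨ρ.finsupport x, fun i ↦ ρ i x, hsum x,
    fun i hi ↦ hmem hi, fun s ↦ rfl⟩⟩
  refine ContMDiffAt.contMDiffWithinAt ?_
  have h1 : ContMDiffAt IL (IL.prod 𝓘(ℝ, EL →L[ℝ] F)) ∞
      (fun y ↦ (⟨y, ∑ i ∈ ρ.fintsupport x, ρ i y • D i s y⟩ :
        TotalSpace (EL →L[ℝ] F) fun x ↦ TangentSpace IL x →L[ℝ] N x)) x := by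
    refine ContMDiffAt.sum_section fun i hi ↦ ?_
    have hx : x ∈ W i := hρ i ((ρ.mem_fintsupport_iff x i).1 hi)
    exact ((ρ i).contMDiff x).smul_section
      (((hDs i).contMDiff (fun y hy ↦ (hs y trivial).mono (Set.subset_univ _))).contMDiffAt
        ((hWo i).mem_nhds hx))
  refine h1.congr_of_eventuallyEq ?_
  filter_upwards [ρ.eventually_finsupport_subset x] with y hy
  congr 1
  refine Finset.sum_subset hy fun i _ hi ↦ ?_
  have : ρ i y = 0 := by simpa using hi
  rw [this, zero_smul]

end Connection


/-! ### Pseudoholomorphic vector bundles in coordinates -/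
section NijenhuisLinear
variable {E : Type*} [NormedAddCommGroup E] [NormedSpace ℝ E] [FiniteDimensional ℝ E]
  {H : Type*} [TopologicalSpace H] {I : ModelWithCorners ℝ E H}
  {M : Type*} [TopologicalSpace M] [ChartedSpace H M] [IsManifold I ∞ M]

theorem nijenhuis_swap (J : AlmostComplexStructure I M) (x : M) (u v : TangentSpace I x) :
    nijenhuis J x v u = -nijenhuis J x u v := nijenhuisField_swap J _ _ x

theorem mlieBracket_neg_right {X Y : Π x : M, TangentSpace I x} {x : M}
    (hY : MDiffAt (T% Y) x) : mlieBracket I X (fun y ↦ -Y y) x = -mlieBracket I X Y x := by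
  have h := mlieBracket_const_smul_right (I := I) (V := X) (W := Y) (x := x) (c := (-1 : ℝ)) hY
  have e : ((-1 : ℝ) • Y) = fun y ↦ -Y y := by ext y; simp
  rw [e] at h
  simpa using h

theorem nijenhuis_acs_right (J : AlmostComplexStructure I M) (x : M) (u v : TangentSpace I x) :
    nijenhuis J x u (J x v) = -J x (nijenhuis J x u v) := by
  set X := FiberBundle.extend E u
  set Y := FiberBundle.extend E v
  have hX : MDiffAt (T% X) x := FiberBundle.mdifferentiableAt_extend I E u
  have hY : MDiffAt (T% Y) x := FiberBundle.mdifferentiableAt_extend I E v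
  have hu : u = X x := by simp [X]
  have hv : v = Y x := by simp [Y]
  have e : (fun y ↦ J y (J y (Y y))) = fun y ↦ -Y y := by ext y; rw [J.sq_eq_neg]
  have h1 := nijenhuis_apply J hX (J.mdifferentiableAt_apply hY)
  have h2 := nijenhuis_apply J hX hY
  rw [← hu, ← hv] at *
  rw [h1, h2]
  simp only [nijenhuisField, mlieBracket_neg_right hY, map_sub, map_neg, J.sq_eq_neg]
  abel
end NijenhuisLinear

section PH
variable {EL : Type*} [NormedAddCommGroup EL] [NormedSpace ℝ EL] [FiniteDimensional ℝ EL]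
  {HL : Type*} [TopologicalSpace HL] {IL : ModelWithCorners ℝ EL HL} [IL.Boundaryless]
  {L : Type*} [TopologicalSpace L] [ChartedSpace HL L]
  {F : Type*} [NormedAddCommGroup F] [NormedSpace ℝ F] [FiniteDimensional ℝ F]
  {N : L → Type*} [TopologicalSpace (TotalSpace F N)]
  [∀ x, AddCommGroup (N x)] [∀ x, Module ℝ (N x)] [∀ x, TopologicalSpace (N x)]
  [FiberBundle F N] [VectorBundle ℝ F N] [IsManifold IL ∞ L] [ContMDiffVectorBundle ∞ F N IL]

/-- A field of endomorphisms on the base, read in the chart centred at `x₀`. -/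
def baseEndo (x₀ : L) (J : Π x : L, TangentSpace IL x →L[ℝ] TangentSpace IL x) :
    EL → EL →L[ℝ] EL :=
  pullEndo IL (extChartAt IL x₀).symm J

/-- A field of endomorphisms on the total space, read in the chart and the trivialization centred
at `x₀`. -/
def bundleEndo (x₀ : L)
    (K : Π p : TotalSpace F N, TangentSpace (IL.prod 𝓘(ℝ, F)) p →L[ℝ]
      TangentSpace (IL.prod 𝓘(ℝ, F)) p) :
    EL × F → EL × F →L[ℝ] EL × F :=
  pullEndo (IL.prod 𝓘(ℝ, F)) (extChartAt (IL.prod 𝓘(ℝ, F)) (zeroSection F N x₀)).symm K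

variable {x₀ x : L}

theorem chartDeriv_baseEndo (hx : x ∈ coordDom IL F N x₀)
    (J : Π x : L, TangentSpace IL x →L[ℝ] TangentSpace IL x) (u : TangentSpace IL x) :
    chartDeriv IL x₀ x (J x u) = baseEndo x₀ J (extChartAt IL x₀ x) (chartDeriv IL x₀ x u) :=
  chartDeriv_endo hx.1 J u

theorem totalDeriv_bundleEndo (hx : x ∈ coordDom IL F N x₀)
    (K : Π p : TotalSpace F N, TangentSpace (IL.prod 𝓘(ℝ, F)) p →L[ℝ]
      TangentSpace (IL.prod 𝓘(ℝ, F)) p) (a : N x)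
    (v : TangentSpace (IL.prod 𝓘(ℝ, F)) (⟨x, a⟩ : TotalSpace F N)) :
    totalDeriv F N IL x₀ ⟨x, a⟩ (K ⟨x, a⟩ v)
      = bundleEndo x₀ K (extChartAt IL x₀ x, fiberCoord F x₀ x a)
        (totalDeriv F N IL x₀ ⟨x, a⟩ v) := by
  rw [← extChartAt_zeroSection_apply hx]
  exact chartDeriv_endo (mem_extChartAt_zeroSection_source.2 hx) K v

theorem mem_extChartAt_zeroSection_target (hx : x ∈ coordDom IL F N x₀) (w : F) :
    (extChartAt IL x₀ x, w) ∈ (extChartAt (IL.prod 𝓘(ℝ, F)) (zeroSection F N x₀)).target := by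
  have h := extChartAt_zeroSection_apply hx (fiberCoordSymm F N x₀ x w)
  rw [fiberCoord_symm hx] at h
  rw [← h]
  exact (extChartAt _ _).map_source (mem_extChartAt_zeroSection_source.2 hx)

theorem contDiffAt_bundleEndo (hx : x ∈ coordDom IL F N x₀)
    (K : AlmostComplexStructure (IL.prod 𝓘(ℝ, F)) (TotalSpace F N)) (w : F) :
    ContDiffAt ℝ ∞ (bundleEndo x₀ K) (extChartAt IL x₀ x, w) :=
  (isParamAt_extChartAt_symm _ (mem_extChartAt_zeroSection_target hx w)).contDiffAt_pullEndo_acs K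

theorem bundleEndo_sq (hx : x ∈ coordDom IL F N x₀)
    (K : AlmostComplexStructure (IL.prod 𝓘(ℝ, F)) (TotalSpace F N)) (w : F) (v : EL × F) :
    bundleEndo x₀ K (extChartAt IL x₀ x, w) (bundleEndo x₀ K (extChartAt IL x₀ x, w) v) = -v :=
  (isParamAt_extChartAt_symm _ (mem_extChartAt_zeroSection_target hx w)).pullEndo_sq K v

theorem contDiffAt_baseEndo (hx : x ∈ coordDom IL F N x₀) (J : AlmostComplexStructure IL L) :
    ContDiffAt ℝ ∞ (baseEndo x₀ J) (extChartAt IL x₀ x) :=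
  (isParamAt_extChartAt_symm _ ((extChartAt IL x₀).map_source hx.1)).contDiffAt_pullEndo_acs J

/-- In the coordinates centred at `x₀`, on the fibre over `x`, the field `K` covers `JL`, is
constant in the direction of the fibre and depends linearly on the point of the fibre. -/
def IsFiberLinearAt (JL : AlmostComplexStructure IL L)
    (K : AlmostComplexStructure (IL.prod 𝓘(ℝ, F)) (TotalSpace F N)) (x₀ x : L) : Prop :=
  ∃ (C : F →L[ℝ] EL →L[ℝ] F) (j : F →L[ℝ] F), ∀ a, bundleEndo x₀ K (extChartAt IL x₀ x, a)
    = blockEndo (baseEndo x₀ JL (extChartAt IL x₀ x)) (C a) j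

variable {JL : AlmostComplexStructure IL L}
  {K : AlmostComplexStructure (IL.prod 𝓘(ℝ, F)) (TotalSpace F N)}

theorem blocks_eq_of_linear {κ : EL × F → EL × F →L[ℝ] EL × F} {z : EL}
    {J : EL →L[ℝ] EL} {C : F →L[ℝ] EL →L[ℝ] F} {j : F →L[ℝ] F}
    (hκ : DifferentiableAt ℝ κ (z, 0)) (h : ∀ a, κ (z, a) = blockEndo J (C a) j) :
    mixedBlock κ z = C ∧ fiberBlock κ z = j := by
  constructor
  · ext a u
    have h1 : HasFDerivAt (fun a : F ↦ κ (z, a)) (fderiv ℝ κ (z, 0) ∘L .inr ℝ EL F) 0 :=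
      HasFDerivAt.comp (0 : F) (g := κ) (f := fun a ↦ (z, a)) hκ.hasFDerivAt
        (hasFDerivAt_prodMk_right z 0)
    have h2 : HasFDerivAt (fun a : F ↦ (κ (z, a) (u, 0)).2)
        ((ContinuousLinearMap.snd ℝ EL F) ∘L
          (fderiv ℝ κ (z, 0) ∘L ContinuousLinearMap.inr ℝ EL F).flip (u, 0)) 0 := by
      have := (hasFDerivAt_snd (𝕜 := ℝ) (E := EL) (F := F) (p := κ (z, 0) (u, 0))).comp (0 : F)
        (h1.clm_apply (hasFDerivAt_const (u, (0 : F)) (0 : F)))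
      refine HasFDerivAt.congr_fderiv (f := fun a : F ↦ (κ (z, a) (u, 0)).2) this ?_
      ext a
      simp
    have h3 : (fun a : F ↦ (κ (z, a) (u, 0)).2) = fun a ↦ C.flip u a := by
      ext a; simp [h a]
    rw [h3] at h2
    have h4 := h2.unique (C.flip u).hasFDerivAt
    exact congrArg (fun g : F →L[ℝ] F ↦ g a) h4
  · ext w
    rw [fiberBlock_apply, h]
    simp

theorem IsFiberLinearAt.eq_linearModel (h : IsFiberLinearAt JL K x₀ x)
    (hx : x ∈ coordDom IL F N x₀) (a : F) :
    bundleEndo x₀ K (extChartAt IL x₀ x, a)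
      = linearModel (baseEndo x₀ JL) (mixedBlock (bundleEndo x₀ K)) (fiberBlock (bundleEndo x₀ K))
        (extChartAt IL x₀ x, a) := by
  obtain ⟨C, j, h⟩ := h
  obtain ⟨h1, h2⟩ := blocks_eq_of_linear
    ((contDiffAt_bundleEndo hx K 0).differentiableAt (by simp)) h
  rw [h a, linearModel, h1, h2]

variable [∀ x, IsTopologicalAddGroup (N x)] [∀ x, ContinuousSMul ℝ (N x)]

theorem totalDeriv_injective (hx : x ∈ coordDom IL F N x₀) (a : N x) :
    Function.Injective (totalDeriv F N IL x₀ (⟨x, a⟩ : TotalSpace F N)) :=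
  (totalDeriv_isInvertible (p := ⟨x, a⟩) hx).bijective.injective

theorem totalDeriv_surjective (hx : x ∈ coordDom IL F N x₀) (a : N x) :
    Function.Surjective (totalDeriv F N IL x₀ (⟨x, a⟩ : TotalSpace F N)) :=
  (totalDeriv_isInvertible (p := ⟨x, a⟩) hx).bijective.surjective

theorem vert_add (a w w' : N x) : vert IL F a (w + w') = vert IL F a w + vert IL F a w' := by
  apply totalDeriv_injective (mem_coordDom_self x) a
  simp [totalDeriv_vert (mem_coordDom_self x)]

theorem vert_smul (a w : N x) (c : ℝ) : vert IL F a (c • w) = c • vert IL F a w := by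
  apply totalDeriv_injective (mem_coordDom_self x) a
  simp [totalDeriv_vert (mem_coordDom_self x)]

variable (IL F) in
/-- The isomorphism of the fibre with the vertical space at `a`, as a linear map. -/
def vertHom (a : N x) : N x →ₗ[ℝ] TangentSpace (IL.prod 𝓘(ℝ, F)) (⟨x, a⟩ : TotalSpace F N) where
  toFun := vert IL F a
  map_add' := vert_add a
  map_smul' c w := vert_smul a w c

theorem vertHom_apply (a w : N x) : vertHom IL F a w = vert IL F a w := rfl

theorem eq_vert_of_totalDeriv_fst_eq_zero (hx : x ∈ coordDom IL F N x₀) {a : N x}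
    {v : TangentSpace (IL.prod 𝓘(ℝ, F)) (⟨x, a⟩ : TotalSpace F N)}
    (hv : (totalDeriv F N IL x₀ ⟨x, a⟩ v).1 = 0) :
    v = vert IL F a (fiberCoordSymm F N x₀ x (totalDeriv F N IL x₀ ⟨x, a⟩ v).2) := by
  apply totalDeriv_injective hx a
  rw [totalDeriv_vert hx, fiberCoord_symm hx, ← hv]

theorem totalDeriv_horizLift (hx : x ∈ coordDom IL F N x₀) {s : Π x, N x}
    (hs : MDiffAt (T% s) x) (u : TangentSpace IL x) (c : N x) :
    totalDeriv F N IL x₀ ⟨x, s x⟩ (horizLift IL F s x u c)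
      = (chartDeriv IL x₀ x u, mvfderiv IL (localSection F x₀ s) x u - fiberCoord F x₀ x c) := by
  have e : totalDeriv F N IL x₀ ⟨x, s x⟩ (horizLift IL F s x u c)
      = totalDeriv F N IL x₀ ⟨x, s x⟩
        (mfderiv IL (IL.prod 𝓘(ℝ, F)) (fun x' ↦ (⟨x', s x'⟩ : TotalSpace F N)) x u)
        - totalDeriv F N IL x₀ ⟨x, s x⟩ (vert IL F (s x) c) := map_sub _ _ _
  rw [e, totalDeriv_section hx hs, totalDeriv_vert hx]
  simp

/-- A pseudoholomorphic vector bundle structure depends linearly on the point of the fibre. -/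
theorem IsPHVectorBundle.isFiberLinearAt (hK : IsPHVectorBundle JL K)
    (hx : x ∈ coordDom IL F N x₀) : IsFiberLinearAt JL K x₀ x := by
  obtain ⟨D, -, hD⟩ := hK.connection
  obtain ⟨j, -, hj⟩ := hK.fiber x
  -- for the sections `s a` that are constant in the trivialization, `∇ (s a)` is linear in `a`; the
  -- complex linearity of their horizontal lifts determines `K` on a complement of the vertical
  -- space
  let s (a : F) (x' : L) : N x' := fiberCoordSymm F N x₀ x' a
  have hsa (a : F) : localSection F x₀ (s a) =ᶠ[𝓝 x] fun _ ↦ a := by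
    filter_upwards [(isOpen_coordDom (IL := IL) (F := F) (N := N) x₀).mem_nhds hx] with y hy
    exact fiberCoord_symm hy a
  have hs (a : F) : MDiffAt (T% (s a)) x :=
    (mdifferentiableAt_section_iff_localSection hx).2
      ((hsa a).mdifferentiableAt_iff.2 mdifferentiableAt_const)
  have hds (a : F) : mvfderiv IL (localSection F x₀ (s a)) x = 0 := by
    have h1 := (hsa a).mfderiv_eq (I := IL) (I' := 𝓘(ℝ, F))
    rw [mfderiv_const] at h1
    ext v
    exact congrArg (fun g : TangentSpace IL x →L[ℝ] F ↦ g v) h1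
  have hc := D.isCovariantDerivativeOnUniv
  let Dl : F →ₗ[ℝ] EL →L[ℝ] F :=
    { toFun := fun a ↦ fiberCoord F x₀ x ∘L D (s a) x ∘L (chartDeriv IL x₀ x).inverse
      map_add' := fun a b ↦ by
        have e : s (a + b) = s a + s b := by ext y; simp [s]
        rw [e, hc.add (hs a) (hs b)]
        ext v; simp
      map_smul' := fun r a ↦ by
        have e : s (r • a) = r • s a := by ext y; simp [s]
        rw [e, hc.smul_const r (hs a)]
        ext v; simp }
  let Dc : F →L[ℝ] EL →L[ℝ] F := LinearMap.toContinuousLinearMap Dl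
  have hDc (a : F) (u : TangentSpace IL x) :
      Dc a (chartDeriv IL x₀ x u) = fiberCoord F x₀ x (D (s a) x u) := by
    have : (chartDeriv IL x₀ x).inverse (chartDeriv IL x₀ x u) = u :=
      (chartDeriv_isInvertible hx.1).inverse_apply_self u
    simp [Dc, Dl, this]
  let ĵ : F →L[ℝ] F := fiberCoord F x₀ x ∘L j ∘L fiberCoordSymm F N x₀ x
  let Ĵ := baseEndo x₀ JL (extChartAt IL x₀ x)
  refine ⟨(ContinuousLinearMap.compL ℝ EL F F ĵ) ∘L Dc
    - ((ContinuousLinearMap.compL ℝ EL EL F).flip Ĵ) ∘L Dc, ĵ, fun a ↦ ?_⟩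
  have ha : fiberCoord F x₀ x (s a x) = a := fiberCoord_symm hx a
  have hk := totalDeriv_bundleEndo hx K (s a x)
  rw [ha] at hk
  have hvert (w : F) : bundleEndo x₀ K (extChartAt IL x₀ x, a) (0, w) = (0, ĵ w) := by
    have h1 := hk (vert IL F (s a x) (fiberCoordSymm F N x₀ x w))
    rw [hj, totalDeriv_vert hx, totalDeriv_vert hx, fiberCoord_symm hx] at h1
    exact h1.symm
  have hfst (v : EL × F) : (bundleEndo x₀ K (extChartAt IL x₀ x, a) v).1 = Ĵ v.1 := by
    obtain ⟨v, rfl⟩ := totalDeriv_surjective hx (s a x) v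
    rw [← hk, ← totalDeriv_proj (p := ⟨x, s a x⟩) hx, hK.proj,
      ← totalDeriv_proj (p := ⟨x, s a x⟩) hx]
    exact chartDeriv_baseEndo hx JL _
  have hhor (u : EL) : (bundleEndo x₀ K (extChartAt IL x₀ x, a) (u, 0)).2
      = ĵ (Dc a u) - Dc a (Ĵ u) := by
    obtain ⟨u, rfl⟩ := (chartDeriv_isInvertible hx.1).bijective.surjective u
    have h1 := hk (horizLift IL F (s a) x u (D (s a) x u))
    rw [hD (s a) x (hs a) u, totalDeriv_horizLift hx (hs a), totalDeriv_horizLift hx (hs a),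
      hds, ← hDc, ← hDc, chartDeriv_baseEndo hx] at h1
    have h2 : ((chartDeriv IL x₀ x u, (0 : TangentSpace IL x →L[ℝ] F) u
        - Dc a (chartDeriv IL x₀ x u)) : EL × F)
        = (chartDeriv IL x₀ x u, 0) + (0, -Dc a (chartDeriv IL x₀ x u)) := by simp
    rw [h2, map_add, hvert] at h1
    have h3 := (Prod.ext_iff.1 h1).2
    simp only [Prod.snd_add, zero_apply, zero_sub, map_neg] at h3
    exact (eq_add_of_add_neg_eq h3.symm).trans (neg_add_eq_sub _ _)
  ext1
  · ext u
    · simpa [Ĵ] using hfst (u, 0)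
    · simpa [Ĵ] using hhor u
  · ext w
    · simpa using congrArg Prod.fst (hvert w)
    · simpa using congrArg Prod.snd (hvert w)

end PH


/-! ### Connections with complex linear horizontal lift -/
section NIF
variable {EL : Type*} [NormedAddCommGroup EL] [NormedSpace ℝ EL] [FiniteDimensional ℝ EL]
  {HL : Type*} [TopologicalSpace HL] {IL : ModelWithCorners ℝ EL HL} [IL.Boundaryless]
  {L : Type*} [TopologicalSpace L] [ChartedSpace HL L]
  {F : Type*} [NormedAddCommGroup F] [NormedSpace ℝ F] [FiniteDimensional ℝ F]
  {N : L → Type*} [TopologicalSpace (TotalSpace F N)]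
  [∀ x, AddCommGroup (N x)] [∀ x, Module ℝ (N x)] [∀ x, TopologicalSpace (N x)]
  [FiberBundle F N] [VectorBundle ℝ F N] [IsManifold IL ∞ L] [ContMDiffVectorBundle ∞ F N IL]
  {x₀ x : L} {JL : AlmostComplexStructure IL L}
  {K : AlmostComplexStructure (IL.prod 𝓘(ℝ, F)) (TotalSpace F N)}

variable (IL) in
/-- The Christoffel symbols `-½ j C` of a connection with complex linear horizontal lift, for a
field of endomorphisms of the form `(u, w) ↦ (J u, C a u + j w)`. -/
def complexChristoffel (κ : EL × F → EL × F →L[ℝ] EL × F) (z : EL) : F →L[ℝ] EL →L[ℝ] F :=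
  (-(1 / 2) : ℝ) • (ContinuousLinearMap.compL ℝ EL F F (fiberBlock κ z)) ∘L mixedBlock κ z

theorem complexChristoffel_apply (κ : EL × F → EL × F →L[ℝ] EL × F) (z : EL) (a : F) (u : EL) :
    complexChristoffel κ z a u = (-(1 / 2) : ℝ) • fiberBlock κ z (mixedBlock κ z a u) := rfl

theorem ContDiffAt.complexChristoffel {κ : EL × F → EL × F →L[ℝ] EL × F} {z : EL}
    (h : ContDiffAt ℝ ∞ κ (z, 0)) : ContDiffAt ℝ ∞ (complexChristoffel κ) z := by
  have hc : ContDiffAt ℝ ∞ (fun y ↦ ContinuousLinearMap.compL ℝ EL F F (_root_.fiberBlock κ y)) z :=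
    contDiffAt_const.clm_apply h.fiberBlock
  exact (hc.clm_comp h.mixedBlock).const_smul (-(1 / 2) : ℝ)

namespace IsFiberLinearAt

theorem apply (h : IsFiberLinearAt JL K x₀ x) (hx : x ∈ coordDom IL F N x₀) (a : F) (v : EL × F) :
    bundleEndo x₀ K (extChartAt IL x₀ x, a) v
      = (baseEndo x₀ JL (extChartAt IL x₀ x) v.1,
        mixedBlock (bundleEndo x₀ K) (extChartAt IL x₀ x) a v.1
          + fiberBlock (bundleEndo x₀ K) (extChartAt IL x₀ x) v.2) := by
  rw [h.eq_linearModel hx]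
  rfl

theorem fiberBlock_sq (h : IsFiberLinearAt JL K x₀ x) (hx : x ∈ coordDom IL F N x₀) (w : F) :
    fiberBlock (bundleEndo x₀ K) (extChartAt IL x₀ x)
      (fiberBlock (bundleEndo x₀ K) (extChartAt IL x₀ x) w) = -w := by
  have := bundleEndo_sq hx K 0 (0, w)
  rw [h.apply hx, h.apply hx] at this
  simpa using congrArg Prod.snd this

/-- The off-diagonal part of `K² = -1`. -/
theorem mixedBlock_baseEndo (h : IsFiberLinearAt JL K x₀ x) (hx : x ∈ coordDom IL F N x₀)
    (a : F) (u : EL) :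
    mixedBlock (bundleEndo x₀ K) (extChartAt IL x₀ x) a (baseEndo x₀ JL (extChartAt IL x₀ x) u)
      = -fiberBlock (bundleEndo x₀ K) (extChartAt IL x₀ x)
        (mixedBlock (bundleEndo x₀ K) (extChartAt IL x₀ x) a u) := by
  have := bundleEndo_sq hx K a (u, 0)
  rw [h.apply hx, h.apply hx] at this
  have h2 := congrArg Prod.snd this
  simp only [map_zero, add_zero, Prod.snd_neg, neg_zero] at h2
  exact eq_neg_of_add_eq_zero_left h2

variable [∀ x, IsTopologicalAddGroup (N x)] [∀ x, ContinuousSMul ℝ (N x)]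

theorem apply_vert (h : IsFiberLinearAt JL K x₀ x) (hx : x ∈ coordDom IL F N x₀) (a w : N x) :
    K ⟨x, a⟩ (vert IL F a w) = vert IL F a (fiberCoordSymm F N x₀ x
      (fiberBlock (bundleEndo x₀ K) (extChartAt IL x₀ x) (fiberCoord F x₀ x w))) := by
  apply totalDeriv_injective hx a
  rw [totalDeriv_bundleEndo hx, h.apply hx, totalDeriv_vert hx, totalDeriv_vert hx,
    fiberCoord_symm hx]
  simp

theorem horizLift_localConnection (h : IsFiberLinearAt JL K x₀ x) (hx : x ∈ coordDom IL F N x₀)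
    {s : Π x, N x} (hs : MDiffAt (T% s) x) (u : TangentSpace IL x) :
    K ⟨x, s x⟩ (horizLift IL F s x u
        (localConnection IL x₀ (complexChristoffel (bundleEndo x₀ K)) s x u))
      = horizLift IL F s x (JL x u)
        (localConnection IL x₀ (complexChristoffel (bundleEndo x₀ K)) s x (JL x u)) := by
  apply totalDeriv_injective hx (s x)
  rw [totalDeriv_bundleEndo hx, h.apply hx, totalDeriv_horizLift hx hs, totalDeriv_horizLift hx hs,
    localConnection_apply, localConnection_apply, fiberCoord_symm hx, fiberCoord_symm hx,
    chartDeriv_baseEndo hx, complexChristoffel_apply, complexChristoffel_apply,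
    h.mixedBlock_baseEndo hx, map_neg, h.fiberBlock_sq hx]
  simp only [sub_add_cancel_left, map_neg, map_smul, h.fiberBlock_sq hx, localSection]
  congr 1
  module

end IsFiberLinearAt

variable [∀ x, IsTopologicalAddGroup (N x)] [∀ x, ContinuousSMul ℝ (N x)]

/-- An almost complex structure that, in suitable coordinates, depends linearly on the point of the
fibre makes the bundle pseudoholomorphic: locally, the connection with Christoffel symbols `-½ j C`
has a complex linear horizontal lift, and this property is stable under affine combinations. -/
theorem isPHVectorBundle_of_isFiberLinearAt [T2Space L] [SigmaCompactSpace L]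
    (h : ∀ x₀ : L, ∀ᶠ x in 𝓝 x₀, IsFiberLinearAt JL K x₀ x) : IsPHVectorBundle JL K where
  proj := by
    rintro ⟨x, a⟩ v
    have hx : x ∈ coordDom IL F N x := mem_coordDom_self x
    refine (chartDeriv_isInvertible hx.1).bijective.injective ?_
    have h1 := totalDeriv_proj (p := ⟨x, a⟩) hx (K ⟨x, a⟩ v)
    refine h1.trans ?_
    rw [totalDeriv_bundleEndo hx, (h x).self_of_nhds.apply hx]
    have h2 := totalDeriv_proj (p := ⟨x, a⟩) hx v
    rw [← h2]
    exact (chartDeriv_baseEndo hx JL _).symm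
  fiber x := by
    have hx : x ∈ coordDom IL F N x := mem_coordDom_self x
    refine ⟨fiberCoordSymm F N x x ∘L fiberBlock (bundleEndo x K) (extChartAt IL x x) ∘L
      fiberCoord F x x, fun w ↦ ?_, fun a w ↦ (h x).self_of_nhds.apply_vert hx a w⟩
    simp only [ContinuousLinearMap.comp_apply, fiberCoord_symm hx,
      (h x).self_of_nhds.fiberBlock_sq hx, map_neg, fiberCoordSymm_coord hx]
  connection := by
    have h' (x₀ : L) : ∃ W : Set L, (∀ x ∈ W, x ∈ coordDom IL F N x₀ ∧ IsFiberLinearAt JL K x₀ x) ∧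
        IsOpen W ∧ x₀ ∈ W :=
      eventually_nhds_iff.1 (Filter.Eventually.and ((isOpen_coordDom x₀).mem_nhds
        (mem_coordDom_self x₀)) (h x₀))
    choose W hW hWo hWm using h'
    obtain ⟨D, hDs, hD⟩ := exists_covariantDerivative_of_local W hWo
      (fun x _ ↦ Set.mem_iUnion.2 ⟨x, hWm x⟩)
      (fun x₀ ↦ localConnection (N := N) IL x₀ (complexChristoffel (bundleEndo x₀ K)))
      (fun x₀ ↦ isCovariantDerivativeOn_localConnection.mono fun x hx ↦ (hW x₀ x hx).1)
      (fun x₀ ↦ contMDiffOn_localConnection (fun x hx ↦ (hW x₀ x hx).1) (hWo x₀)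
        fun x hx ↦ (contDiffAt_bundleEndo (hW x₀ x hx).1 K 0).complexChristoffel)
    refine ⟨D, hDs, fun s x hs u ↦ ?_⟩
    obtain ⟨t, f, hf, htW, hDx⟩ := hD x
    have hx : x ∈ coordDom IL F N x := mem_coordDom_self x
    let j : N x →L[ℝ] N x := fiberCoordSymm F N x x ∘L
      fiberBlock (bundleEndo x K) (extChartAt IL x x) ∘L fiberCoord F x x
    have hj (w : N x) : K ⟨x, s x⟩ (vert IL F (s x) w) = vert IL F (s x) (j w) :=
      (h x).self_of_nhds.apply_vert hx _ w
    -- complex linearity of the horizontal lift is an affine condition on the connection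
    have key (A : TangentSpace IL x →L[ℝ] N x) :
        K ⟨x, s x⟩ (horizLift IL F s x u (A u)) = horizLift IL F s x (JL x u) (A (JL x u)) ↔
        vertHom IL F (s x) (A (JL x u) - j (A u))
          = mfderiv IL (IL.prod 𝓘(ℝ, F)) (fun x' ↦ (⟨x', s x'⟩ : TotalSpace F N)) x (JL x u)
            - K ⟨x, s x⟩
              (mfderiv IL (IL.prod 𝓘(ℝ, F)) (fun x' ↦ (⟨x', s x'⟩ : TotalSpace F N)) x u) := by
      rw [horizLift, horizLift, map_sub, hj, map_sub, vertHom_apply, vertHom_apply,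
        sub_eq_sub_iff_add_eq_add, sub_eq_sub_iff_add_eq_add, add_comm, eq_comm,
        add_comm (vert IL F (s x) (A (JL x u)))]
    rw [key, hDx]
    have h1 (i : L) (hi : i ∈ t) := (key _).1 ((hW i x (htW i hi)).2.horizLift_localConnection
      (hW i x (htW i hi)).1 hs u)
    have h2 : (∑ i ∈ t, f i • localConnection IL i (complexChristoffel (bundleEndo i K)) s x)
          (JL x u)
        - j ((∑ i ∈ t, f i • localConnection IL i (complexChristoffel (bundleEndo i K)) s x) u)
        = ∑ i ∈ t, f i • (localConnection IL i (complexChristoffel (bundleEndo i K)) s x (JL x u)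
          - j (localConnection IL i (complexChristoffel (bundleEndo i K)) s x u)) := by
      simp [smul_sub, Finset.sum_sub_distrib]
    rw [h2, map_sum]
    simp only [map_smul]
    rw [Finset.sum_congr rfl fun i hi ↦ by rw [h1 i hi], ← Finset.sum_smul, hf, one_smul]

/-! ### The normally integrable form -/

theorem bundleEndo_eventuallyEq (hx : x ∈ coordDom IL F N x₀)
    {K : Π p : TotalSpace F N, TangentSpace (IL.prod 𝓘(ℝ, F)) p →L[ℝ]
      TangentSpace (IL.prod 𝓘(ℝ, F)) p} {κ : EL × F → EL × F →L[ℝ] EL × F}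
    (h : ∀ᶠ y in 𝓝 x, ∀ a : F, bundleEndo x₀ K (extChartAt IL x₀ y, a)
      = κ (extChartAt IL x₀ y, a)) (a : F) :
    bundleEndo x₀ K =ᶠ[𝓝 (extChartAt IL x₀ x, a)] κ := by
  have h1 : Tendsto (fun q : EL × F ↦ (extChartAt IL x₀).symm q.1) (𝓝 (extChartAt IL x₀ x, a))
      (𝓝 x) := by
    have := ((continuousAt_extChartAt_symm' hx.1).comp_of_eq (f := Prod.fst)
      (continuousAt_fst (p := (extChartAt IL x₀ x, a))) rfl).tendsto
    simp only [Function.comp_apply, (extChartAt IL x₀).left_inv hx.1] at this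
    exact this
  have h2 : ∀ᶠ q in 𝓝 (extChartAt IL x₀ x, a), q.1 ∈ (extChartAt IL x₀).target :=
    continuousAt_fst.preimage_mem_nhds
      ((isOpen_extChartAt_target x₀).mem_nhds ((extChartAt IL x₀).map_source hx.1))
  filter_upwards [h1.eventually h, h2] with q hq hq2
  have := hq q.2
  rwa [(extChartAt IL x₀).right_inv hq2] at this

/-- If `K` is a linear model in coordinates near the fibre over `x`, then its Nijenhuis tensor with
a vertical argument is vertical, and is given by the mixed tensor. -/
theorem totalDeriv_nijenhuis_vert (hx : x ∈ coordDom IL F N x₀) {J : EL → EL →L[ℝ] EL}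
    {C : EL → F →L[ℝ] EL →L[ℝ] F} {j : EL → F →L[ℝ] F}
    (hJ : ContDiffAt ℝ ∞ J (extChartAt IL x₀ x)) (hC : ContDiffAt ℝ ∞ C (extChartAt IL x₀ x))
    (hj : ContDiffAt ℝ ∞ j (extChartAt IL x₀ x))
    (h : ∀ᶠ y in 𝓝 x, ∀ a : F, bundleEndo x₀ K (extChartAt IL x₀ y, a)
      = linearModel J C j (extChartAt IL x₀ y, a)) (a b : N x)
    (v : TangentSpace (IL.prod 𝓘(ℝ, F)) (⟨x, a⟩ : TotalSpace F N)) :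
    totalDeriv F N IL x₀ ⟨x, a⟩ (nijenhuis K ⟨x, a⟩ (vert IL F a b) v)
      = (0, mixedNijenhuis J C j (extChartAt IL x₀ x) (fiberCoord F x₀ x b)
        (totalDeriv F N IL x₀ ⟨x, a⟩ v).1) := by
  have h1 := chartDeriv_nijenhuis K (mem_extChartAt_zeroSection_source.2 hx) (vert IL F a b) v
  refine h1.trans ?_
  have h2 := bundleEndo_eventuallyEq hx h (fiberCoord F x₀ x a)
  have h3 := flatNijenhuis_linearModel (hJ.differentiableAt (by simp))
    (hC.differentiableAt (by simp)) (hj.differentiableAt (by simp)) (fiberCoord F x₀ x a)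
    (fiberCoord F x₀ x b) (totalDeriv F N IL x₀ ⟨x, a⟩ v)
  rw [← h3, extChartAt_zeroSection_apply hx]
  have h4 := totalDeriv_vert hx a b
  unfold totalDeriv at h4 ⊢
  rw [h4]
  simp only [flatNijenhuis]
  have h5 := h2.fderiv_eq (𝕜 := ℝ)
  have h6 := h2.self_of_nhds
  unfold bundleEndo at h5 h6
  rw [h5, h6]

variable (x₀) in
/-- The mixed part of the Nijenhuis tensor of `K` in the coordinates centred at `x₀`. -/
def mixedTensor (JL : AlmostComplexStructure IL L)
    (K : AlmostComplexStructure (IL.prod 𝓘(ℝ, F)) (TotalSpace F N)) : EL → F →L[ℝ] EL →L[ℝ] F :=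
  mixedNijenhuis (baseEndo x₀ JL) (mixedBlock (bundleEndo x₀ K)) (fiberBlock (bundleEndo x₀ K))

theorem nijenhuis_acs_right_vert (x : L) (a b : N x) (v) :
    nijenhuis K ⟨x, a⟩ (vert IL F a b) (K ⟨x, a⟩ v)
      = -K ⟨x, a⟩ (nijenhuis K ⟨x, a⟩ (vert IL F a b) v) := nijenhuis_acs_right K _ _ v

namespace IsPHVectorBundle

theorem eventually_linearModel (hK : IsPHVectorBundle JL K) (hx : x ∈ coordDom IL F N x₀) :
    ∀ᶠ y in 𝓝 x, ∀ a : F, bundleEndo x₀ K (extChartAt IL x₀ y, a)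
      = linearModel (baseEndo x₀ JL) (mixedBlock (bundleEndo x₀ K)) (fiberBlock (bundleEndo x₀ K))
        (extChartAt IL x₀ y, a) := by
  filter_upwards [(isOpen_coordDom (IL := IL) (F := F) (N := N) x₀).mem_nhds hx] with y hy a
  exact (hK.isFiberLinearAt hy).eq_linearModel hy a

theorem totalDeriv_nijenhuis (hK : IsPHVectorBundle JL K) (hx : x ∈ coordDom IL F N x₀)
    (a b : N x) (v : TangentSpace (IL.prod 𝓘(ℝ, F)) (⟨x, a⟩ : TotalSpace F N)) :
    totalDeriv F N IL x₀ ⟨x, a⟩ (nijenhuis K ⟨x, a⟩ (vert IL F a b) v)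
      = (0, mixedTensor x₀ JL K (extChartAt IL x₀ x) (fiberCoord F x₀ x b)
        (totalDeriv F N IL x₀ ⟨x, a⟩ v).1) :=
  totalDeriv_nijenhuis_vert hx (contDiffAt_baseEndo hx JL)
    (contDiffAt_bundleEndo hx K 0).mixedBlock (contDiffAt_bundleEndo hx K 0).fiberBlock
    (hK.eventually_linearModel hx) a b v

theorem nijenhuis_vert_vert (hK : IsPHVectorBundle JL K) (a b w : N x) :
    nijenhuis K ⟨x, a⟩ (vert IL F a b) (vert IL F a w) = 0 := by
  have hx : x ∈ coordDom IL F N x := mem_coordDom_self x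
  apply totalDeriv_injective hx a
  rw [hK.totalDeriv_nijenhuis hx, totalDeriv_vert hx]
  simp

/-- `N_K(b, ·)` takes vertical values for vertical `b`. -/
theorem exists_nijenhuis_eq_vert (hK : IsPHVectorBundle JL K) (a b : N x)
    (v : TangentSpace (IL.prod 𝓘(ℝ, F)) (⟨x, a⟩ : TotalSpace F N)) :
    ∃ w, nijenhuis K ⟨x, a⟩ (vert IL F a b) v = vert IL F a w := by
  have hx : x ∈ coordDom IL F N x := mem_coordDom_self x
  exact ⟨_, eq_vert_of_totalDeriv_fst_eq_zero hx (by rw [hK.totalDeriv_nijenhuis hx])⟩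

/-- In coordinates, the field `K - ½ K N_K(r, ·)` is obtained from `K` by correcting the mixed
block. -/
theorem bundleEndo_integrable (hK : IsPHVectorBundle JL K)
    {K' : Π p : TotalSpace F N, TangentSpace (IL.prod 𝓘(ℝ, F)) p →L[ℝ]
      TangentSpace (IL.prod 𝓘(ℝ, F)) p}
    (h : ∀ (x : L) (a : N x) (v : TangentSpace (IL.prod 𝓘(ℝ, F)) (⟨x, a⟩ : TotalSpace F N)),
      K' ⟨x, a⟩ v = K ⟨x, a⟩ v
        - (1 / 2 : ℝ) • K ⟨x, a⟩ (nijenhuis K ⟨x, a⟩ (vert IL F a a) v))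
    (hx : x ∈ coordDom IL F N x₀) (a : F) :
    bundleEndo x₀ K' (extChartAt IL x₀ x, a)
      = linearModel (baseEndo x₀ JL)
        (integrableMixed (baseEndo x₀ JL) (mixedBlock (bundleEndo x₀ K))
          (fiberBlock (bundleEndo x₀ K)))
        (fiberBlock (bundleEndo x₀ K)) (extChartAt IL x₀ x, a) := by
  obtain ⟨b, rfl⟩ : ∃ b : N x, fiberCoord F x₀ x b = a := ⟨_, fiberCoord_symm hx a⟩
  refine ContinuousLinearMap.ext fun v ↦ ?_
  obtain ⟨v, rfl⟩ := totalDeriv_surjective hx b v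
  rw [← totalDeriv_bundleEndo hx, h, map_sub, map_smul, totalDeriv_bundleEndo hx,
    totalDeriv_bundleEndo hx, hK.totalDeriv_nijenhuis hx,
    (hK.isFiberLinearAt hx).apply hx, (hK.isFiberLinearAt hx).apply hx]
  simp only [linearModel, blockEndo_apply, integrableMixed_apply, map_zero, zero_add,
    Prod.smul_mk, smul_zero, Prod.mk_sub_mk, sub_zero, mixedTensor]
  congr 1
  abel

/-- The almost complex structure `K - ½ K N_K(r, ·)`. -/
theorem exists_integrable (hK : IsPHVectorBundle JL K) :
    ∃ J₀ : AlmostComplexStructure (IL.prod 𝓘(ℝ, F)) (TotalSpace F N),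
      ∀ (x : L) (a : N x) (v : TangentSpace (IL.prod 𝓘(ℝ, F)) (⟨x, a⟩ : TotalSpace F N)),
        J₀ ⟨x, a⟩ v = K ⟨x, a⟩ v
          - (1 / 2 : ℝ) • K ⟨x, a⟩ (nijenhuis K ⟨x, a⟩ (vert IL F a a) v) := by
  -- `A = N_K(r, ·)`. From `A² = 0` and `A K = -K A` it follows that `(K - ½ K A)² = -1`.
  let A (p : TotalSpace F N) : TangentSpace (IL.prod 𝓘(ℝ, F)) p →L[ℝ]
      TangentSpace (IL.prod 𝓘(ℝ, F)) p :=
    (totalDeriv F N IL p.1 p).inverse ∘L ContinuousLinearMap.inr ℝ EL F ∘L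
      mixedTensor p.1 JL K (extChartAt IL p.1 p.1) (fiberCoord F p.1 p.1 p.2) ∘L
      ContinuousLinearMap.fst ℝ EL F ∘L totalDeriv F N IL p.1 p
  have hA (x : L) (a : N x) (v : TangentSpace (IL.prod 𝓘(ℝ, F)) (⟨x, a⟩ : TotalSpace F N)) :
      A ⟨x, a⟩ v = nijenhuis K ⟨x, a⟩ (vert IL F a a) v := by
    have hx : x ∈ coordDom IL F N x := mem_coordDom_self x
    exact ((totalDeriv_isInvertible (p := ⟨x, a⟩) hx).inverse_apply_eq).2
      (hK.totalDeriv_nijenhuis hx a a v).symm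
  have hAA (x : L) (a : N x) (v) : A ⟨x, a⟩ (A ⟨x, a⟩ v) = 0 := by
    obtain ⟨w, hw⟩ := hK.exists_nijenhuis_eq_vert a a v
    rw [hA x a v, hw, hA, hK.nijenhuis_vert_vert]
  have hAK (x : L) (a : N x) (v) : A ⟨x, a⟩ (K ⟨x, a⟩ v) = -K ⟨x, a⟩ (A ⟨x, a⟩ v) := by
    rw [hA, hA, nijenhuis_acs_right_vert]
  let T (p : TotalSpace F N) : TangentSpace (IL.prod 𝓘(ℝ, F)) p →L[ℝ]
      TangentSpace (IL.prod 𝓘(ℝ, F)) p := K p - (1 / 2 : ℝ) • (K p ∘L A p)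
  have hT (p : TotalSpace F N) (v) : T p v = K p v - (1 / 2 : ℝ) • K p (A p v) := rfl
  have hT' (x : L) (a : N x) (v) : T ⟨x, a⟩ v = K ⟨x, a⟩ v
      - (1 / 2 : ℝ) • K ⟨x, a⟩ (nijenhuis K ⟨x, a⟩ (vert IL F a a) v) := by rw [hT, hA]
  refine ⟨⟨T, fun ⟨x, a⟩ v ↦ ?_, fun ⟨x, a⟩ ↦ ?_⟩, hT'⟩
  · simp only [hT, map_sub, map_smul, hAK, hAA, K.sq_eq_neg, map_neg, map_zero]
    module
  · have hx : x ∈ coordDom IL F N x := mem_coordDom_self x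
    refine smoothEndoAt_of_chart (p := zeroSection F N x)
      (mem_extChartAt_zeroSection_source.2 hx) ?_
    have h1 : ContDiffAt ℝ ∞ (bundleEndo x K) (extChartAt IL x x, 0) := contDiffAt_bundleEndo hx K 0
    have h2 := ((contDiffAt_baseEndo hx JL).linearModel
      ((contDiffAt_baseEndo hx JL).integrableMixed h1.mixedBlock h1.fiberBlock) h1.fiberBlock
      (fiberCoord F x x a))
    rw [extChartAt_zeroSection_apply hx]
    refine h2.congr_of_eventuallyEq (bundleEndo_eventuallyEq hx ?_ _)
    filter_upwards [(isOpen_coordDom (IL := IL) (F := F) (N := N) x).mem_nhds hx] with y hy b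
    exact hK.bundleEndo_integrable hT' hy b

/-- The square of the fibre block, near a point of the chart. -/
theorem eventually_fiberBlock_sq (hK : IsPHVectorBundle JL K) (hx : x ∈ coordDom IL F N x₀) :
    ∀ᶠ z in 𝓝 (extChartAt IL x₀ x), ∀ w,
      fiberBlock (bundleEndo x₀ K) z (fiberBlock (bundleEndo x₀ K) z w) = -w := by
  have hc : Tendsto (extChartAt IL x₀).symm (𝓝 (extChartAt IL x₀ x)) (𝓝 x) := by
    have := (continuousAt_extChartAt_symm' (I := IL) hx.1).tendsto
    rwa [(extChartAt IL x₀).left_inv hx.1] at this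
  filter_upwards [hc.eventually ((isOpen_coordDom (IL := IL) (F := F) (N := N) x₀).mem_nhds hx),
    (isOpen_extChartAt_target x₀).mem_nhds ((extChartAt IL x₀).map_source hx.1)] with z hz hz' w
  have := (hK.isFiberLinearAt hz).fiberBlock_sq hz w
  rwa [(extChartAt IL x₀).right_inv hz'] at this

theorem isNormallyIntegrable_of_formula (hK : IsPHVectorBundle JL K)
    {J₀ : AlmostComplexStructure (IL.prod 𝓘(ℝ, F)) (TotalSpace F N)}
    (h : ∀ (x : L) (a : N x) (v : TangentSpace (IL.prod 𝓘(ℝ, F)) (⟨x, a⟩ : TotalSpace F N)),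
      J₀ ⟨x, a⟩ v = K ⟨x, a⟩ v
        - (1 / 2 : ℝ) • K ⟨x, a⟩ (nijenhuis K ⟨x, a⟩ (vert IL F a a) v)) :
    IsNormallyIntegrable J₀ := by
  intro x a w v
  have hx : x ∈ coordDom IL F N x := mem_coordDom_self x
  have h1 : ContDiffAt ℝ ∞ (bundleEndo x K) (extChartAt IL x x, 0) :=
    contDiffAt_bundleEndo hx K 0
  have h3 : ∀ᶠ y in 𝓝 x, ∀ a : F, bundleEndo x J₀ (extChartAt IL x y, a)
      = linearModel (baseEndo x JL)
        (integrableMixed (baseEndo x JL) (mixedBlock (bundleEndo x K))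
          (fiberBlock (bundleEndo x K)))
        (fiberBlock (bundleEndo x K)) (extChartAt IL x y, a) := by
    filter_upwards [(isOpen_coordDom (IL := IL) (F := F) (N := N) x).mem_nhds hx] with y hy b
    exact hK.bundleEndo_integrable h hy b
  have h4 := totalDeriv_nijenhuis_vert hx (contDiffAt_baseEndo hx JL)
    ((contDiffAt_baseEndo hx JL).integrableMixed h1.mixedBlock h1.fiberBlock) h1.fiberBlock h3 a w v
  rw [mixedNijenhuis_integrableMixed (h1.fiberBlock.differentiableAt (by simp))
    (hK.eventually_fiberBlock_sq hx)] at h4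
  rw [nijenhuis_swap, neg_eq_zero]
  apply totalDeriv_injective hx a
  rw [h4, map_zero]
  rfl

/-- The normally integrable form of a pseudoholomorphic vector bundle structure `K` is
`K - ½ K N_K(r, ·)`. -/
theorem isNormallyIntegrableForm_iff [T2Space L] [SigmaCompactSpace L]
    (hK : IsPHVectorBundle JL K)
    {J₀ : AlmostComplexStructure (IL.prod 𝓘(ℝ, F)) (TotalSpace F N)}
    (h : ∀ (x : L) (a : N x) (v : TangentSpace (IL.prod 𝓘(ℝ, F)) (⟨x, a⟩ : TotalSpace F N)),
      J₀ ⟨x, a⟩ v = K ⟨x, a⟩ v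
        - (1 / 2 : ℝ) • K ⟨x, a⟩ (nijenhuis K ⟨x, a⟩ (vert IL F a a) v))
    (K' : AlmostComplexStructure (IL.prod 𝓘(ℝ, F)) (TotalSpace F N)) :
    IsNormallyIntegrableForm JL K K' ↔ K' = J₀ := by
  constructor
  · intro h'
    -- `K` and its normally integrable form `K'` agree on vertical vectors, and `N_K(r, v)` is
    -- vertical; so `K'` can be replaced by `K` in the correction term
    have hv (x : L) (a w : N x) : K' ⟨x, a⟩ (vert IL F a w) = K ⟨x, a⟩ (vert IL F a w) := by
      have := h'.formula x a (vert IL F a w)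
      rw [hK.nijenhuis_vert_vert, map_zero, smul_zero, add_zero] at this
      exact this.symm
    refine AlmostComplexStructure.ext (funext fun ⟨x, a⟩ ↦ ?_)
    ext1 v
    obtain ⟨w, hw⟩ := hK.exists_nijenhuis_eq_vert a a v
    rw [h, h'.formula x a v, hw, hv]
    abel
  · rintro rfl
    refine ⟨isPHVectorBundle_of_isFiberLinearAt fun x₀ ↦ ?_, fun x a w v ↦ ?_, fun x a v ↦ ?_⟩
    · filter_upwards [(isOpen_coordDom (IL := IL) (F := F) (N := N) x₀).mem_nhds
        (mem_coordDom_self x₀)] with x hx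
      exact ⟨integrableMixed (baseEndo x₀ JL) (mixedBlock (bundleEndo x₀ K))
          (fiberBlock (bundleEndo x₀ K)) (extChartAt IL x₀ x),
        fiberBlock (bundleEndo x₀ K) (extChartAt IL x₀ x),
        fun a ↦ hK.bundleEndo_integrable h hx a⟩
    · exact hK.isNormallyIntegrable_of_formula h x a w v
    · obtain ⟨w, hw⟩ := hK.exists_nijenhuis_eq_vert a a v
      have h1 : K' ⟨x, a⟩ (vert IL F a w) = K ⟨x, a⟩ (vert IL F a w) := by
        rw [h, hK.nijenhuis_vert_vert, map_zero, smul_zero, sub_zero]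
      rw [hw, h1, h, hw]
      abel

end IsPHVectorBundle
end NIF


/-! ### Linearization of an almost complex structure along a subspace -/

section FlatAdapted
variable {EL : Type*} [NormedAddCommGroup EL] [NormedSpace ℝ EL]
  {F : Type*} [NormedAddCommGroup F] [NormedSpace ℝ F]
  {κ : EL × F → EL × F →L[ℝ] EL × F} {z : EL}

theorem fderiv_fiberBlock (hκ : DifferentiableAt ℝ κ (z, 0)) (u : EL) (w : F) :
    fderiv ℝ (fiberBlock κ) z u w = (fderiv ℝ κ (z, 0) (u, 0) (0, w)).2 := by
  have h1 : HasFDerivAt (fun z : EL ↦ κ (z, 0)) (fderiv ℝ κ (z, 0) ∘L .inl ℝ EL F) z :=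
    HasFDerivAt.comp z (g := κ) (f := fun z ↦ (z, (0 : F))) hκ.hasFDerivAt
      (hasFDerivAt_prodMk_left z 0)
  have h2 : HasFDerivAt (fiberBlock κ) _ z :=
    (hasFDerivAt_const (ContinuousLinearMap.snd ℝ EL F) z).clm_comp
      (h1.clm_comp (hasFDerivAt_const (ContinuousLinearMap.inr ℝ EL F) z))
  rw [h2.fderiv]
  simp

theorem fderiv_inl_inl_snd (hκ : DifferentiableAt ℝ κ (z, 0))
    (hC : ∀ᶠ y in 𝓝 z, ∀ u, (κ (y, 0) (u, 0)).2 = 0) (u v : EL) :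
    (fderiv ℝ κ (z, 0) (u, 0) (v, 0)).2 = 0 := by
  have h1 : HasFDerivAt (fun z : EL ↦ κ (z, 0)) (fderiv ℝ κ (z, 0) ∘L .inl ℝ EL F) z :=
    HasFDerivAt.comp z (g := κ) (f := fun z ↦ (z, (0 : F))) hκ.hasFDerivAt
      (hasFDerivAt_prodMk_left z 0)
  have h2 : HasFDerivAt (fun y : EL ↦ (κ (y, 0) (v, 0)).2) _ z :=
    (hasFDerivAt_snd (𝕜 := ℝ) (E := EL) (F := F) (p := κ (z, 0) (v, 0))).comp z
      (h1.clm_apply (hasFDerivAt_const (v, (0 : F)) z))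
  have h3 : (fun y : EL ↦ (κ (y, 0) (v, 0)).2) =ᶠ[𝓝 z] fun _ ↦ 0 := by
    filter_upwards [hC] with y hy using hy v
  have h4 := (h2.congr_of_eventuallyEq h3.symm).unique (hasFDerivAt_const 0 z)
  have h5 := congrArg (fun g : EL →L[ℝ] F ↦ g u) h4
  simpa using h5

/-- If `EL × 0` is invariant under `κ`, and `0 × F` is invariant along it, then the normal part of
the Nijenhuis tensor is the tensor of the linearization of `κ`. -/
theorem flatNijenhuis_snd (hκ : DifferentiableAt ℝ κ (z, 0))
    (hC : ∀ᶠ y in 𝓝 z, ∀ u, (κ (y, 0) (u, 0)).2 = 0)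
    {J : EL → EL →L[ℝ] EL} (hJ : ∀ u, (κ (z, 0) (u, 0)).1 = J z u) (X : EL × F) (u : EL) :
    (flatNijenhuis κ (z, 0) X (u, 0)).2
      = mixedNijenhuis J (mixedBlock κ) (fiberBlock κ) z X.2 u := by
  have hsplit (v : EL × F) : v = (v.1, 0) + (0, v.2) := by simp
  have hu (u : EL) : κ (z, 0) (u, 0) = (J z u, 0) := Prod.ext (hJ u) (hC.self_of_nhds u)
  have hk (v : EL × F) : (κ (z, 0) v).2 = fiberBlock κ z v.2 := by
    conv_lhs => rw [hsplit v, map_add]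
    rw [Prod.snd_add, hC.self_of_nhds, zero_add, fiberBlock_apply]
  have hD (v : EL × F) (u : EL) : (fderiv ℝ κ (z, 0) v (u, 0)).2 = mixedBlock κ z v.2 u := by
    conv_lhs => rw [hsplit v, map_add]
    rw [add_apply, Prod.snd_add, fderiv_inl_inl_snd hκ hC, zero_add, mixedBlock_apply]
  have hD' (u : EL) (v : EL × F) :
      (fderiv ℝ κ (z, 0) (u, 0) v).2 = fderiv ℝ (fiberBlock κ) z u v.2 := by
    conv_lhs => rw [hsplit v, map_add]
    rw [Prod.snd_add, fderiv_inl_inl_snd hκ hC, zero_add, fderiv_fiberBlock hκ]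
  simp only [flatNijenhuis, Prod.snd_sub, Prod.snd_add, hu, hk, hD, hD', mixedNijenhuis_apply,
    map_sub]
  abel

/-- The limit of the transforms of `κ` by the dilatations of the fibres is the linearization of `κ`
along the zero section. -/
theorem tendsto_dilation (hκ : DifferentiableAt ℝ κ (z, 0))
    (hC : ∀ u, (κ (z, 0) (u, 0)).2 = 0) (a : F) (v : EL × F) :
    Tendsto (fun t : ℝ ↦ ((κ (z, t • a) (v.1, t • v.2)).1, t⁻¹ • (κ (z, t • a) (v.1, t • v.2)).2))
      (𝓝[≠] 0) (𝓝 (linearModel (baseBlock κ) (mixedBlock κ) (fiberBlock κ) (z, a) v)) := by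
  have hline : HasDerivAt (fun t : ℝ ↦ (z, t • a)) ((0 : EL), a) 0 := by
    have := (hasDerivAt_id (0 : ℝ)).smul_const a
    exact (hasDerivAt_const (0 : ℝ) z).prodMk (by simpa using this)
  have h0 : ((z, (0 : ℝ) • a) : EL × F) = (z, 0) := by simp
  have h1 : HasDerivAt (fun t : ℝ ↦ κ (z, t • a)) (fderiv ℝ κ (z, 0) (0, a)) 0 :=
    HasFDerivAt.comp_hasDerivAt (l := κ) (l' := fderiv ℝ κ (z, 0)) (0 : ℝ)
      (by rw [h0]; exact hκ.hasFDerivAt) hline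
  have hc : Tendsto (fun t : ℝ ↦ κ (z, t • a)) (𝓝[≠] 0) (𝓝 (κ (z, 0))) := by
    have := h1.continuousAt.tendsto
    rw [h0] at this
    exact this.mono_left nhdsWithin_le_nhds
  have happ {f : ℝ → EL × F} {w : EL × F} (hf : Tendsto f (𝓝[≠] 0) (𝓝 w)) :
      Tendsto (fun t : ℝ ↦ κ (z, t • a) (f t)) (𝓝[≠] 0) (𝓝 (κ (z, 0) w)) :=
    (isBoundedBilinearMap_apply.continuous.tendsto (κ (z, 0), w)).comp (hc.prodMk_nhds hf)
  have ht : Tendsto (fun t : ℝ ↦ t) (𝓝[≠] 0) (𝓝 0) := tendsto_id.mono_left nhdsWithin_le_nhds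
  refine Tendsto.prodMk_nhds ?_ ?_
  · have h2 : Tendsto (fun t : ℝ ↦ (v.1, t • v.2)) (𝓝[≠] 0) (𝓝 (v.1, (0 : F))) := by
      have := ht.smul_const v.2
      rw [zero_smul] at this
      exact tendsto_const_nhds.prodMk_nhds this
    exact (continuous_fst.tendsto _).comp (happ h2)
  · have h2 : HasDerivAt (fun t : ℝ ↦ (κ (z, t • a) (v.1, 0)).2)
        (fderiv ℝ κ (z, 0) (0, a) (v.1, 0)).2 0 := by
      have h3 := h1.clm_apply (hasDerivAt_const (0 : ℝ) (v.1, (0 : F)))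
      have h4 := (hasFDerivAt_snd (𝕜 := ℝ) (E := EL) (F := F)).comp_hasDerivAt (0 : ℝ) h3
      refine HasDerivAt.congr_deriv (f := fun t : ℝ ↦ (κ (z, t • a) (v.1, 0)).2) h4 ?_
      simp
    have h3 := h2.tendsto_slope_zero
    have h4 : Tendsto (fun t : ℝ ↦ (κ (z, t • a) (0, v.2)).2) (𝓝[≠] 0)
        (𝓝 (κ (z, 0) (0, v.2)).2) :=
      (continuous_snd.tendsto _).comp (happ tendsto_const_nhds)
    refine (h3.add h4).congr' ?_
    filter_upwards [self_mem_nhdsWithin] with t ht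
    have ht : t ≠ 0 := ht
    have e : ((v.1, t • v.2) : EL × F) = (v.1, 0) + t • ((0 : EL), v.2) := by simp
    rw [e, map_add, map_smul, Prod.snd_add, Prod.smul_snd, smul_add, smul_smul,
      inv_mul_cancel₀ ht, one_smul, zero_add, h0, hC, sub_zero]

end FlatAdapted

section PullVec
variable {E : Type*} [NormedAddCommGroup E] [NormedSpace ℝ E]
  {H : Type*} [TopologicalSpace H] {I : ModelWithCorners ℝ E H}
  {M : Type*} [TopologicalSpace M] [ChartedSpace H M]
  {E' : Type*} [NormedAddCommGroup E'] [NormedSpace ℝ E']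

variable (I) in
/-- The inverse of the differential of a local parametrization `ψ` at `q`, on the tangent space at
a point `p` that is equal to `ψ q`. -/
def pullVec (ψ : E' → M) (q : E') (p : M) : TangentSpace I p →L[ℝ] E' :=
  (paramDeriv I ψ q).inverse

variable {ψ : E' → M} {q : E'} {p : M}

theorem pullVec_field (hp : ψ q = p) (X : Π x : M, TangentSpace I x) :
    pullVec I ψ q p (X p) = pullField I ψ X q := by subst hp; rfl

namespace IsParamAt

theorem pullVec_paramDeriv (h : IsParamAt I ψ q) (v : E') :
    pullVec I ψ q (ψ q) (paramDeriv I ψ q v) = v := h.inverse_deriv v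

theorem pullVec_endo (h : IsParamAt I ψ q) (hp : ψ q = p)
    (J : Π x : M, TangentSpace I x →L[ℝ] TangentSpace I x) (V : TangentSpace I p) :
    pullVec I ψ q p (J p V) = pullEndo I ψ J q (pullVec I ψ q p V) := by
  subst hp; exact h.inverse_endo J V

theorem pullVec_injective (h : IsParamAt I ψ q) (p : M) :
    Function.Injective (pullVec I ψ q p) := h.inv.inverse.bijective.injective

/-- The differential of a map into `M` that is given in a local parametrization. -/
theorem pullVec_mfderiv {E₂ : Type*} [NormedAddCommGroup E₂] [NormedSpace ℝ E₂]
    {H₂ : Type*} [TopologicalSpace H₂] {I₂ : ModelWithCorners ℝ E₂ H₂}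
    {P : Type*} [TopologicalSpace P] [ChartedSpace H₂ P] {f : P → M} {g : P → E'} {y : P}
    (h : IsParamAt I ψ (g y)) (hg : MDifferentiableAt I₂ 𝓘(ℝ, E') g y)
    (hf : f =ᶠ[𝓝 y] fun y ↦ ψ (g y)) (v : TangentSpace I₂ y) :
    pullVec I ψ (g y) (f y) (mfderiv I₂ I f y v) = mvfderiv I₂ g y v := by
  have h1 := (h.mdifferentiableAt.hasMFDerivAt.comp y hg.hasMFDerivAt).congr_of_eventuallyEq hf
  have h2 : mfderiv I₂ I f y v = paramDeriv I ψ (g y) (mvfderiv I₂ g y v) :=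
    congrArg (fun D : TangentSpace I₂ y →L[ℝ] E ↦ D v) h1.mfderiv
  exact (congrArg (fun w : E ↦ pullVec I ψ (g y) (f y) w) h2).trans (h.inverse_deriv _)

variable [IsManifold I ∞ M] [CompleteSpace E']

theorem pullVec_mlieBracket (h : IsParamAt I ψ q) (hp : ψ q = p) {X Y : Π x : M, TangentSpace I x}
    (hX : MDiffAt (T% X) p) (hY : MDiffAt (T% Y) p) :
    pullVec I ψ q p (mlieBracket I X Y p)
      = fderiv ℝ (pullField I ψ Y) q (pullVec I ψ q p (X p))
        - fderiv ℝ (pullField I ψ X) q (pullVec I ψ q p (Y p)) := by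
  subst hp; exact h.pullField_mlieBracket hX hY

theorem pullVec_nijenhuis [FiniteDimensional ℝ E] (h : IsParamAt I ψ q) (hp : ψ q = p)
    (J : AlmostComplexStructure I M) (u v : TangentSpace I p) :
    pullVec I ψ q p (nijenhuis J p u v)
      = flatNijenhuis (pullEndo I ψ J) q (pullVec I ψ q p u) (pullVec I ψ q p v) := by
  subst hp; exact h.inverse_nijenhuis J u v

/-- The field `J[U, θ] - [JU, θ]` in a local parametrization. -/
theorem pullVec_bracket (h : IsParamAt I ψ q) (hp : ψ q = p)
    (J : AlmostComplexStructure I M) {U θ : Π x : M, TangentSpace I x}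
    (hU : MDiffAt (T% U) p) (hθ : MDiffAt (T% θ) p) :
    pullVec I ψ q p (J p (mlieBracket I U θ p) - mlieBracket I (fun y ↦ J y (U y)) θ p)
      = pullEndo I ψ J q (fderiv ℝ (pullField I ψ θ) q (pullVec I ψ q p (U p)))
        - fderiv ℝ (pullField I ψ θ) q (pullEndo I ψ J q (pullVec I ψ q p (U p)))
        + fderiv ℝ (pullEndo I ψ J) q (pullVec I ψ q p (θ p)) (pullVec I ψ q p (U p)) := by
  have hJU := J.mdifferentiableAt_apply hU
  rw [map_sub, h.pullVec_endo hp, h.pullVec_mlieBracket hp hU hθ, h.pullVec_mlieBracket hp hJU hθ,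
    h.pullVec_endo hp]
  subst hp
  rw [h.fderiv_pullField_acs J hU]
  simp only [map_sub]
  have : pullVec I ψ q (ψ q) (U (ψ q)) = pullField I ψ U q := rfl
  rw [this]
  abel

end IsParamAt
end PullVec

section Immersion
variable {E : Type*} [NormedAddCommGroup E] [NormedSpace ℝ E]
  {H : Type*} [TopologicalSpace H] {I : ModelWithCorners ℝ E H} [I.Boundaryless]
  {M : Type*} [TopologicalSpace M] [ChartedSpace H M] [IsManifold I ∞ M]
  {E' : Type*} [NormedAddCommGroup E'] [NormedSpace ℝ E']
  {H' : Type*} [TopologicalSpace H'] {I' : ModelWithCorners ℝ E' H'}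
  {M' : Type*} [TopologicalSpace M'] [ChartedSpace H' M'] [IsManifold I' ∞ M']

/-- In suitable charts, an immersion is `u ↦ (u, 0)`, and hence has a differentiable left
inverse. -/
theorem mfderiv_injective_of_isImmersionAt {f : M → M'} {x : M} (h : IsImmersionAt I I' ∞ f x) :
    Function.Injective (mfderiv I I' f x) := by
  let e := h.domChart.extend I
  let e' := h.codChart.extend I'
  have hx : x ∈ e.source := by simpa [e] using h.mem_domChart_source
  have key : ∀ y ∈ e.source, e' (f y) = h.equiv (e y, 0) := by
    intro y hy
    have := h.writtenInCharts (e.map_source hy)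
    simpa [e, e', e.left_inv hy, h.domChart.left_inv (by simpa [e] using hy)] using this
  let g : M' → M := fun y ↦ e.symm (h.equiv.symm (e' y)).1
  have hg : MDifferentiableAt I' I g (f x) := by
    have h1 : MDifferentiableAt I' 𝓘(ℝ, E') e' (f x) :=
      (h.codChart.contMDiffAt_extend h.codChart_mem_maximalAtlas
        h.mem_codChart_source).mdifferentiableAt (by simp)
    have h2 : MDifferentiableAt 𝓘(ℝ, E') 𝓘(ℝ, E) (fun v ↦ (h.equiv.symm v).1) (e' (f x)) :=
      DifferentiableAt.mdifferentiableAt (by fun_prop)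
    have h3 : MDifferentiableAt 𝓘(ℝ, E) I e.symm (h.equiv.symm (e' (f x))).1 := by
      have h4 := contMDiffOn_extend_symm (I := I) h.domChart_mem_maximalAtlas
      rw [← OpenPartialHomeomorph.extend_target'] at h4
      refine (h4.contMDiffAt (h.domChart.isOpen_extend_target.mem_nhds ?_)).mdifferentiableAt
        (by simp)
      rw [key x hx]
      simp only [ContinuousLinearEquiv.symm_apply_apply]
      exact e.map_source hx
    exact MDifferentiableAt.comp (f x) (g := e.symm) h3 (h2.comp (f x) h1)
  have hf : MDifferentiableAt I I' f x := h.contMDiffAt.mdifferentiableAt (by simp)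
  have hgf : g ∘ f =ᶠ[𝓝 x] id := by
    filter_upwards [h.domChart.open_source.mem_nhds h.mem_domChart_source] with y hy
    have hy' : y ∈ e.source := by simpa [e] using hy
    simp only [Function.comp_apply, g, key y hy', ContinuousLinearEquiv.symm_apply_apply]
    exact e.left_inv hy'
  have h5 := (hg.hasMFDerivAt.comp x hf.hasMFDerivAt).congr_of_eventuallyEq hgf.symm
  have h6 := hasMFDerivAt_unique h5 (hasMFDerivAt_id x)
  intro u v huv
  have h7 (u : TangentSpace I x) : mfderiv I' I g (f x) (mfderiv I I' f x u) = u :=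
    congrArg (fun g : TangentSpace I x →L[ℝ] TangentSpace I x ↦ g u) h6
  rw [← h7 u, huv, h7 v]

end Immersion


/-! ### Adapted parametrizations -/

section Adapted
variable {EL : Type*} [NormedAddCommGroup EL] [NormedSpace ℝ EL] [FiniteDimensional ℝ EL]
  {HL : Type*} [TopologicalSpace HL] {IL : ModelWithCorners ℝ EL HL} [IL.Boundaryless]
  {L : Type*} [TopologicalSpace L] [ChartedSpace HL L]
  {F : Type*} [NormedAddCommGroup F] [NormedSpace ℝ F] [FiniteDimensional ℝ F]
  {N : L → Type*} [TopologicalSpace (TotalSpace F N)]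
  [∀ x, AddCommGroup (N x)] [∀ x, Module ℝ (N x)] [∀ x, TopologicalSpace (N x)]
  [FiberBundle F N] [VectorBundle ℝ F N] [IsManifold IL ∞ L] [ContMDiffVectorBundle ∞ F N IL]
  [∀ x, IsTopologicalAddGroup (N x)] [∀ x, ContinuousSMul ℝ (N x)]
  {EM : Type*} [NormedAddCommGroup EM] [NormedSpace ℝ EM] [FiniteDimensional ℝ EM]
  {HM : Type*} [TopologicalSpace HM] {IM : ModelWithCorners ℝ EM HM} [IM.Boundaryless]
  {M : Type*} [TopologicalSpace M] [ChartedSpace HM M] [IsManifold IM ∞ M]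

/-- A local parametrization of `M` near `ι x` by the coordinates of the bundle `N` centred at `x₀`:
it is the submanifold `ι` on the zero section, its fibre derivative along the zero section is
compatible with the projection `χ` to the normal bundle, and the image of that derivative is
invariant under `JM`. -/
structure IsAdaptedParam (IL : ModelWithCorners ℝ EL HL) (JM : AlmostComplexStructure IM M)
    (ι : L → M) (χ : Π x : L, TangentSpace IM (ι x) →L[ℝ] N x) (x₀ x : L) (ψ : EL × F → M) :
    Prop where
  isParamAt : IsParamAt IM ψ (extChartAt IL x₀ x, 0)
  base : ∀ᶠ y in 𝓝 x, ψ (extChartAt IL x₀ y, 0) = ι y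
  normal : ∀ᶠ y in 𝓝 x, ∀ V : TangentSpace IM (ι y),
    fiberCoord F x₀ y (χ y V) = (pullVec IM ψ (extChartAt IL x₀ y, 0) (ι y) V).2
  invariant : ∀ᶠ y in 𝓝 x, ∀ w : F, (pullEndo IM ψ JM (extChartAt IL x₀ y, 0) (0, w)).1 = 0

variable {JL : AlmostComplexStructure IL L} {JM : AlmostComplexStructure IM M} {ι : L → M}
  {χ : Π x : L, TangentSpace IM (ι x) →L[ℝ] N x} {x₀ x : L} {ψ ψ' : EL × F → M}

theorem tendsto_extChartAt_symm (hx : x ∈ coordDom IL F N x₀) :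
    Tendsto (extChartAt IL x₀).symm (𝓝 (extChartAt IL x₀ x)) (𝓝 x) := by
  have := (continuousAt_extChartAt_symm' (I := IL) hx.1).tendsto
  rwa [(extChartAt IL x₀).left_inv hx.1] at this

theorem eventually_extChartAt_symm (hx : x ∈ coordDom IL F N x₀) :
    ∀ᶠ z in 𝓝 (extChartAt IL x₀ x), (extChartAt IL x₀).symm z ∈ coordDom IL F N x₀ ∧
      extChartAt IL x₀ ((extChartAt IL x₀).symm z) = z := by
  filter_upwards [(tendsto_extChartAt_symm hx).eventually
    ((isOpen_coordDom (IL := IL) (F := F) (N := N) x₀).mem_nhds hx),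
    (isOpen_extChartAt_target x₀).mem_nhds ((extChartAt IL x₀).map_source hx.1)] with z hz hz'
  exact ⟨hz, (extChartAt IL x₀).right_inv hz'⟩

theorem tendsto_zeroCoord (hx : x ∈ coordDom IL F N x₀) :
    Tendsto (fun y ↦ (extChartAt IL x₀ y, (0 : F))) (𝓝 x) (𝓝 (extChartAt IL x₀ x, 0)) :=
  (continuousAt_extChartAt' hx.1).tendsto.prodMk_nhds tendsto_const_nhds

namespace IsAdaptedParam

theorem eventually (h : IsAdaptedParam IL JM ι χ x₀ x ψ) (hx : x ∈ coordDom IL F N x₀) :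
    ∀ᶠ y in 𝓝 x, IsAdaptedParam IL JM ι χ x₀ y ψ := by
  filter_upwards [(tendsto_zeroCoord hx).eventually h.isParamAt.eventually,
    h.base.eventually_nhds, h.normal.eventually_nhds, h.invariant.eventually_nhds]
    with y h1 h2 h3 h4
  exact ⟨h1, h2, h3, h4⟩

theorem eq_base (h : IsAdaptedParam IL JM ι χ x₀ x ψ) : ψ (extChartAt IL x₀ x, 0) = ι x :=
  h.base.self_of_nhds

theorem pullVec_mfderiv (h : IsAdaptedParam IL JM ι χ x₀ x ψ) (hx : x ∈ coordDom IL F N x₀)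
    (u : TangentSpace IL x) :
    pullVec IM ψ (extChartAt IL x₀ x, 0) (ι x) (mfderiv IL IM ι x u)
      = (chartDeriv IL x₀ x u, 0) := by
  have h1 : HasMFDerivAt IL 𝓘(ℝ, EL) (extChartAt IL x₀) x (chartDeriv IL x₀ x) :=
    (mdifferentiableAt_extChartAt (I := IL) (x := x₀) (y := x)
      (by simpa using hx.1)).hasMFDerivAt
  have h2 : HasMFDerivAt IL 𝓘(ℝ, EL × F) (fun y ↦ (extChartAt IL x₀ y, (0 : F))) x
      ((chartDeriv IL x₀ x).prod (0 : TangentSpace IL x →L[ℝ] F)) :=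
    ⟨h1.1.prodMk continuousAt_const, h1.2.prodMk (hasFDerivWithinAt_const _ _ _)⟩
  have h3 := IsParamAt.pullVec_mfderiv (g := fun y ↦ (extChartAt IL x₀ y, (0 : F))) (f := ι)
    h.isParamAt h2.mdifferentiableAt (h.base.mono fun y hy ↦ hy.symm) u
  refine h3.trans ?_
  exact congrArg (fun D : TangentSpace IL x →L[ℝ] EL × F ↦ D u) h2.mfderiv

/-- The submanifold `EL × 0` is pseudoholomorphic, with induced structure `JL`. -/
theorem endo_inl (h : IsAdaptedParam IL JM ι χ x₀ x ψ) (hx : x ∈ coordDom IL F N x₀)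
    (hι : IsPHSubmanifold JL JM ι) (u : EL) :
    pullEndo IM ψ JM (extChartAt IL x₀ x, 0) (u, 0)
      = (baseEndo x₀ JL (extChartAt IL x₀ x) u, 0) := by
  obtain ⟨u, rfl⟩ := (chartDeriv_isInvertible hx.1).bijective.surjective u
  rw [← h.pullVec_mfderiv hx, ← h.isParamAt.pullVec_endo h.eq_base, ← hι.comm,
    h.pullVec_mfderiv hx, chartDeriv_baseEndo hx]

theorem baseBlock_eq (h : IsAdaptedParam IL JM ι χ x₀ x ψ) (hx : x ∈ coordDom IL F N x₀)
    (hι : IsPHSubmanifold JL JM ι) :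
    baseBlock (pullEndo IM ψ JM) (extChartAt IL x₀ x) = baseEndo x₀ JL (extChartAt IL x₀ x) := by
  ext u
  rw [baseBlock_apply, h.endo_inl hx hι]

theorem eventually_endo_inl (h : IsAdaptedParam IL JM ι χ x₀ x ψ) (hx : x ∈ coordDom IL F N x₀)
    (hι : IsPHSubmanifold JL JM ι) :
    ∀ᶠ z in 𝓝 (extChartAt IL x₀ x), ∀ u, (pullEndo IM ψ JM (z, 0) (u, 0)).2 = 0 := by
  filter_upwards [(tendsto_extChartAt_symm hx).eventually (h.eventually hx),
    eventually_extChartAt_symm hx] with z h1 h2 u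
  have := h1.endo_inl h2.1 hι u
  rw [h2.2] at this
  rw [this]

theorem endo_inr (h : IsAdaptedParam IL JM ι χ x₀ x ψ) (w : F) :
    pullEndo IM ψ JM (extChartAt IL x₀ x, 0) (0, w)
      = (0, fiberBlock (pullEndo IM ψ JM) (extChartAt IL x₀ x) w) :=
  Prod.ext (h.invariant.self_of_nhds w) rfl

theorem endo_snd (h : IsAdaptedParam IL JM ι χ x₀ x ψ) (hx : x ∈ coordDom IL F N x₀)
    (hι : IsPHSubmanifold JL JM ι) (v : EL × F) :
    (pullEndo IM ψ JM (extChartAt IL x₀ x, 0) v).2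
      = fiberBlock (pullEndo IM ψ JM) (extChartAt IL x₀ x) v.2 := by
  have hv : v = (v.1, 0) + (0, v.2) := by simp
  conv_lhs => rw [hv, map_add, h.endo_inl hx hι, h.endo_inr]
  simp

theorem fiberCoord_normal (h : IsAdaptedParam IL JM ι χ x₀ x ψ) (V : TangentSpace IM (ι x)) :
    fiberCoord F x₀ x (χ x V) = (pullVec IM ψ (extChartAt IL x₀ x, 0) (ι x) V).2 :=
  h.normal.self_of_nhds V

theorem fiberCoord_endo (h : IsAdaptedParam IL JM ι χ x₀ x ψ) (hx : x ∈ coordDom IL F N x₀)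
    (hι : IsPHSubmanifold JL JM ι) (V : TangentSpace IM (ι x)) :
    fiberCoord F x₀ x (χ x (JM (ι x) V))
      = fiberBlock (pullEndo IM ψ JM) (extChartAt IL x₀ x) (fiberCoord F x₀ x (χ x V)) := by
  rw [h.fiberCoord_normal, h.isParamAt.pullVec_endo h.eq_base, h.endo_snd hx hι,
    h.fiberCoord_normal]

section Section
variable {θ : Π y : M, TangentSpace IM y}

theorem localSection_eventuallyEq (h : IsAdaptedParam IL JM ι χ x₀ x ψ)
    (hx : x ∈ coordDom IL F N x₀) (θ : Π y : M, TangentSpace IM y) :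
    localSection F x₀ (fun y ↦ χ y (θ (ι y))) =ᶠ[𝓝 x]
      fun y ↦ (pullField IM ψ θ (extChartAt IL x₀ y, 0)).2 := by
  filter_upwards [h.eventually hx] with y hy
  rw [localSection, hy.fiberCoord_normal, pullVec_field hy.eq_base]

theorem differentiableAt_pullField (h : IsAdaptedParam IL JM ι χ x₀ x ψ)
    (hθ : MDiffAt (T% θ) (ι x)) :
    DifferentiableAt ℝ (pullField IM ψ θ) (extChartAt IL x₀ x, 0) :=
  h.isParamAt.differentiableAt_pullField (by rw [h.eq_base]; exact hθ)

theorem hasMFDerivAt_localSection (h : IsAdaptedParam IL JM ι χ x₀ x ψ)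
    (hx : x ∈ coordDom IL F N x₀) (hθ : MDiffAt (T% θ) (ι x)) :
    HasMFDerivAt IL 𝓘(ℝ, F) (localSection F x₀ (fun y ↦ χ y (θ (ι y)))) x
      ((ContinuousLinearMap.snd ℝ EL F ∘L fderiv ℝ (pullField IM ψ θ) (extChartAt IL x₀ x, 0)
        ∘L ContinuousLinearMap.inl ℝ EL F).comp (chartDeriv IL x₀ x)) := by
  have h1 : HasMFDerivAt IL 𝓘(ℝ, EL) (extChartAt IL x₀) x (chartDeriv IL x₀ x) :=
    (mdifferentiableAt_extChartAt (I := IL) (x := x₀) (y := x)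
      (by simpa using hx.1)).hasMFDerivAt
  have h2 : HasFDerivAt (fun z : EL ↦ pullField IM ψ θ (z, (0 : F)))
      (fderiv ℝ (pullField IM ψ θ) (extChartAt IL x₀ x, 0) ∘L .inl ℝ EL F) (extChartAt IL x₀ x) :=
    HasFDerivAt.comp _ (g := pullField IM ψ θ) (f := fun z ↦ (z, (0 : F)))
      (h.differentiableAt_pullField hθ).hasFDerivAt (hasFDerivAt_prodMk_left _ 0)
  have h3 : HasFDerivAt (fun z : EL ↦ (pullField IM ψ θ (z, (0 : F))).2)
      (ContinuousLinearMap.snd ℝ EL F ∘L (fderiv ℝ (pullField IM ψ θ) (extChartAt IL x₀ x, 0)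
        ∘L .inl ℝ EL F)) (extChartAt IL x₀ x) :=
    (hasFDerivAt_snd (𝕜 := ℝ) (E := EL) (F := F)).comp _ h2
  exact (h3.hasMFDerivAt.comp x h1).congr_of_eventuallyEq (h.localSection_eventuallyEq hx θ)

theorem mdifferentiableAt_section (h : IsAdaptedParam IL JM ι χ x₀ x ψ)
    (hx : x ∈ coordDom IL F N x₀) (hθ : MDiffAt (T% θ) (ι x)) :
    MDiffAt (T% (fun y ↦ χ y (θ (ι y)))) x :=
  (mdifferentiableAt_section_iff_localSection hx).2
    (h.hasMFDerivAt_localSection hx hθ).mdifferentiableAt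

theorem mvfderiv_localSection (h : IsAdaptedParam IL JM ι χ x₀ x ψ)
    (hx : x ∈ coordDom IL F N x₀) (hθ : MDiffAt (T% θ) (ι x)) (u : TangentSpace IL x) :
    mvfderiv IL (localSection F x₀ (fun y ↦ χ y (θ (ι y)))) x u
      = (fderiv ℝ (pullField IM ψ θ) (extChartAt IL x₀ x, 0) (chartDeriv IL x₀ x u, 0)).2 :=
  congrArg (fun D : TangentSpace IL x →L[ℝ] F ↦ D u) (h.hasMFDerivAt_localSection hx hθ).mfderiv

/-- The normal part of `J[U, θ] - [JU, θ]`, for a field `U` that is tangent to the submanifold at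
`ι x`. -/
theorem fiberCoord_bracket (h : IsAdaptedParam IL JM ι χ x₀ x ψ)
    (hx : x ∈ coordDom IL F N x₀) (hι : IsPHSubmanifold JL JM ι)
    {U : Π y : M, TangentSpace IM y} (hU : MDiffAt (T% U) (ι x)) (hθ : MDiffAt (T% θ) (ι x))
    {u : TangentSpace IL x} (hu : U (ι x) = mfderiv IL IM ι x u) :
    fiberCoord F x₀ x (χ x (JM (ι x) (mlieBracket IM U θ (ι x))
        - mlieBracket IM (fun y ↦ JM y (U y)) θ (ι x)))
      = fiberBlock (pullEndo IM ψ JM) (extChartAt IL x₀ x)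
          (mvfderiv IL (localSection F x₀ (fun y ↦ χ y (θ (ι y)))) x u)
        - mvfderiv IL (localSection F x₀ (fun y ↦ χ y (θ (ι y)))) x (JL x u)
        + mixedBlock (pullEndo IM ψ JM) (extChartAt IL x₀ x) (fiberCoord F x₀ x (χ x (θ (ι x))))
          (chartDeriv IL x₀ x u) := by
  have hd := h.isParamAt.differentiableAt_pullEndo JM
  have hD (v : EL × F) (u : EL) :
      (fderiv ℝ (pullEndo IM ψ JM) (extChartAt IL x₀ x, 0) v (u, 0)).2
        = mixedBlock (pullEndo IM ψ JM) (extChartAt IL x₀ x) v.2 u := by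
    have hv : v = (v.1, 0) + (0, v.2) := by simp
    conv_lhs => rw [hv, map_add]
    rw [add_apply, Prod.snd_add, fderiv_inl_inl_snd hd (h.eventually_endo_inl hx hι), zero_add,
      mixedBlock_apply]
  rw [h.fiberCoord_normal, h.isParamAt.pullVec_bracket h.eq_base JM hU hθ, hu,
    h.pullVec_mfderiv hx, Prod.snd_add, Prod.snd_sub, h.endo_snd hx hι, h.endo_inl hx hι,
    ← h.mvfderiv_localSection hx hθ, hD, ← h.fiberCoord_normal, ← chartDeriv_baseEndo hx,
    ← h.mvfderiv_localSection hx hθ]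

end Section

/-- The normal part of `N_J(V, u)`, for a vector `u` that is tangent to the submanifold. -/
theorem fiberCoord_nijenhuis (h : IsAdaptedParam IL JM ι χ x₀ x ψ)
    (hx : x ∈ coordDom IL F N x₀) (hι : IsPHSubmanifold JL JM ι) (V : TangentSpace IM (ι x))
    (u : TangentSpace IL x) :
    fiberCoord F x₀ x (χ x (nijenhuis JM (ι x) V (mfderiv IL IM ι x u)))
      = mixedNijenhuis (baseEndo x₀ JL) (mixedBlock (pullEndo IM ψ JM))
        (fiberBlock (pullEndo IM ψ JM)) (extChartAt IL x₀ x) (fiberCoord F x₀ x (χ x V))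
        (chartDeriv IL x₀ x u) := by
  rw [h.fiberCoord_normal, h.isParamAt.pullVec_nijenhuis h.eq_base, h.pullVec_mfderiv hx,
    flatNijenhuis_snd (h.isParamAt.differentiableAt_pullEndo JM) (h.eventually_endo_inl hx hι)
      (J := baseEndo x₀ JL) (fun u ↦ by rw [h.endo_inl hx hι]), h.fiberCoord_normal]

/-- `J² = -1` on the invariant complement `0 × F`. -/
theorem fiberBlock_sq (h : IsAdaptedParam IL JM ι χ x₀ x ψ) (w : F) :
    fiberBlock (pullEndo IM ψ JM) (extChartAt IL x₀ x)
      (fiberBlock (pullEndo IM ψ JM) (extChartAt IL x₀ x) w) = -w := by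
  have := h.isParamAt.pullEndo_sq JM (0, w)
  rw [h.endo_inr, h.endo_inr] at this
  simpa using congrArg Prod.snd this

/-- Differentiating `J² = -1` in a normal direction, along the submanifold. -/
theorem mixedBlock_baseEndo (h : IsAdaptedParam IL JM ι χ x₀ x ψ)
    (hx : x ∈ coordDom IL F N x₀) (hι : IsPHSubmanifold JL JM ι) (a : F) (u : EL) :
    mixedBlock (pullEndo IM ψ JM) (extChartAt IL x₀ x) a (baseEndo x₀ JL (extChartAt IL x₀ x) u)
      = -fiberBlock (pullEndo IM ψ JM) (extChartAt IL x₀ x)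
        (mixedBlock (pullEndo IM ψ JM) (extChartAt IL x₀ x) a u) := by
  have h1 := fderiv_anticomm (h.isParamAt.differentiableAt_pullEndo JM)
    (h.isParamAt.eventually.mono fun y hy ↦ hy.pullEndo_sq JM) (0, a) (u, 0)
  rw [h.endo_inl hx hι] at h1
  have h2 := congrArg Prod.snd h1
  rw [Prod.snd_neg, h.endo_snd hx hι] at h2
  exact h2

/-- The linearization of `JM` along the submanifold, as a structure on the normal bundle, does not
depend on the adapted parametrization. -/
theorem blocks_eq (h : IsAdaptedParam IL JM ι χ x₀ x ψ) (h' : IsAdaptedParam IL JM ι χ x₀ x ψ')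
    (hx : x ∈ coordDom IL F N x₀) (hι : IsPHSubmanifold JL JM ι)
    (hχ : Function.Surjective (χ x)) :
    mixedBlock (pullEndo IM ψ JM) (extChartAt IL x₀ x)
        = mixedBlock (pullEndo IM ψ' JM) (extChartAt IL x₀ x) ∧
      fiberBlock (pullEndo IM ψ JM) (extChartAt IL x₀ x)
        = fiberBlock (pullEndo IM ψ' JM) (extChartAt IL x₀ x) := by
  have hsurj (w : F) : ∃ V, fiberCoord F x₀ x (χ x V) = w := by
    obtain ⟨V, hV⟩ := hχ (fiberCoordSymm F N x₀ x w)
    exact ⟨V, by rw [hV, fiberCoord_symm hx]⟩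
  have hj : fiberBlock (pullEndo IM ψ JM) (extChartAt IL x₀ x)
      = fiberBlock (pullEndo IM ψ' JM) (extChartAt IL x₀ x) := by
    ext w
    obtain ⟨V, rfl⟩ := hsurj w
    rw [← h.fiberCoord_endo hx hι, ← h'.fiberCoord_endo hx hι]
  refine ⟨?_, hj⟩
  ext w u
  obtain ⟨V, rfl⟩ := hsurj w
  obtain ⟨u, rfl⟩ := (chartDeriv_isInvertible hx.1).bijective.surjective u
  let U := FiberBundle.extend EM (mfderiv IL IM ι x u)
  let θ := FiberBundle.extend EM V
  have hU : MDiffAt (T% U) (ι x) := FiberBundle.mdifferentiableAt_extend IM EM _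
  have hθ : MDiffAt (T% θ) (ι x) := FiberBundle.mdifferentiableAt_extend IM EM V
  have hu : U (ι x) = mfderiv IL IM ι x u := by simp [U]
  have hV : θ (ι x) = V := by simp [θ]
  have e := (h.fiberCoord_bracket hx hι hU hθ hu).symm.trans
    (h'.fiberCoord_bracket hx hι hU hθ hu)
  rw [hj, hV] at e
  exact add_left_cancel e

end IsAdaptedParam
end Adapted


/-! ### Tubular maps -/

/-- A linear map out of a product that restricts to an isomorphism of the first factor with the
kernel of `χ`, and to a right inverse of `f ∘ χ` on the second factor, is bijective. -/
theorem bijective_of_split {V₁ V₂ V W : Type*} [AddCommGroup V₁] [Module ℝ V₁] [AddCommGroup V₂]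
    [Module ℝ V₂] [AddCommGroup V] [Module ℝ V] [AddCommGroup W] [Module ℝ W]
    (A : V₁ × V₂ →ₗ[ℝ] V) (χ : V →ₗ[ℝ] W) (f : W →ₗ[ℝ] V₂) (hf : Function.Injective f)
    (hA : ∀ w, f (χ (A (0, w))) = w) (hinj : ∀ u, A (u, 0) = 0 → u = 0)
    (hker : ∀ v, χ v = 0 ↔ ∃ u, A (u, 0) = v) : Function.Bijective A := by
  have hsplit (v : V₁ × V₂) : A v = A (v.1, 0) + A (0, v.2) := by rw [← map_add]; simp
  have h0 (u : V₁) : χ (A (u, 0)) = 0 := (hker _).2 ⟨u, rfl⟩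
  constructor
  · refine (injective_iff_map_eq_zero A).2 fun v hv ↦ ?_
    have h2 : v.2 = 0 := by
      have := hA v.2
      rw [hsplit] at hv
      have h3 := congrArg χ hv
      rw [map_add, h0, zero_add, map_zero] at h3
      rw [← this, h3, map_zero]
    refine Prod.ext (hinj _ ?_) h2
    rwa [hsplit, h2, ← Prod.zero_eq_mk, map_zero, add_zero] at hv
  · intro v
    have h1 : χ (v - A (0, f (χ v))) = 0 := by
      apply hf
      rw [map_sub, map_sub, hA, sub_self, map_zero]
    obtain ⟨u, hu⟩ := (hker _).1 h1
    exact ⟨(u, f (χ v)), by rw [hsplit]; simp [hu]⟩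

section Tubular
variable {EL : Type*} [NormedAddCommGroup EL] [NormedSpace ℝ EL] [FiniteDimensional ℝ EL]
  {HL : Type*} [TopologicalSpace HL] {IL : ModelWithCorners ℝ EL HL} [IL.Boundaryless]
  {L : Type*} [TopologicalSpace L] [ChartedSpace HL L]
  {F : Type*} [NormedAddCommGroup F] [NormedSpace ℝ F] [FiniteDimensional ℝ F]
  {N : L → Type*} [TopologicalSpace (TotalSpace F N)]
  [∀ x, AddCommGroup (N x)] [∀ x, Module ℝ (N x)] [∀ x, TopologicalSpace (N x)]
  [FiberBundle F N] [VectorBundle ℝ F N] [IsManifold IL ∞ L] [ContMDiffVectorBundle ∞ F N IL]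
  [∀ x, IsTopologicalAddGroup (N x)] [∀ x, ContinuousSMul ℝ (N x)]
  {EM : Type*} [NormedAddCommGroup EM] [NormedSpace ℝ EM] [FiniteDimensional ℝ EM]
  {HM : Type*} [TopologicalSpace HM] {IM : ModelWithCorners ℝ EM HM} [IM.Boundaryless]
  {M : Type*} [TopologicalSpace M] [ChartedSpace HM M] [IsManifold IM ∞ M]

variable (IL) in
/-- A map `φ` on the total space, read in the chart and the trivialization centred at `x₀`. -/
def localMap (x₀ : L) (φ : TotalSpace F N → M) : EL × F → M :=
  fun q ↦ φ ((extChartAt (IL.prod 𝓘(ℝ, F)) (zeroSection F N x₀)).symm q)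

variable {x₀ x : L} {φ : TotalSpace F N → M}

theorem localMap_apply (hx : x ∈ coordDom IL F N x₀) (φ : TotalSpace F N → M) (a : N x) :
    localMap IL x₀ φ (extChartAt IL x₀ x, fiberCoord F x₀ x a) = φ ⟨x, a⟩ := by
  rw [localMap, ← extChartAt_zeroSection_apply hx,
    (extChartAt _ _).left_inv (mem_extChartAt_zeroSection_source.2 hx)]

theorem localMap_zero (hx : x ∈ coordDom IL F N x₀) (φ : TotalSpace F N → M) :
    localMap IL x₀ φ (extChartAt IL x₀ x, 0) = φ (zeroSection F N x) := by
  have := localMap_apply hx φ (0 : N x)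
  rwa [map_zero] at this

theorem contMDiffAt_localMap (hx : x ∈ coordDom IL F N x₀) {a : N x}
    (hφ : ContMDiffAt (IL.prod 𝓘(ℝ, F)) IM ∞ φ ⟨x, a⟩) :
    ContMDiffAt 𝓘(ℝ, EL × F) IM ∞ (localMap IL x₀ φ)
      (extChartAt IL x₀ x, fiberCoord F x₀ x a) := by
  have hs := (mem_extChartAt_zeroSection_source (IL := IL) (p := (⟨x, a⟩ : TotalSpace F N))).2 hx
  rw [← extChartAt_zeroSection_apply hx]
  exact ContMDiffAt.comp_of_eq hφ
    (isParamAt_extChartAt_symm _ ((extChartAt _ _).map_source hs)).smooth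
    ((extChartAt _ _).left_inv hs)

/-- The differential of a map `f` on the total space that, in the chart and the trivialization
centred at `x₀`, is the composition of a linear map and a map `ψ`. -/
theorem mfderiv_eq_of_localMap (hx : x ∈ coordDom IL F N x₀) {a : N x} {f : TotalSpace F N → M}
    {ψ : EL × F → M} (A : EL × F →L[ℝ] EL × F)
    (hψ : MDifferentiableAt 𝓘(ℝ, EL × F) IM ψ (A (extChartAt IL x₀ x, fiberCoord F x₀ x a)))
    (hf : ∀ y ∈ coordDom IL F N x₀, ∀ b : N y,
      f ⟨y, b⟩ = ψ (A (extChartAt IL x₀ y, fiberCoord F x₀ y b))) :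
    (mfderiv (IL.prod 𝓘(ℝ, F)) IM f ⟨x, a⟩ : EL × F →L[ℝ] EM)
      = (paramDeriv IM ψ (A (extChartAt IL x₀ x, fiberCoord F x₀ x a)) : EL × F →L[ℝ] EM)
        ∘L A ∘L totalDeriv F N IL x₀ ⟨x, a⟩ := by
  have hs := (mem_extChartAt_zeroSection_source (IL := IL) (p := (⟨x, a⟩ : TotalSpace F N))).2 hx
  have he := extChartAt_zeroSection_apply hx a
  have h3 : HasMFDerivAt (IL.prod 𝓘(ℝ, F)) 𝓘(ℝ, EL × F)
      (extChartAt (IL.prod 𝓘(ℝ, F)) (zeroSection F N x₀)) ⟨x, a⟩ (totalDeriv F N IL x₀ ⟨x, a⟩) :=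
    (mdifferentiableAt_extChartAt (I := IL.prod 𝓘(ℝ, F)) (x := zeroSection F N x₀) (y := ⟨x, a⟩)
      (by simpa using hs)).hasMFDerivAt
  rw [← he] at hψ ⊢
  have h4 := A.hasFDerivAt (x := extChartAt (IL.prod 𝓘(ℝ, F)) (zeroSection F N x₀) ⟨x, a⟩)
    |>.hasMFDerivAt.comp (⟨x, a⟩ : TotalSpace F N) h3
  have h5 := HasMFDerivAt.comp (⟨x, a⟩ : TotalSpace F N) (g := ψ) hψ.hasMFDerivAt h4
  refine (h5.congr_of_eventuallyEq ?_).mfderiv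
  filter_upwards [(contMDiffAt_proj N (IB := IL) (n := ∞)).continuousAt.preimage_mem_nhds
      ((isOpen_coordDom (IL := IL) (F := F) (N := N) x₀).mem_nhds hx)] with p hp
  have := hf p.1 hp p.2
  rw [← extChartAt_zeroSection_apply (IL := IL) hp p.2] at this
  exact this

theorem mfderiv_eq_paramDeriv (hx : x ∈ coordDom IL F N x₀) {a : N x}
    (hφ : ContMDiffAt (IL.prod 𝓘(ℝ, F)) IM ∞ φ ⟨x, a⟩)
    (v : TangentSpace (IL.prod 𝓘(ℝ, F)) (⟨x, a⟩ : TotalSpace F N)) :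
    (mfderiv (IL.prod 𝓘(ℝ, F)) IM φ ⟨x, a⟩ v : EM)
      = paramDeriv IM (localMap IL x₀ φ) (extChartAt IL x₀ x, fiberCoord F x₀ x a)
        (totalDeriv F N IL x₀ ⟨x, a⟩ v) := by
  have h := mfderiv_eq_of_localMap hx (a := a) (f := φ) (ψ := localMap IL x₀ φ)
    (ContinuousLinearMap.id ℝ (EL × F))
    ((contMDiffAt_localMap hx hφ).mdifferentiableAt (by simp))
    (fun y hy b ↦ (localMap_apply hy φ b).symm)
  exact congrArg (fun D : EL × F →L[ℝ] EM ↦ D v) h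

theorem IsParamAt.endo_paramDeriv_of_eq {E E' H M : Type*} [NormedAddCommGroup E] [NormedSpace ℝ E]
    [TopologicalSpace H] {I : ModelWithCorners ℝ E H} [TopologicalSpace M] [ChartedSpace H M]
    [NormedAddCommGroup E'] [NormedSpace ℝ E'] {ψ : E' → M} {q : E'} {m : M}
    (h : IsParamAt I ψ q) (hp : ψ q = m)
    (J : Π x : M, TangentSpace I x →L[ℝ] TangentSpace I x) (v : E') :
    (J m (paramDeriv I ψ q v : E) : E) = paramDeriv I ψ q (pullEndo I ψ J q v) := by
  subst hp
  exact (h.deriv_pullEndo J v).symm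

variable {JL : AlmostComplexStructure IL L} {JM : AlmostComplexStructure IM M} {ι : L → M}
  {χ : Π x : L, TangentSpace IM (ι x) →L[ℝ] N x} {O : Set (TotalSpace F N)}

variable (IL F N) in
theorem contMDiff_zeroSection_total :
    ContMDiff IL (IL.prod 𝓘(ℝ, F)) ∞ (zeroSection F N) :=
  contMDiff_zeroSection ℝ N (IB := IL) (n := ∞)

namespace IsTubularMapOn

theorem paramDeriv_inr (h : IsTubularMapOn IL JM ι χ O φ) (hO : IsOpen O)
    (hx : x ∈ coordDom IL F N x₀) (hxO : zeroSection F N x ∈ O) (w : N x) :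
    (paramDeriv IM (localMap IL x₀ φ) (extChartAt IL x₀ x, 0) (0, fiberCoord F x₀ x w) : EM)
      = mfderiv (IL.prod 𝓘(ℝ, F)) IM φ (zeroSection F N x) (vert IL F (0 : N x) w) := by
  have h1 := mfderiv_eq_paramDeriv (x₀ := x₀) (a := (0 : N x)) hx
    (h.smooth.contMDiffAt (hO.mem_nhds hxO)) (vert IL F (0 : N x) w)
  rw [totalDeriv_vert hx] at h1
  refine Eq.trans ?_ h1.symm
  rw [map_zero]

theorem eventually_base (h : IsTubularMapOn IL JM ι χ O φ) (hO : IsOpen O)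
    (hx : x ∈ coordDom IL F N x₀) (hxO : zeroSection F N x ∈ O) :
    ∀ᶠ y in 𝓝 x, y ∈ coordDom IL F N x₀ ∧ zeroSection F N y ∈ O ∧
      localMap IL x₀ φ (extChartAt IL x₀ y, 0) = ι y := by
  filter_upwards [(isOpen_coordDom (IL := IL) (F := F) (N := N) x₀).mem_nhds hx,
    (contMDiff_zeroSection_total IL F N).continuous.continuousAt.preimage_mem_nhds
      (hO.mem_nhds hxO)]
    with y hy hyO
  exact ⟨hy, hyO, (localMap_zero hy φ).trans (h.zero y hyO)⟩

theorem contMDiffAt_localMap_zero (h : IsTubularMapOn IL JM ι χ O φ) (hO : IsOpen O)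
    (hx : x ∈ coordDom IL F N x₀) (hxO : zeroSection F N x ∈ O) :
    ContMDiffAt 𝓘(ℝ, EL × F) IM ∞ (localMap IL x₀ φ) (extChartAt IL x₀ x, 0) := by
  have := contMDiffAt_localMap hx (a := (0 : N x)) (h.smooth.contMDiffAt (hO.mem_nhds hxO))
  rwa [map_zero] at this

theorem eventually_contMDiffAt_localMap (h : IsTubularMapOn IL JM ι χ O φ) (hO : IsOpen O)
    (hx : x ∈ coordDom IL F N x₀) (hxO : zeroSection F N x ∈ O) :
    ∀ᶠ q in 𝓝 (extChartAt IL x₀ x, (0 : F)),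
      ContMDiffAt 𝓘(ℝ, EL × F) IM ∞ (localMap IL x₀ φ) q := by
  have ht := mem_extChartAt_zeroSection_target hx (0 : F)
  have hs := isParamAt_extChartAt_symm (I := IL.prod 𝓘(ℝ, F)) (zeroSection F N x₀) ht
  have h0 : (extChartAt (IL.prod 𝓘(ℝ, F)) (zeroSection F N x₀)).symm (extChartAt IL x₀ x, 0)
      = zeroSection F N x := localMap_zero hx id
  filter_upwards [hs.smooth.continuousAt.preimage_mem_nhds (h0 ▸ hO.mem_nhds hxO),
    (isOpen_extChartAt_target _).mem_nhds ht] with q hq hqt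
  exact ContMDiffAt.comp_of_eq (h.smooth.contMDiffAt (hO.mem_nhds hq))
    (isParamAt_extChartAt_symm _ hqt).smooth rfl

/-- A tubular map is `ι` on the zero section, hence so is its differential on `EL × 0`. -/
theorem paramDeriv_inl (h : IsTubularMapOn IL JM ι χ O φ) (hO : IsOpen O)
    (hx : x ∈ coordDom IL F N x₀) (hxO : zeroSection F N x ∈ O) (u : TangentSpace IL x) :
    (paramDeriv IM (localMap IL x₀ φ) (extChartAt IL x₀ x, 0) (chartDeriv IL x₀ x u, 0) : EM)
      = mfderiv IL IM ι x u := by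
  have h1 : HasMFDerivAt IL 𝓘(ℝ, EL) (extChartAt IL x₀) x (chartDeriv IL x₀ x) :=
    (mdifferentiableAt_extChartAt (I := IL) (x := x₀) (y := x)
      (by simpa using hx.1)).hasMFDerivAt
  have h2 : HasMFDerivAt IL 𝓘(ℝ, EL × F) (fun y ↦ (extChartAt IL x₀ y, (0 : F))) x
      ((chartDeriv IL x₀ x).prod (0 : TangentSpace IL x →L[ℝ] F)) :=
    ⟨h1.1.prodMk continuousAt_const, h1.2.prodMk (hasFDerivWithinAt_const _ _ _)⟩
  have h3 := (((h.contMDiffAt_localMap_zero hO hx hxO).mdifferentiableAt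
    (by simp)).hasMFDerivAt.comp x h2).congr_of_eventuallyEq
      ((h.eventually_base hO hx hxO).mono fun y hy ↦ hy.2.2.symm)
  exact (congrArg (fun D : TangentSpace IL x →L[ℝ] EM ↦ D u) h3.mfderiv).symm

/-- A tubular map, read in coordinates, has bijective differential along the submanifold: it maps
`EL × 0` onto the tangent space of `L`, which is the kernel of `χ`, and `0 × F` onto a
complement. -/
theorem bijective_paramDeriv (h : IsTubularMapOn IL JM ι χ O φ) (hO : IsOpen O)
    (hι : IsPHSubmanifold JL JM ι) (hχ : IsNormalBundle IL IM F ι χ)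
    (hx : x ∈ coordDom IL F N x₀) (hxO : zeroSection F N x ∈ O) :
    Function.Bijective (paramDeriv IM (localMap IL x₀ φ) (extChartAt IL x₀ x, 0)) ∧
      ∀ v : EL × F, fiberCoord F x₀ x (χ x
        (paramDeriv IM (localMap IL x₀ φ) (extChartAt IL x₀ x, 0) v : EM)) = v.2 := by
  let A : EL × F →ₗ[ℝ] EM :=
    (show EL × F →L[ℝ] EM from
      paramDeriv IM (localMap IL x₀ φ) (extChartAt IL x₀ x, 0)).toLinearMap
  let X : EM →ₗ[ℝ] N x := (show EM →L[ℝ] N x from χ x).toLinearMap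
  have hl (u : TangentSpace IL x) : A (chartDeriv IL x₀ x u, 0) = mfderiv IL IM ι x u :=
    h.paramDeriv_inl hO hx hxO u
  have hA (w : F) : fiberCoord F x₀ x (X (A (0, w))) = w := by
    have h1 := h.paramDeriv_inr hO hx hxO (fiberCoordSymm F N x₀ x w)
    rw [fiberCoord_symm hx] at h1
    have h2 := h.proj x hxO (fiberCoordSymm F N x₀ x w)
    have h3 : X (A (0, w)) = fiberCoordSymm F N x₀ x w := (congrArg X h1).trans h2
    rw [h3, fiberCoord_symm hx]
  have hker (v : EM) : X v = 0 ↔ ∃ u, A (u, 0) = v := by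
    have h1 := SetLike.ext_iff.1 (hχ.ker_eq x) v
    refine Iff.trans (b := ∃ u, mfderiv IL IM ι x u = v) h1 ⟨?_, ?_⟩
    · rintro ⟨u, hu⟩
      exact ⟨_, (hl u).trans hu⟩
    · rintro ⟨u, hu⟩
      obtain ⟨u, rfl⟩ := (chartDeriv_isInvertible hx.1).bijective.surjective u
      exact ⟨u, (hl u).symm.trans hu⟩
  constructor
  · refine bijective_of_split A X (fiberCoord F x₀ x).toLinearMap (fiberCoord_injective hx) hA
      (fun u hu ↦ ?_) hker
    obtain ⟨u, rfl⟩ := (chartDeriv_isInvertible hx.1).bijective.surjective u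
    have h1 : mfderiv IL IM ι x u = 0 := (hl u).symm.trans hu
    have h2 : u = 0 := mfderiv_injective_of_isImmersionAt
      (hι.isSmoothEmbedding.isImmersion.isImmersionAt x) (h1.trans (map_zero _).symm)
    rw [h2, map_zero]
  · intro v
    have e : A v = A (v.1, 0) + A (0, v.2) := by rw [← map_add]; simp
    change fiberCoord F x₀ x (X (A v)) = v.2
    rw [e, map_add, (hker _).2 ⟨v.1, rfl⟩, zero_add, hA]

/-- A tubular map, read in coordinates, is an adapted parametrization. -/
theorem isAdaptedParam (h : IsTubularMapOn IL JM ι χ O φ) (hO : IsOpen O)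
    (hι : IsPHSubmanifold JL JM ι) (hχ : IsNormalBundle IL IM F ι χ)
    (hx : x ∈ coordDom IL F N x₀) (hxO : zeroSection F N x ∈ O) :
    IsAdaptedParam IL JM ι χ x₀ x (localMap IL x₀ φ) := by
  have hparam (y : L) (hy : y ∈ coordDom IL F N x₀) (hyO : zeroSection F N y ∈ O) :
      IsParamAt IM (localMap IL x₀ φ) (extChartAt IL x₀ y, 0) := by
    refine ⟨h.eventually_contMDiffAt_localMap hO hy hyO, ?_⟩
    let A : EL × F →L[ℝ] EM := paramDeriv IM (localMap IL x₀ φ) (extChartAt IL x₀ y, 0)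
    have hA : Function.Bijective A := (h.bijective_paramDeriv hO hι hχ hy hyO).1
    exact ⟨(LinearEquiv.ofBijective A.toLinearMap hA).toContinuousLinearEquiv, rfl⟩
  refine ⟨hparam x hx hxO, (h.eventually_base hO hx hxO).mono fun y hy ↦ hy.2.2, ?_, ?_⟩
  · filter_upwards [h.eventually_base hO hx hxO] with y ⟨hy, hyO, hyι⟩ V
    obtain ⟨hb, hn⟩ := h.bijective_paramDeriv hO hι hχ hy hyO
    obtain ⟨v, hv⟩ := hb.surjective V
    have h2 : pullVec IM (localMap IL x₀ φ) (extChartAt IL x₀ y, 0) (ι y) V = v := by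
      rw [← hv]; exact (hparam y hy hyO).inverse_deriv v
    rw [h2, ← hn v]
    exact congrArg (fun V : TangentSpace IM (ι y) ↦ fiberCoord F x₀ y (χ y V)) hv.symm
  · filter_upwards [h.eventually_base hO hx hxO] with y ⟨hy, hyO, hyι⟩ w
    obtain ⟨w', hw'⟩ := h.invariant y hyO (fiberCoordSymm F N x₀ y w)
    have h1 := h.paramDeriv_inr hO hy hyO (fiberCoordSymm F N x₀ y w)
    have h2 := h.paramDeriv_inr hO hy hyO w'
    rw [fiberCoord_symm hy] at h1
    have h3 := (hparam y hy hyO).endo_paramDeriv_of_eq (localMap_zero hy φ) JM (0, w)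
    have h4 : paramDeriv IM (localMap IL x₀ φ) (extChartAt IL x₀ y, 0)
        (pullEndo IM (localMap IL x₀ φ) JM (extChartAt IL x₀ y, 0) (0, w))
        = paramDeriv IM (localMap IL x₀ φ) (extChartAt IL x₀ y, 0) (0, fiberCoord F x₀ y w') :=
      h3.symm.trans ((congrArg (fun V : EM ↦ (JM (φ (zeroSection F N y)) V : EM)) h1).trans
        (hw'.trans h2.symm))
    have h5 := (hparam y hy hyO).inv.bijective.injective h4
    rw [h5]

end IsTubularMapOn
end Tubular


/-! ### The limit of the dilated structures -/

section Limit
variable {EL : Type*} [NormedAddCommGroup EL] [NormedSpace ℝ EL] [FiniteDimensional ℝ EL]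
  {HL : Type*} [TopologicalSpace HL] {IL : ModelWithCorners ℝ EL HL} [IL.Boundaryless]
  {L : Type*} [TopologicalSpace L] [ChartedSpace HL L]
  {F : Type*} [NormedAddCommGroup F] [NormedSpace ℝ F] [FiniteDimensional ℝ F]
  {N : L → Type*} [TopologicalSpace (TotalSpace F N)]
  [∀ x, AddCommGroup (N x)] [∀ x, Module ℝ (N x)] [∀ x, TopologicalSpace (N x)]
  [FiberBundle F N] [VectorBundle ℝ F N] [IsManifold IL ∞ L] [ContMDiffVectorBundle ∞ F N IL]
  [∀ x, IsTopologicalAddGroup (N x)] [∀ x, ContinuousSMul ℝ (N x)]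
  {EM : Type*} [NormedAddCommGroup EM] [NormedSpace ℝ EM] [FiniteDimensional ℝ EM]
  {HM : Type*} [TopologicalSpace HM] {IM : ModelWithCorners ℝ EM HM} [IM.Boundaryless]
  {M : Type*} [TopologicalSpace M] [ChartedSpace HM M] [IsManifold IM ∞ M]
  {x₀ x : L} {φ : TotalSpace F N → M}
  {JL : AlmostComplexStructure IL L} {JM : AlmostComplexStructure IM M} {ι : L → M}
  {χ : Π x : L, TangentSpace IM (ι x) →L[ℝ] N x} {O : Set (TotalSpace F N)}

variable (EL F) in
/-- The dilatation of the second factor of a product. -/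
def dilation (t : ℝ) : EL × F →L[ℝ] EL × F :=
  (ContinuousLinearMap.fst ℝ EL F).prod (t • ContinuousLinearMap.snd ℝ EL F)

@[simp] theorem dilation_apply (t : ℝ) (v : EL × F) : dilation EL F t v = (v.1, t • v.2) := rfl

theorem dilation_isInvertible {t : ℝ} (ht : t ≠ 0) : (dilation EL F t).IsInvertible := by
  refine ContinuousLinearMap.IsInvertible.of_inverse (g := dilation EL F t⁻¹) ?_ ?_ <;>
  · refine ContinuousLinearMap.ext fun v ↦ ?_
    simp [smul_smul, ht]

/-- In coordinates, `J_t` is the conjugate of the structure of `M` by the dilatation. -/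
theorem totalDeriv_dilatedStructure (hx : x ∈ coordDom IL F N x₀) (a : N x) {t : ℝ} (ht : t ≠ 0)
    (h : IsParamAt IM (localMap IL x₀ φ) (extChartAt IL x₀ x, t • fiberCoord F x₀ x a))
    (v : TangentSpace (IL.prod 𝓘(ℝ, F)) (⟨x, a⟩ : TotalSpace F N)) :
    totalDeriv F N IL x₀ ⟨x, a⟩ (dilatedStructure IL F JM φ t ⟨x, a⟩ v)
      = dilation EL F t⁻¹ (pullEndo IM (localMap IL x₀ φ) JM
          (extChartAt IL x₀ x, t • fiberCoord F x₀ x a)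
          (dilation EL F t (totalDeriv F N IL x₀ ⟨x, a⟩ v))) := by
  let Φ : TotalSpace F N → M := fun b ↦ φ ⟨b.1, t • b.2⟩
  have hT := totalDeriv_isInvertible (IL := IL) (p := (⟨x, a⟩ : TotalSpace F N)) hx
  have hΦ (y) (hy : y ∈ coordDom IL F N x₀) (b : N y) : Φ ⟨y, b⟩
      = localMap IL x₀ φ (dilation EL F t (extChartAt IL x₀ y, fiberCoord F x₀ y b)) := by
    have := localMap_apply hy φ (t • b)
    rw [map_smul] at this
    exact this.symm
  have hD := mfderiv_eq_of_localMap hx (a := a) (f := Φ) (dilation EL F t)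
    h.mdifferentiableAt hΦ
  have hinv : (mfderiv (IL.prod 𝓘(ℝ, F)) IM Φ ⟨x, a⟩).IsInvertible := by
    have h1 : ((paramDeriv IM (localMap IL x₀ φ)
        (dilation EL F t (extChartAt IL x₀ x, fiberCoord F x₀ x a)) : EL × F →L[ℝ] EM)
        ∘L dilation EL F t ∘L totalDeriv F N IL x₀ ⟨x, a⟩).IsInvertible :=
      ContinuousLinearMap.IsInvertible.comp h.inv ((dilation_isInvertible ht).comp hT)
    exact hD ▸ h1
  obtain ⟨w, hw⟩ := hT.bijective.surjective (dilation EL F t⁻¹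
    (pullEndo IM (localMap IL x₀ φ) JM (extChartAt IL x₀ x, t • fiberCoord F x₀ x a)
      (dilation EL F t (totalDeriv F N IL x₀ ⟨x, a⟩ v))))
  have hDv (v) : (mfderiv (IL.prod 𝓘(ℝ, F)) IM Φ ⟨x, a⟩ v : EM)
      = paramDeriv IM (localMap IL x₀ φ) (extChartAt IL x₀ x, t • fiberCoord F x₀ x a)
        (dilation EL F t (totalDeriv F N IL x₀ ⟨x, a⟩ v)) :=
    congrArg (fun D : EL × F →L[ℝ] EM ↦ D v) hD
  have key : JM (Φ ⟨x, a⟩) (mfderiv (IL.prod 𝓘(ℝ, F)) IM Φ ⟨x, a⟩ v)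
      = mfderiv (IL.prod 𝓘(ℝ, F)) IM Φ ⟨x, a⟩ w := by
    have h1 := h.endo_paramDeriv_of_eq (hΦ x hx a).symm JM
      (dilation EL F t (totalDeriv F N IL x₀ ⟨x, a⟩ v))
    have h2 := hDv w
    rw [hw] at h2
    refine (congrArg (fun V : EM ↦ (JM (Φ ⟨x, a⟩) V : EM)) (hDv v)).trans (h1.trans ?_)
    refine Eq.trans ?_ h2.symm
    refine congrArg _ ?_
    simp [smul_smul, ht]
  have h3 : dilatedStructure IL F JM φ t ⟨x, a⟩ v = w := hinv.inverse_apply_eq.2 key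
  rw [h3, hw]

namespace IsAdaptedParam

/-- The limit of the dilated structures is the linearization of `JM` along the submanifold. -/
theorem tendsto_dilatedStructure (h : IsAdaptedParam IL JM ι χ x₀ x (localMap IL x₀ φ))
    (hx : x ∈ coordDom IL F N x₀) (hι : IsPHSubmanifold JL JM ι) (a : N x)
    (v : TangentSpace (IL.prod 𝓘(ℝ, F)) (⟨x, a⟩ : TotalSpace F N)) :
    Tendsto (fun t : ℝ ↦ totalDeriv F N IL x₀ ⟨x, a⟩ (dilatedStructure IL F JM φ t ⟨x, a⟩ v))
      (𝓝[≠] 0) (𝓝 (linearModel (baseEndo x₀ JL) (mixedBlock (pullEndo IM (localMap IL x₀ φ) JM))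
        (fiberBlock (pullEndo IM (localMap IL x₀ φ) JM))
        (extChartAt IL x₀ x, fiberCoord F x₀ x a) (totalDeriv F N IL x₀ ⟨x, a⟩ v))) := by
  have h1 := tendsto_dilation (h.isParamAt.differentiableAt_pullEndo JM)
    (h.eventually_endo_inl hx hι).self_of_nhds (fiberCoord F x₀ x a)
    (totalDeriv F N IL x₀ ⟨x, a⟩ v)
  have e : linearModel (baseBlock (pullEndo IM (localMap IL x₀ φ) JM))
      (mixedBlock (pullEndo IM (localMap IL x₀ φ) JM))
      (fiberBlock (pullEndo IM (localMap IL x₀ φ) JM)) (extChartAt IL x₀ x, fiberCoord F x₀ x a)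
      = linearModel (baseEndo x₀ JL) (mixedBlock (pullEndo IM (localMap IL x₀ φ) JM))
      (fiberBlock (pullEndo IM (localMap IL x₀ φ) JM))
      (extChartAt IL x₀ x, fiberCoord F x₀ x a) := by
    simp only [linearModel, h.baseBlock_eq hx hι]
  rw [e] at h1
  refine h1.congr' ?_
  have h2 : Tendsto (fun t : ℝ ↦ (extChartAt IL x₀ x, t • fiberCoord F x₀ x a)) (𝓝[≠] 0)
      (𝓝 (extChartAt IL x₀ x, (0 : F))) := by
    refine tendsto_const_nhds.prodMk_nhds ?_
    have := (tendsto_id.mono_left nhdsWithin_le_nhds : Tendsto (fun t : ℝ ↦ t) (𝓝[≠] 0)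
      (𝓝 0)).smul_const (fiberCoord F x₀ x a)
    rwa [zero_smul] at this
  filter_upwards [h2.eventually h.isParamAt.eventually, self_mem_nhdsWithin] with t ht ht0
  rw [totalDeriv_dilatedStructure hx a ht0 ht]
  rfl

end IsAdaptedParam

/-- The structure `K` on the normal bundle is, in every adapted parametrization, the linearization
of `JM` along the submanifold. -/
def IsLinearization (JL : AlmostComplexStructure IL L) (JM : AlmostComplexStructure IM M)
    (ι : L → M) (χ : Π x : L, TangentSpace IM (ι x) →L[ℝ] N x)
    (K : Π p : TotalSpace F N, TangentSpace (IL.prod 𝓘(ℝ, F)) p →L[ℝ]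
      TangentSpace (IL.prod 𝓘(ℝ, F)) p) : Prop :=
  ∀ x₀ x : L, x ∈ coordDom IL F N x₀ → ∀ ψ : EL × F → M, IsAdaptedParam IL JM ι χ x₀ x ψ →
    ∀ a : F, bundleEndo x₀ K (extChartAt IL x₀ x, a)
      = linearModel (baseEndo x₀ JL) (mixedBlock (pullEndo IM ψ JM))
        (fiberBlock (pullEndo IM ψ JM)) (extChartAt IL x₀ x, a)

namespace IsTubularMapOn

/-- The limit of the dilated structures is the linearization of `JM`, since `totalDeriv` is an
isomorphism. -/
theorem tendsto_iff (h : IsTubularMapOn IL JM ι χ O φ) (hO : IsOpen O)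
    (hι : IsPHSubmanifold JL JM ι) (hχ : IsNormalBundle IL IM F ι χ)
    (hx : x ∈ coordDom IL F N x₀) (hxO : zeroSection F N x ∈ O) (a : N x)
    (v w : TangentSpace (IL.prod 𝓘(ℝ, F)) (⟨x, a⟩ : TotalSpace F N)) :
    Tendsto (fun t : ℝ ↦ dilatedStructure IL F JM φ t ⟨x, a⟩ v) (𝓝[≠] 0) (𝓝 w) ↔
      totalDeriv F N IL x₀ ⟨x, a⟩ w
        = linearModel (baseEndo x₀ JL) (mixedBlock (pullEndo IM (localMap IL x₀ φ) JM))
          (fiberBlock (pullEndo IM (localMap IL x₀ φ) JM))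
          (extChartAt IL x₀ x, fiberCoord F x₀ x a) (totalDeriv F N IL x₀ ⟨x, a⟩ v) := by
  have h1 := (h.isAdaptedParam hO hι hχ hx hxO).tendsto_dilatedStructure hx hι a v
  have hT := totalDeriv_isInvertible (IL := IL) (p := (⟨x, a⟩ : TotalSpace F N)) hx
  constructor
  · intro h2
    exact tendsto_nhds_unique
      (((totalDeriv F N IL x₀ ⟨x, a⟩).continuous.tendsto w).comp h2) h1
  · intro h2
    rw [← h2] at h1
    have h3 := ((totalDeriv F N IL x₀ ⟨x, a⟩).inverse.continuous.tendsto _).comp h1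
    rw [hT.inverse_apply_self] at h3
    refine h3.congr fun t ↦ ?_
    exact hT.inverse_apply_self _

end IsTubularMapOn

/-- If the submanifold has tubular maps near each of its points, then the linearization is an
almost complex structure on the normal bundle. -/
theorem exists_isLinearization (hι : IsPHSubmanifold JL JM ι) (hχ : IsNormalBundle IL IM F ι χ)
    (htub : ∀ x₀ : L, ∃ O : Set (TotalSpace F N), IsOpen O ∧ zeroSection F N x₀ ∈ O ∧
      ∃ φ : TotalSpace F N → M, IsTubularMapOn IL JM ι χ O φ) :
    ∃ K : AlmostComplexStructure (IL.prod 𝓘(ℝ, F)) (TotalSpace F N),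
      IsLinearization JL JM ι χ K := by
  choose O hO hxO φ hφ using htub
  have had {x₀ x : L} (hx : x ∈ coordDom IL F N x₀) :
      IsAdaptedParam IL JM ι χ x₀ x (localMap IL x₀ (φ x)) :=
    (hφ x).isAdaptedParam (hO x) hι hχ hx (hxO x)
  let T (p : TotalSpace F N) : TangentSpace (IL.prod 𝓘(ℝ, F)) p →L[ℝ]
      TangentSpace (IL.prod 𝓘(ℝ, F)) p :=
    (totalDeriv F N IL p.1 p).inverse ∘L
      linearModel (baseEndo p.1 JL) (mixedBlock (pullEndo IM (localMap IL p.1 (φ p.1)) JM))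
        (fiberBlock (pullEndo IM (localMap IL p.1 (φ p.1)) JM))
        (extChartAt IL p.1 p.1, fiberCoord F p.1 p.1 p.2) ∘L totalDeriv F N IL p.1 p
  have hT (x : L) (a : N x) (v : TangentSpace (IL.prod 𝓘(ℝ, F)) (⟨x, a⟩ : TotalSpace F N)) :
      Tendsto (fun t : ℝ ↦ dilatedStructure IL F JM (φ x) t ⟨x, a⟩ v) (𝓝[≠] 0)
        (𝓝 (T ⟨x, a⟩ v)) := by
    have hx : x ∈ coordDom IL F N x := mem_coordDom_self x
    refine ((hφ x).tendsto_iff (hO x) hι hχ hx (hxO x) a v _).2 ?_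
    exact (totalDeriv_isInvertible (p := (⟨x, a⟩ : TotalSpace F N)) hx).self_apply_inverse _
  -- a fixed tubular map around `x` can be read in the coordinates centred at any `x₀`; the limit,
  -- which does not involve coordinates, relates the two linearizations
  have hlin : IsLinearization JL JM ι χ T := by
    intro x₀ x hx ψ hψ a
    obtain ⟨b, rfl⟩ : ∃ b : N x, fiberCoord F x₀ x b = a := ⟨_, fiberCoord_symm hx a⟩
    refine ContinuousLinearMap.ext fun v ↦ ?_
    obtain ⟨v, rfl⟩ := totalDeriv_surjective hx b v
    obtain ⟨h1, h2⟩ := hψ.blocks_eq (had hx) hx hι (hχ.surjective x)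
    rw [← totalDeriv_bundleEndo hx, ((hφ x).tendsto_iff (hO x) hι hχ hx (hxO x) b v _).1 (hT x b v)]
    simp only [linearModel, h1, h2]
  refine ⟨⟨T, fun ⟨x, a⟩ v ↦ ?_, fun ⟨x, a⟩ ↦ ?_⟩, hlin⟩
  · have hx : x ∈ coordDom IL F N x := mem_coordDom_self x
    apply totalDeriv_injective hx a
    have h1 := chartDeriv_baseEndo hx JL
    rw [totalDeriv_bundleEndo hx, totalDeriv_bundleEndo hx, hlin x x hx _ (had hx)]
    obtain ⟨u, hu⟩ := (chartDeriv_isInvertible hx.1).bijective.surjective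
      (totalDeriv F N IL x ⟨x, a⟩ v).1
    simp only [linearModel, blockEndo_apply, map_add, (had hx).mixedBlock_baseEndo hx hι,
      (had hx).fiberBlock_sq]
    rw [← hu, ← h1, ← h1, JL.sq_eq_neg, map_neg, map_neg, hu]
    refine Prod.ext rfl ?_
    simp
  · have hx : x ∈ coordDom IL F N x := mem_coordDom_self x
    refine smoothEndoAt_of_chart (p := zeroSection F N x)
      (mem_extChartAt_zeroSection_source.2 hx) ?_
    have h1 := (had hx).isParamAt.contDiffAt_pullEndo_acs JM
    have h2 := (contDiffAt_baseEndo hx JL).linearModel h1.mixedBlock h1.fiberBlock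
      (fiberCoord F x x a)
    rw [extChartAt_zeroSection_apply hx]
    refine h2.congr_of_eventuallyEq (bundleEndo_eventuallyEq hx ?_ _)
    filter_upwards [(isOpen_coordDom (IL := IL) (F := F) (N := N) x).mem_nhds hx,
      (had hx).eventually hx] with y hy hy' b
    exact hlin x y hy _ hy' b

namespace IsLinearization
variable {K : AlmostComplexStructure (IL.prod 𝓘(ℝ, F)) (TotalSpace F N)}

/-- The linearization is the only NB-II structure. -/
theorem isNBII_iff (hK : IsLinearization JL JM ι χ K) (hι : IsPHSubmanifold JL JM ι)
    (hχ : IsNormalBundle IL IM F ι χ)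
    (htub : ∀ x₀ : L, ∃ O : Set (TotalSpace F N), IsOpen O ∧ zeroSection F N x₀ ∈ O ∧
      ∃ φ : TotalSpace F N → M, IsTubularMapOn IL JM ι χ O φ)
    (K' : AlmostComplexStructure (IL.prod 𝓘(ℝ, F)) (TotalSpace F N)) :
    IsNBII JM ι χ K' ↔ K' = K := by
  have key {O : Set (TotalSpace F N)} {φ : TotalSpace F N → M} (h : IsTubularMapOn IL JM ι χ O φ)
      (hO : IsOpen O) {x : L} (hxO : zeroSection F N x ∈ O) (a : N x)
      (v w : TangentSpace (IL.prod 𝓘(ℝ, F)) (⟨x, a⟩ : TotalSpace F N)) :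
      Tendsto (fun t : ℝ ↦ dilatedStructure IL F JM φ t ⟨x, a⟩ v) (𝓝[≠] 0) (𝓝 w) ↔
        w = K ⟨x, a⟩ v := by
    have hx : x ∈ coordDom IL F N x := mem_coordDom_self x
    rw [h.tendsto_iff hO hι hχ hx hxO, ← hK x x hx _ (h.isAdaptedParam hO hι hχ hx hxO),
      ← totalDeriv_bundleEndo hx]
    exact (totalDeriv_injective hx a).eq_iff
  constructor
  · intro h
    refine AlmostComplexStructure.ext (funext fun ⟨x, a⟩ ↦ ContinuousLinearMap.ext fun v ↦ ?_)
    obtain ⟨O, hO, hxO, φ, hφ, hlim⟩ := h x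
    exact (key hφ hO hxO a v _).1 (hlim x hxO a v)
  · rintro rfl x₀
    obtain ⟨O, hO, hxO, φ, hφ⟩ := htub x₀
    exact ⟨O, hO, hxO, φ, hφ, fun x hx a v ↦ (key hφ hO hx a v _).2 rfl⟩

theorem isPHVectorBundle [T2Space L] [SigmaCompactSpace L]
    (hK : IsLinearization JL JM ι χ K)
    (hψ : ∀ x₀ x : L, x ∈ coordDom IL F N x₀ → ∃ ψ : EL × F → M, IsAdaptedParam IL JM ι χ x₀ x ψ) :
    IsPHVectorBundle JL K := by
  refine isPHVectorBundle_of_isFiberLinearAt fun x₀ ↦ ?_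
  filter_upwards [(isOpen_coordDom (IL := IL) (F := F) (N := N) x₀).mem_nhds
    (mem_coordDom_self x₀)] with x hx
  obtain ⟨ψ, hψ⟩ := hψ x₀ x hx
  exact ⟨mixedBlock (pullEndo IM ψ JM) (extChartAt IL x₀ x),
    fiberBlock (pullEndo IM ψ JM) (extChartAt IL x₀ x), fun a ↦ hK x₀ x hx ψ hψ a⟩

end IsLinearization
end Limit


/-! ### The structure defined by a minimal connection -/

section MinimalIdentity
variable {E : Type*} [NormedAddCommGroup E] [NormedSpace ℝ E] [FiniteDimensional ℝ E]
  {H : Type*} [TopologicalSpace H] {I : ModelWithCorners ℝ E H}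
  {M : Type*} [TopologicalSpace M] [ChartedSpace H M] [IsManifold I ∞ M]

/-- For a minimal connection, the failure of `∇θ` to be complex linear is determined by `J`: the
terms `∇_θ Y` and `∇_θ (J Y) = J ∇_θ Y`, which come from the torsion, cancel. -/
theorem IsMinimalConnectionOn.acs_cov_sub {J : AlmostComplexStructure I M} {U : Set M}
    {cov : (Π x : M, TangentSpace I x) → (Π x : M, TangentSpace I x →L[ℝ] TangentSpace I x)}
    (h : IsMinimalConnectionOn J U cov) {p : M} (hp : p ∈ U) {Y θ : Π x : M, TangentSpace I x}
    (hY : MDiffAt (T% Y) p) (hθ : MDiffAt (T% θ) p) :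
    J p (cov θ p (Y p)) - cov θ p (J p (Y p))
      = (J p (mlieBracket I Y θ p) - mlieBracket I (fun y ↦ J y (Y y)) θ p)
        - (1 / 2 : ℝ) • J p (nijenhuis J p (θ p) (Y p)) := by
  have h1 := h.torsion p hp Y θ hY hθ
  have h2 := h.torsion p hp (fun y ↦ J y (Y y)) θ (J.mdifferentiableAt_apply hY) hθ
  rw [h.complexLinear p hp Y hY, nijenhuis_swap, nijenhuis_acs_right] at h2
  rw [nijenhuis_swap] at h1
  have e1 : cov θ p (Y p) = cov Y p (θ p) + mlieBracket I Y θ p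
      + (1 / 4 : ℝ) • -nijenhuis J p (θ p) (Y p) := by rw [← h1]; abel
  have e2 : cov θ p (J p (Y p)) = J p (cov Y p (θ p)) + mlieBracket I (fun y ↦ J y (Y y)) θ p
      + (1 / 4 : ℝ) • - -J p (nijenhuis J p (θ p) (Y p)) := by rw [← h2]; abel
  rw [e1, e2]
  simp only [map_add, map_smul, map_neg]
  module
end MinimalIdentity

section NBI
variable {EL : Type*} [NormedAddCommGroup EL] [NormedSpace ℝ EL] [FiniteDimensional ℝ EL]
  {HL : Type*} [TopologicalSpace HL] {IL : ModelWithCorners ℝ EL HL} [IL.Boundaryless]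
  {L : Type*} [TopologicalSpace L] [ChartedSpace HL L]
  {F : Type*} [NormedAddCommGroup F] [NormedSpace ℝ F] [FiniteDimensional ℝ F]
  {N : L → Type*} [TopologicalSpace (TotalSpace F N)]
  [∀ x, AddCommGroup (N x)] [∀ x, Module ℝ (N x)] [∀ x, TopologicalSpace (N x)]
  [FiberBundle F N] [VectorBundle ℝ F N] [IsManifold IL ∞ L] [ContMDiffVectorBundle ∞ F N IL]
  [∀ x, IsTopologicalAddGroup (N x)] [∀ x, ContinuousSMul ℝ (N x)]
  {EM : Type*} [NormedAddCommGroup EM] [NormedSpace ℝ EM] [FiniteDimensional ℝ EM]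
  {HM : Type*} [TopologicalSpace HM] {IM : ModelWithCorners ℝ EM HM} [IM.Boundaryless]
  {M : Type*} [TopologicalSpace M] [ChartedSpace HM M] [IsManifold IM ∞ M]
  {x₀ x : L} {ψ : EL × F → M}
  {JL : AlmostComplexStructure IL L} {JM : AlmostComplexStructure IM M} {ι : L → M}
  {χ : Π x : L, TangentSpace IM (ι x) →L[ℝ] N x}
  {U : Set M}
  {cov : (Π x : M, TangentSpace IM x) → (Π x : M, TangentSpace IM x →L[ℝ] TangentSpace IM x)}

namespace IsAdaptedParam

/-- The normal part of `J ∇_u θ - ∇_{Ju} θ`, for a minimal connection and a vector `u` that is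
tangent to the submanifold. -/
theorem fiberCoord_cov (h : IsAdaptedParam IL JM ι χ x₀ x ψ)
    (hx : x ∈ coordDom IL F N x₀) (hι : IsPHSubmanifold JL JM ι)
    (hcov : IsMinimalConnectionOn JM U cov) (hxU : ι x ∈ U)
    {θ : Π y : M, TangentSpace IM y} (hθ : MDiffAt (T% θ) (ι x)) (u : TangentSpace IL x) :
    fiberBlock (pullEndo IM ψ JM) (extChartAt IL x₀ x)
          (fiberCoord F x₀ x (χ x (cov θ (ι x) (mfderiv IL IM ι x u))))
        - fiberCoord F x₀ x (χ x (cov θ (ι x) (mfderiv IL IM ι x (JL x u))))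
      = fiberBlock (pullEndo IM ψ JM) (extChartAt IL x₀ x)
          (mvfderiv IL (localSection F x₀ (fun y ↦ χ y (θ (ι y)))) x u)
        - mvfderiv IL (localSection F x₀ (fun y ↦ χ y (θ (ι y)))) x (JL x u)
        + integrableMixed (baseEndo x₀ JL) (mixedBlock (pullEndo IM ψ JM))
            (fiberBlock (pullEndo IM ψ JM)) (extChartAt IL x₀ x)
            (fiberCoord F x₀ x (χ x (θ (ι x)))) (chartDeriv IL x₀ x u) := by
  let Y := FiberBundle.extend EM (mfderiv IL IM ι x u)
  have hY : MDiffAt (T% Y) (ι x) := FiberBundle.mdifferentiableAt_extend IM EM _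
  have hu : Y (ι x) = mfderiv IL IM ι x u := by simp [Y]
  have h1 := hcov.acs_cov_sub hxU hY hθ
  have h3 := h.fiberCoord_bracket hx hι hY hθ hu
  have h4 := h.fiberCoord_nijenhuis hx hι (θ (ι x)) u
  have hsub (V W : TangentSpace IM (ι x)) : fiberCoord F x₀ x (χ x (V - W))
      = fiberCoord F x₀ x (χ x V) - fiberCoord F x₀ x (χ x W) := by rw [map_sub, map_sub]
  have h5 : fiberCoord F x₀ x (χ x _) = fiberCoord F x₀ x (χ x _) :=
    congrArg (fun V ↦ fiberCoord F x₀ x (χ x V)) h1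
  rw [hsub, hsub (JM (ι x) _ - _), h3, map_smul, map_smul, h.fiberCoord_endo hx hι,
    h.fiberCoord_endo hx hι, hu, h4, ← hι.comm] at h5
  rw [h5, integrableMixed_apply]
  abel

/-- A structure on the normal bundle satisfies the conditions that define the NB-I structure at the
points over `x`, for a given minimal connection, if and only if it is given by the blocks of the
normally integrable form of the linearization. -/
theorem nbi_iff (h : IsAdaptedParam IL JM ι χ x₀ x ψ)
    (hx : x ∈ coordDom IL F N x₀) (hι : IsPHSubmanifold JL JM ι)
    (hχ : Function.Surjective (χ x))
    (hcov : IsMinimalConnectionOn JM U cov) (hxU : ι x ∈ U)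
    (K : AlmostComplexStructure (IL.prod 𝓘(ℝ, F)) (TotalSpace F N)) :
    ((∀ (a : N x) (v : TangentSpace IM (ι x)),
        K ⟨x, a⟩ (vert IL F a (χ x v)) = vert IL F a (χ x (JM (ι x) v))) ∧
      (∀ θ : Π y : M, TangentSpace IM y, MDiffAt (T% θ) (ι x) → ∀ u : TangentSpace IL x,
        K ⟨x, χ x (θ (ι x))⟩
            (horizLift IL F (fun x' ↦ χ x' (θ (ι x'))) x u
              (χ x (cov θ (ι x) (mfderiv IL IM ι x u))))
          = horizLift IL F (fun x' ↦ χ x' (θ (ι x'))) x (JL x u)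
              (χ x (cov θ (ι x) (mfderiv IL IM ι x (JL x u)))))) ↔
    ∀ a : F, bundleEndo x₀ K (extChartAt IL x₀ x, a)
      = linearModel (baseEndo x₀ JL)
        (integrableMixed (baseEndo x₀ JL) (mixedBlock (pullEndo IM ψ JM))
          (fiberBlock (pullEndo IM ψ JM)))
        (fiberBlock (pullEndo IM ψ JM)) (extChartAt IL x₀ x, a) := by
  -- both conditions, in coordinates
  have hvert (a : N x) (v : TangentSpace IM (ι x)) :
      K ⟨x, a⟩ (vert IL F a (χ x v)) = vert IL F a (χ x (JM (ι x) v)) ↔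
        bundleEndo x₀ K (extChartAt IL x₀ x, fiberCoord F x₀ x a) (0, fiberCoord F x₀ x (χ x v))
          = (0, fiberBlock (pullEndo IM ψ JM) (extChartAt IL x₀ x)
            (fiberCoord F x₀ x (χ x v))) := by
    rw [← (totalDeriv_injective hx a).eq_iff, totalDeriv_bundleEndo hx, totalDeriv_vert hx,
      totalDeriv_vert hx, h.fiberCoord_endo hx hι]
  have hhor (θ : Π y : M, TangentSpace IM y) (hθ : MDiffAt (T% θ) (ι x))
      (u : TangentSpace IL x) :
      K ⟨x, χ x (θ (ι x))⟩
            (horizLift IL F (fun x' ↦ χ x' (θ (ι x'))) x u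
              (χ x (cov θ (ι x) (mfderiv IL IM ι x u))))
          = horizLift IL F (fun x' ↦ χ x' (θ (ι x'))) x (JL x u)
              (χ x (cov θ (ι x) (mfderiv IL IM ι x (JL x u)))) ↔
        bundleEndo x₀ K (extChartAt IL x₀ x, fiberCoord F x₀ x (χ x (θ (ι x))))
          (chartDeriv IL x₀ x u,
            mvfderiv IL (localSection F x₀ (fun y ↦ χ y (θ (ι y)))) x u
              - fiberCoord F x₀ x (χ x (cov θ (ι x) (mfderiv IL IM ι x u))))
          = (baseEndo x₀ JL (extChartAt IL x₀ x) (chartDeriv IL x₀ x u),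
            integrableMixed (baseEndo x₀ JL) (mixedBlock (pullEndo IM ψ JM))
              (fiberBlock (pullEndo IM ψ JM)) (extChartAt IL x₀ x)
              (fiberCoord F x₀ x (χ x (θ (ι x)))) (chartDeriv IL x₀ x u)
            + fiberBlock (pullEndo IM ψ JM) (extChartAt IL x₀ x)
              (mvfderiv IL (localSection F x₀ (fun y ↦ χ y (θ (ι y)))) x u
                - fiberCoord F x₀ x (χ x (cov θ (ι x) (mfderiv IL IM ι x u))))) := by
    have hs := h.mdifferentiableAt_section hx hθ
    have h1 := h.fiberCoord_cov hx hι hcov hxU hθ u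
    have h2 : mvfderiv IL (localSection F x₀ (fun y ↦ χ y (θ (ι y)))) x (JL x u)
        - fiberCoord F x₀ x (χ x (cov θ (ι x) (mfderiv IL IM ι x (JL x u))))
        = integrableMixed (baseEndo x₀ JL) (mixedBlock (pullEndo IM ψ JM))
              (fiberBlock (pullEndo IM ψ JM)) (extChartAt IL x₀ x)
              (fiberCoord F x₀ x (χ x (θ (ι x)))) (chartDeriv IL x₀ x u)
            + fiberBlock (pullEndo IM ψ JM) (extChartAt IL x₀ x)
              (mvfderiv IL (localSection F x₀ (fun y ↦ χ y (θ (ι y)))) x u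
                - fiberCoord F x₀ x (χ x (cov θ (ι x) (mfderiv IL IM ι x u)))) := by
      rw [map_sub, sub_eq_iff_eq_add.1 h1]
      abel
    have h3 := totalDeriv_horizLift hx hs u (χ x (cov θ (ι x) (mfderiv IL IM ι x u)))
    have h4 := totalDeriv_horizLift hx hs (JL x u)
      (χ x (cov θ (ι x) (mfderiv IL IM ι x (JL x u))))
    rw [← (totalDeriv_injective hx (χ x (θ (ι x)))).eq_iff, totalDeriv_bundleEndo hx, h3, h4,
      h2, chartDeriv_baseEndo hx]
  have hsurj (w : F) : ∃ V, fiberCoord F x₀ x (χ x V) = w := by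
    obtain ⟨V, hV⟩ := hχ (fiberCoordSymm F N x₀ x w)
    exact ⟨V, by rw [hV, fiberCoord_symm hx]⟩
  constructor
  · rintro ⟨h1, h2⟩ a
    obtain ⟨V, rfl⟩ := hsurj a
    have h3 (w : F) : bundleEndo x₀ K (extChartAt IL x₀ x, fiberCoord F x₀ x (χ x V)) (0, w)
        = (0, fiberBlock (pullEndo IM ψ JM) (extChartAt IL x₀ x) w) := by
      obtain ⟨W, rfl⟩ := hsurj w
      exact (hvert _ W).1 (h1 _ W)
    -- the horizontal lifts along a section through the given point of the fibre, together with the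
    -- vertical vectors, span the tangent space
    let θ := FiberBundle.extend EM V
    have hθ : MDiffAt (T% θ) (ι x) := FiberBundle.mdifferentiableAt_extend IM EM V
    have hV : θ (ι x) = V := by simp [θ]
    refine ContinuousLinearMap.ext fun v ↦ ?_
    obtain ⟨u, hu⟩ := (chartDeriv_isInvertible hx.1).bijective.surjective v.1
    have h4 := (hhor θ hθ u).1 (h2 θ hθ u)
    rw [hV] at h4
    set b := mvfderiv IL (localSection F x₀ (fun y ↦ χ y (θ (ι y)))) x u
      - fiberCoord F x₀ x (χ x (cov θ (ι x) (mfderiv IL IM ι x u))) with hb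
    have e : v = (chartDeriv IL x₀ x u, b) + (0, v.2 - b) := by
      rw [hu]; refine Prod.ext ?_ ?_ <;> simp
    rw [e, map_add, h4, h3]
    simp only [linearModel, blockEndo_apply, Prod.mk_add_mk, add_zero, map_sub,
      add_sub_cancel]
    refine Prod.ext rfl ?_
    simp only
    abel
  · intro hK
    refine ⟨fun a v ↦ (hvert a v).2 ?_, fun θ hθ u ↦ (hhor θ hθ u).2 ?_⟩
    · rw [hK]; simp [linearModel]
    · rw [hK]; rfl

end IsAdaptedParam

/-- The normally integrable form of the linearization, in an adapted parametrization. -/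
theorem IsLinearization.bundleEndo_integrable [T2Space L] [SigmaCompactSpace L]
    {K J₁ : AlmostComplexStructure (IL.prod 𝓘(ℝ, F)) (TotalSpace F N)}
    (hK : IsLinearization JL JM ι χ K) (hPH : IsPHVectorBundle JL K)
    (hJ₁ : ∀ (x : L) (a : N x) (v : TangentSpace (IL.prod 𝓘(ℝ, F)) (⟨x, a⟩ : TotalSpace F N)),
      J₁ ⟨x, a⟩ v = K ⟨x, a⟩ v
        - (1 / 2 : ℝ) • K ⟨x, a⟩ (nijenhuis K ⟨x, a⟩ (vert IL F a a) v))
    (h : IsAdaptedParam IL JM ι χ x₀ x ψ) (hx : x ∈ coordDom IL F N x₀) (a : F) :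
    bundleEndo x₀ J₁ (extChartAt IL x₀ x, a)
      = linearModel (baseEndo x₀ JL)
        (integrableMixed (baseEndo x₀ JL) (mixedBlock (pullEndo IM ψ JM))
          (fiberBlock (pullEndo IM ψ JM)))
        (fiberBlock (pullEndo IM ψ JM)) (extChartAt IL x₀ x, a) := by
  have h1 : ∀ᶠ z in 𝓝 (extChartAt IL x₀ x),
      mixedBlock (bundleEndo x₀ K) z = mixedBlock (pullEndo IM ψ JM) z ∧
      fiberBlock (bundleEndo x₀ K) z = fiberBlock (pullEndo IM ψ JM) z := by
    filter_upwards [(tendsto_extChartAt_symm hx).eventually (h.eventually hx),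
      eventually_extChartAt_symm hx] with z hz1 hz2
    have := blocks_eq_of_linear (J := baseEndo x₀ JL
        (extChartAt IL x₀ ((extChartAt IL x₀).symm z))) (C := mixedBlock (pullEndo IM ψ JM)
        (extChartAt IL x₀ ((extChartAt IL x₀).symm z)))
      (j := fiberBlock (pullEndo IM ψ JM) (extChartAt IL x₀ ((extChartAt IL x₀).symm z)))
      ((contDiffAt_bundleEndo hz2.1 K 0).differentiableAt (by simp)) (hK x₀ _ hz2.1 ψ hz1)
    rwa [hz2.2] at this
  have h2 : fiberBlock (bundleEndo x₀ K) =ᶠ[𝓝 (extChartAt IL x₀ x)]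
      fiberBlock (pullEndo IM ψ JM) := h1.mono fun z hz ↦ hz.2
  rw [hPH.bundleEndo_integrable hJ₁ hx a]
  simp only [linearModel, integrableMixed, mixedNijenhuis, h1.self_of_nhds.1, h1.self_of_nhds.2,
    h2.fderiv_eq]

/-- A structure that is, in adapted parametrizations, the normally integrable form of the
linearization is the only NB-I structure; totally geodesic minimal connections are needed for the
existence only. -/
theorem isNBI_iff {J₁ : AlmostComplexStructure (IL.prod 𝓘(ℝ, F)) (TotalSpace F N)}
    (hι : IsPHSubmanifold JL JM ι) (hχ : IsNormalBundle IL IM F ι χ)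
    (hψ : ∀ x : L, ∃ ψ : EL × F → M, IsAdaptedParam IL JM ι χ x x ψ)
    (hJ₁ : ∀ x : L, ∀ ψ : EL × F → M, IsAdaptedParam IL JM ι χ x x ψ → ∀ a : F,
      bundleEndo x J₁ (extChartAt IL x x, a)
      = linearModel (baseEndo x JL)
        (integrableMixed (baseEndo x JL) (mixedBlock (pullEndo IM ψ JM))
          (fiberBlock (pullEndo IM ψ JM)))
        (fiberBlock (pullEndo IM ψ JM)) (extChartAt IL x x, a))
    (hmin : ∀ x₀ : L, ∃ U : Set M, IsOpen U ∧ ι x₀ ∈ U ∧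
      ∃ cov : (Π y : M, TangentSpace IM y) →
          (Π y : M, TangentSpace IM y →L[ℝ] TangentSpace IM y),
        IsMinimalConnectionOn JM U cov ∧ IsTotallyGeodesicOn IL ι U cov)
    (K : AlmostComplexStructure (IL.prod 𝓘(ℝ, F)) (TotalSpace F N)) :
    IsNBI JL JM ι χ K ↔ K = J₁ := by
  constructor
  · intro h
    refine AlmostComplexStructure.ext (funext fun ⟨x, a⟩ ↦ ContinuousLinearMap.ext fun v ↦ ?_)
    have hx : x ∈ coordDom IL F N x := mem_coordDom_self x
    obtain ⟨U, -, hxU, cov, hcov, -, hK⟩ := h x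
    obtain ⟨ψ, hψ⟩ := hψ x
    have h1 := (hψ.nbi_iff hx hι (hχ.surjective x) hcov hxU K).1 (hK x hxU)
    apply totalDeriv_injective hx a
    refine (totalDeriv_bundleEndo hx K a v).trans
      (Eq.trans ?_ (totalDeriv_bundleEndo hx J₁ a v).symm)
    rw [h1, hJ₁ x ψ hψ]
  · rintro rfl x₀
    obtain ⟨U, hU, hxU, cov, hcov, hgeo⟩ := hmin x₀
    refine ⟨U, hU, hxU, cov, hcov, hgeo, fun x hxU ↦ ?_⟩
    obtain ⟨ψ, hψ⟩ := hψ x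
    exact (hψ.nbi_iff (mem_coordDom_self x) hι (hχ.surjective x) hcov hxU K).2 (hJ₁ x ψ hψ)

end NBI


/-! ### Minimal connections in a local parametrization -/

section ParamConnection
variable {E : Type*} [NormedAddCommGroup E] [NormedSpace ℝ E]
  {H : Type*} [TopologicalSpace H] {I : ModelWithCorners ℝ E H}
  {M : Type*} [TopologicalSpace M] [ChartedSpace H M]
  {E' : Type*} [NormedAddCommGroup E'] [NormedSpace ℝ E'] [CompleteSpace E']

variable (I) in
/-- Near `p`, the map `g` is a smooth inverse of the local parametrization `ψ`. -/
structure IsParamInverseAt (ψ : E' → M) (g : M → E') (p : M) : Prop where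
  smooth : ContMDiffAt I 𝓘(ℝ, E') ∞ g p
  isParamAt : IsParamAt I ψ (g p)
  right : ∀ᶠ y in 𝓝 p, ψ (g y) = y
  left : ∀ᶠ q in 𝓝 (g p), g (ψ q) = q

variable {ψ : E' → M} {g : M → E'} {q : E'} {p : M}

theorem IsParamInverseAt.apply_eq (h : IsParamInverseAt I ψ g p) : ψ (g p) = p :=
  h.right.self_of_nhds

/-- The inverse function theorem for local parametrizations. -/
theorem IsParamAt.exists_inverse [I.Boundaryless] [IsManifold I ∞ M] (h : IsParamAt I ψ q) :
    ∃ g : M → E', g (ψ q) = q ∧ ∀ᶠ p in 𝓝 (ψ q), IsParamInverseAt I ψ g p := by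
  have hsrc : ψ q ∈ (extChartAt I (ψ q)).source := mem_extChartAt_source _
  set c := extChartAt I (ψ q) with hc
  have hd {z : E'} (hz : IsParamAt I ψ z) (hzs : ψ z ∈ c.source) :
      ∃ A : E' ≃L[ℝ] E, HasFDerivAt (fun z ↦ c (ψ z)) (A : E' →L[ℝ] E) z := by
    obtain ⟨A, hA⟩ := hz.fderiv_chart_isInvertible (ψ q) hzs
    exact ⟨A, by rw [hA]; exact ((hz.contDiffAt_chart (ψ q) hzs).differentiableAt
      (by simp)).hasFDerivAt⟩
  obtain ⟨A, hA⟩ := hd h hsrc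
  let e := (h.contDiffAt_chart (ψ q) hsrc).toOpenPartialHomeomorph _ hA (by simp)
  have hqe : q ∈ e.source := ContDiffAt.mem_toOpenPartialHomeomorph_source _ hA (by simp)
  have he (z : E') : e z = c (ψ z) := rfl
  let g : M → E' := fun y ↦ e.symm (c y)
  have hgq : g (ψ q) = q := e.left_inv hqe
  have hev : ∀ᶠ z in 𝓝 q, IsParamAt I ψ z ∧ ψ z ∈ c.source ∧ z ∈ e.source := by
    filter_upwards [h.eventually, h.smooth.continuousAt.preimage_mem_nhds
      (extChartAt_source_mem_nhds (I := I) (ψ q)), e.open_source.mem_nhds hqe] with z h1 h2 h3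
    exact ⟨h1, h2, h3⟩
  have hcc : ContinuousAt c (ψ q) := continuousAt_extChartAt _
  have hte : c (ψ q) ∈ e.target := e.map_source hqe
  have hgc : Tendsto g (𝓝 (ψ q)) (𝓝 q) := by
    have h1 : ContinuousAt g (ψ q) := ContinuousAt.comp (g := e.symm) (f := c)
      (e.continuousAt_symm hte) hcc
    have h2 := h1.tendsto
    rwa [hgq] at h2
  have h1 : ∀ᶠ y in 𝓝 (ψ q), y ∈ c.source ∧ c y ∈ e.target ∧
      IsParamAt I ψ (g y) ∧ ψ (g y) ∈ c.source ∧ g y ∈ e.source := by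
    filter_upwards [extChartAt_source_mem_nhds (I := I) (ψ q),
      hcc.preimage_mem_nhds (e.open_target.mem_nhds hte), hgc.eventually hev] with y a b d
    exact ⟨a, b, d⟩
  have h2 : ∀ᶠ y in 𝓝 (ψ q), ψ (g y) = y := by
    filter_upwards [h1] with y ⟨hy1, hy2, hy3, hy4, hy5⟩
    exact c.injOn hy4 hy1 (e.right_inv hy2)
  refine ⟨g, hgq, ?_⟩
  filter_upwards [h1, h2.eventually_nhds] with y ⟨hy1, hy2, hy3, hy4, hy5⟩ hy6
  refine ⟨?_, hy3, hy6, ?_⟩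
  · obtain ⟨B, hB⟩ := hd hy3 hy4
    have := e.contDiffAt_symm (n := ∞) hy2 hB (hy3.contDiffAt_chart (ψ q) hy4)
    exact this.contMDiffAt.comp y (contMDiffAt_extChartAt' (by simpa [hc] using hy1))
  · filter_upwards [e.open_source.mem_nhds hy5] with z hz
    exact e.left_inv hz

variable (I) in
/-- The differential of a local parametrization `ψ` at `q`, as a map to the tangent space at a
point `p` that is equal to `ψ q`. -/
def pushVec (ψ : E' → M) (q : E') (p : M) : E' →L[ℝ] TangentSpace I p := paramDeriv I ψ q

namespace IsParamAt

theorem pullVec_pushVec (h : IsParamAt I ψ q) (p : M) (v : E') :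
    pullVec I ψ q p (pushVec I ψ q p v) = v := h.inverse_deriv v

theorem fderiv_comp (h : IsParamAt I ψ q) (hp : ψ q = p) {f : M → ℝ} (hf : MDiffAt f p)
    (v : TangentSpace I p) :
    DifferentiableAt ℝ (fun z ↦ f (ψ z)) q ∧
      fderiv ℝ (fun z ↦ f (ψ z)) q (pullVec I ψ q p v) = mvfderiv I f p v := by
  subst hp
  have h1 : HasFDerivAt (fun z ↦ f (ψ z)) ((mvfderiv I f (ψ q)).comp (paramDeriv I ψ q)) q :=
    (hf.hasMFDerivAt.comp q h.mdifferentiableAt.hasMFDerivAt).hasFDerivAt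
  refine ⟨h1.differentiableAt, ?_⟩
  rw [h1.fderiv, ContinuousLinearMap.comp_apply]
  exact congrArg _ (h.deriv_inverse v)

end IsParamAt

variable (I) in
/-- The connection with Christoffel symbols `Γ` in the local parametrization `ψ` with inverse
`g`. -/
def paramConnection (ψ : E' → M) (g : M → E') (Γ : E' → E' →L[ℝ] E' →L[ℝ] E')
    (Y : Π y : M, TangentSpace I y) (y : M) : TangentSpace I y →L[ℝ] TangentSpace I y :=
  pushVec I ψ (g y) y ∘L
    (fderiv ℝ (pullField I ψ Y) (g y) + Γ (g y) (pullField I ψ Y (g y))) ∘L pullVec I ψ (g y) y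

variable {Γ : E' → E' →L[ℝ] E' →L[ℝ] E'}

namespace IsParamInverseAt

theorem pullVec_paramConnection (h : IsParamInverseAt I ψ g p) (Y : Π y : M, TangentSpace I y)
    (u : TangentSpace I p) :
    pullVec I ψ (g p) p (paramConnection I ψ g Γ Y p u)
      = fderiv ℝ (pullField I ψ Y) (g p) (pullVec I ψ (g p) p u)
        + Γ (g p) (pullVec I ψ (g p) p (Y p)) (pullVec I ψ (g p) p u) := by
  rw [pullVec_field h.apply_eq]
  exact h.isParamAt.pullVec_pushVec p _

variable [IsManifold I ∞ M]

theorem differentiableAt_pullField (h : IsParamInverseAt I ψ g p) {Y : Π y : M, TangentSpace I y}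
    (hY : MDiffAt (T% Y) p) : DifferentiableAt ℝ (pullField I ψ Y) (g p) :=
  h.isParamAt.differentiableAt_pullField (by rw [h.apply_eq]; exact hY)

theorem paramConnection_add (h : IsParamInverseAt I ψ g p) {Y Y' : Π y : M, TangentSpace I y}
    (hY : MDiffAt (T% Y) p) (hY' : MDiffAt (T% Y') p) :
    paramConnection I ψ g Γ (Y + Y') p
      = paramConnection I ψ g Γ Y p + paramConnection I ψ g Γ Y' p := by
  refine ContinuousLinearMap.ext fun u ↦ h.isParamAt.pullVec_injective p ?_
  have e : pullField I ψ (Y + Y') = pullField I ψ Y + pullField I ψ Y' := by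
    ext z; exact map_add (paramDeriv I ψ z).inverse _ _
  rw [add_apply, map_add, h.pullVec_paramConnection, h.pullVec_paramConnection,
    h.pullVec_paramConnection, e,
    fderiv_add (h.differentiableAt_pullField hY) (h.differentiableAt_pullField hY')]
  simp only [Pi.add_apply, map_add, add_apply]
  abel

theorem paramConnection_leibniz (h : IsParamInverseAt I ψ g p) {Y : Π y : M, TangentSpace I y}
    {f : M → ℝ} (hY : MDiffAt (T% Y) p) (hf : MDiffAt f p) :
    paramConnection I ψ g Γ (f • Y) p
      = f p • paramConnection I ψ g Γ Y p + (mvfderiv I f p).smulRight (Y p) := by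
  refine ContinuousLinearMap.ext fun u ↦ h.isParamAt.pullVec_injective p ?_
  have e : pullField I ψ (f • Y) = (fun z ↦ f (ψ z)) • pullField I ψ Y := by
    ext z; exact map_smul (paramDeriv I ψ z).inverse _ _
  obtain ⟨h1, h2⟩ := h.isParamAt.fderiv_comp h.apply_eq hf u
  rw [add_apply, map_add, h.pullVec_paramConnection, e,
    fderiv_smul h1 (h.differentiableAt_pullField hY)]
  simp only [smul_apply, map_smul, h.pullVec_paramConnection, add_apply, Pi.smul_apply',
    ContinuousLinearMap.smulRight_apply, h2, h.apply_eq, smul_add, pullVec_field h.apply_eq]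
  abel

theorem smoothEndoAt_paramConnection (h : IsParamInverseAt I ψ g p)
    (hΓ : ContDiffAt ℝ ∞ Γ (g p)) {Y : Π y : M, TangentSpace I y}
    (hY : ContMDiffAt I I.tangent ∞ (T% Y) p) : SmoothEndoAt (paramConnection I ψ g Γ Y) p := by
  refine h.isParamAt.smoothEndoAt_of_pullEndo h.smooth rfl h.right ?_
  have h1 : ContDiffAt ℝ ∞ (pullField I ψ Y) (g p) :=
    h.isParamAt.contDiffAt_pullField (by rw [h.apply_eq]; exact hY)
  have h2 : ContDiffAt ℝ ∞ (fderiv ℝ (pullField I ψ Y)) (g p) := h1.fderiv_right (by simp)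
  refine (h2.add (hΓ.clm_apply h1)).congr_of_eventuallyEq ?_
  filter_upwards [h.left, h.isParamAt.eventually] with z hz hz'
  refine ContinuousLinearMap.ext fun v ↦ ?_
  have h3 : pullEndo I ψ (paramConnection I ψ g Γ Y) z v
      = pullVec I ψ z (ψ z) (pushVec I ψ (g (ψ z)) (ψ z)
        ((fderiv ℝ (pullField I ψ Y) (g (ψ z)) + Γ (g (ψ z)) (pullField I ψ Y (g (ψ z))))
          (pullVec I ψ (g (ψ z)) (ψ z) (paramDeriv I ψ z v)))) := rfl
  rw [h3, hz, hz'.pullVec_pushVec, hz'.pullVec_paramDeriv]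

end IsParamInverseAt

/-- The Christoffel symbols of a minimal connection of the almost complex structure `k` on a normed
space: `∇_u Y = D_u Y - ¼ ((D_{kY} k) u + k (D_Y k) u + 2 k (D_u k) Y)`. -/
def minimalChristoffel (k : E' → E' →L[ℝ] E') (z : E') : E' →L[ℝ] E' →L[ℝ] E' :=
  (-(1 / 4) : ℝ) • (fderiv ℝ k z ∘L k z
    + (ContinuousLinearMap.compL ℝ E' E' E' (k z)) ∘L (fderiv ℝ k z)
    + (2 : ℝ) • (ContinuousLinearMap.compL ℝ E' E' E' (k z)) ∘L (fderiv ℝ k z).flip)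

theorem minimalChristoffel_apply (k : E' → E' →L[ℝ] E') (z Y u : E') :
    minimalChristoffel k z Y u = (-(1 / 4) : ℝ) • (fderiv ℝ k z (k z Y) u
      + k z (fderiv ℝ k z Y u) + (2 : ℝ) • k z (fderiv ℝ k z u Y)) := rfl

theorem ContDiffAt.minimalChristoffel {k : E' → E' →L[ℝ] E'} {z : E'} (hk : ContDiffAt ℝ ∞ k z) :
    ContDiffAt ℝ ∞ (minimalChristoffel k) z := by
  have hd : ContDiffAt ℝ ∞ (fderiv ℝ k) z := hk.fderiv_right (by simp)
  have hflip : ContDiffAt ℝ ∞ (fun y ↦ (fderiv ℝ k y).flip) z :=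
    ((ContinuousLinearMap.flipₗᵢ ℝ E' E' E').contDiff).contDiffAt.comp z hd
  have hc : ContDiffAt ℝ ∞ (fun y ↦ ContinuousLinearMap.compL ℝ E' E' E' (k y)) z :=
    (ContinuousLinearMap.compL ℝ E' E' E').contDiff.contDiffAt.comp z hk
  exact (((hd.clm_comp hk).add (hc.clm_comp hd)).add
    ((hc.clm_comp hflip).const_smul (2 : ℝ))).const_smul (-(1 / 4) : ℝ)

variable [IsManifold I ∞ M] [FiniteDimensional ℝ E]

/-- In a local parametrization, the Christoffel symbols `minimalChristoffel` define a minimal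
connection. -/
theorem isMinimalConnectionOn_paramConnection (J : AlmostComplexStructure I M) {U : Set M}
    (hU : IsOpen U) (h : ∀ y ∈ U, IsParamInverseAt I ψ g y) :
    IsMinimalConnectionOn J U
      (paramConnection I ψ g (minimalChristoffel (pullEndo I ψ J))) where
  isCovariantDerivativeOn :=
    { add := fun hY hY' hy ↦ (h _ hy).paramConnection_add hY hY'
      leibniz := fun hY hf hy ↦ (h _ hy).paramConnection_leibniz hY hf }
  smooth :=
    { contMDiff := fun {Y} hY y hy ↦ ((h y hy).smoothEndoAt_paramConnection
        ((h y hy).isParamAt.contDiffAt_pullEndo_acs J).minimalChristoffel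
        ((hY y hy).contMDiffAt (hU.mem_nhds hy))).contMDiffWithinAt }
  complexLinear y hy Y hY u := by
    have hi := h y hy
    have hp := hi.isParamAt
    apply hp.pullVec_injective y
    have hY' : MDiffAt (T% Y) (ψ (g y)) := by rw [hi.apply_eq]; exact hY
    have hsq (v : E') := hp.pullEndo_sq J v
    have ha (u v : E') : fderiv ℝ (pullEndo I ψ J) (g y) u (pullEndo I ψ J (g y) v)
        = -pullEndo I ψ J (g y) (fderiv ℝ (pullEndo I ψ J) (g y) u v) :=
      fderiv_anticomm (hp.differentiableAt_pullEndo J)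
        (hp.eventually.mono fun q hq ↦ hq.pullEndo_sq J) u v
    rw [hi.pullVec_paramConnection, hp.pullVec_endo hi.apply_eq, hp.pullVec_endo hi.apply_eq,
      hi.pullVec_paramConnection, hp.fderiv_pullField_acs J hY', ← pullVec_field hi.apply_eq,
      minimalChristoffel_apply, minimalChristoffel_apply]
    simp only [map_add, map_smul, ha, hsq, map_neg, neg_apply]
    module
  torsion y hy X Y hX hY := by
    have hi := h y hy
    have hp := hi.isParamAt
    apply hp.pullVec_injective y
    rw [map_sub, map_sub, map_smul, hi.pullVec_paramConnection, hi.pullVec_paramConnection,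
      hp.pullVec_mlieBracket hi.apply_eq hX hY, hp.pullVec_nijenhuis hi.apply_eq,
      minimalChristoffel_apply, minimalChristoffel_apply, flatNijenhuis]
    module

end ParamConnection


/-! ### Totally geodesic minimal connections -/

section TotallyGeodesic
variable {EL : Type*} [NormedAddCommGroup EL] [NormedSpace ℝ EL] [FiniteDimensional ℝ EL]
  {HL : Type*} [TopologicalSpace HL] {IL : ModelWithCorners ℝ EL HL} [IL.Boundaryless]
  {L : Type*} [TopologicalSpace L] [ChartedSpace HL L]
  {F : Type*} [NormedAddCommGroup F] [NormedSpace ℝ F] [FiniteDimensional ℝ F]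
  {N : L → Type*} [TopologicalSpace (TotalSpace F N)]
  [∀ x, AddCommGroup (N x)] [∀ x, Module ℝ (N x)] [∀ x, TopologicalSpace (N x)]
  [FiberBundle F N] [VectorBundle ℝ F N] [IsManifold IL ∞ L] [ContMDiffVectorBundle ∞ F N IL]
  [∀ x, IsTopologicalAddGroup (N x)] [∀ x, ContinuousSMul ℝ (N x)]
  {EM : Type*} [NormedAddCommGroup EM] [NormedSpace ℝ EM] [FiniteDimensional ℝ EM]
  {HM : Type*} [TopologicalSpace HM] {IM : ModelWithCorners ℝ EM HM} [IM.Boundaryless]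
  {M : Type*} [TopologicalSpace M] [ChartedSpace HM M] [IsManifold IM ∞ M]
  {x₀ x : L} {ψ : EL × F → M} {g : M → EL × F}
  {JL : AlmostComplexStructure IL L} {JM : AlmostComplexStructure IM M} {ι : L → M}
  {χ : Π x : L, TangentSpace IM (ι x) →L[ℝ] N x}

namespace IsAdaptedParam

/-- In an adapted parametrization, the minimal connection given by `minimalChristoffel` preserves
the tangent bundle of the submanifold, because `JM` does. -/
theorem paramConnection_mem_range (h : IsAdaptedParam IL JM ι χ x₀ x ψ)
    (hx : x ∈ coordDom IL F N x₀) (hι : IsPHSubmanifold JL JM ι) (hχ : IsNormalBundle IL IM F ι χ)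
    (hg : IsParamInverseAt IM ψ g (ι x)) (hgx : g (ι x) = (extChartAt IL x₀ x, 0))
    {X : Π y : M, TangentSpace IM y} (hX : MDiffAt (T% X) (ι x))
    (hXL : ∀ᶠ x' in 𝓝 x, X (ι x') ∈ (mfderiv IL IM ι x').range) (u : TangentSpace IL x) :
    paramConnection IM ψ g (minimalChristoffel (pullEndo IM ψ JM)) X (ι x) (mfderiv IL IM ι x u)
      ∈ (mfderiv IL IM ι x).range := by
  have hd := h.isParamAt.differentiableAt_pullEndo JM
  obtain ⟨w, hw⟩ := hXL.self_of_nhds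
  have hw' : X (ι x) = mfderiv IL IM ι x w := hw.symm
  have hD (a b : EL) : (fderiv ℝ (pullEndo IM ψ JM) (extChartAt IL x₀ x, 0) (a, 0) (b, 0)).2 = 0 :=
    fderiv_inl_inl_snd hd (h.eventually_endo_inl hx hι) a b
  have hs : localSection F x₀ (fun y ↦ χ y (X (ι y))) =ᶠ[𝓝 x] fun _ ↦ 0 := by
    filter_upwards [hXL] with y hy
    have : χ y (X (ι y)) = 0 := by
      have h1 := (SetLike.ext_iff.1 (hχ.ker_eq y) (X (ι y))).2 hy
      exact h1
    rw [localSection, this, map_zero]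
  have hs' : mvfderiv IL (localSection F x₀ (fun y ↦ χ y (X (ι y)))) x u = 0 := by
    have h1 := hs.mfderiv_eq (I := IL) (I' := 𝓘(ℝ, F))
    rw [mfderiv_const] at h1
    exact congrArg (fun g : TangentSpace IL x →L[ℝ] F ↦ g u) h1
  rw [h.mvfderiv_localSection hx hX] at hs'
  have h1 := hg.pullVec_paramConnection (Γ := minimalChristoffel (pullEndo IM ψ JM)) X
    (mfderiv IL IM ι x u)
  rw [hgx, h.pullVec_mfderiv hx, hw', h.pullVec_mfderiv hx, minimalChristoffel_apply,
    h.endo_inl hx hι] at h1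
  have h2 := congrArg Prod.snd h1
  rw [Prod.snd_add, hs', Prod.smul_snd, Prod.snd_add, Prod.snd_add, Prod.smul_snd, hD,
    h.endo_snd hx hι, h.endo_snd hx hι, hD, hD, ← h.fiberCoord_normal] at h2
  simp only [map_zero, smul_zero, add_zero] at h2
  have h3 : χ x (paramConnection IM ψ g (minimalChristoffel (pullEndo IM ψ JM)) X (ι x)
      (mfderiv IL IM ι x u)) = 0 := fiberCoord_injective hx (h2.trans (map_zero _).symm)
  exact (SetLike.ext_iff.1 (hχ.ker_eq x) _).1 h3

/-- Near a point of the submanifold there is a minimal connection for which it is totally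
geodesic. -/
theorem exists_isMinimalConnectionOn (h : IsAdaptedParam IL JM ι χ x₀ x ψ)
    (hx : x ∈ coordDom IL F N x₀) (hι : IsPHSubmanifold JL JM ι)
    (hχ : IsNormalBundle IL IM F ι χ) :
    ∃ U : Set M, IsOpen U ∧ ι x ∈ U ∧
      ∃ cov : (Π y : M, TangentSpace IM y) →
          (Π y : M, TangentSpace IM y →L[ℝ] TangentSpace IM y),
        IsMinimalConnectionOn JM U cov ∧ IsTotallyGeodesicOn IL ι U cov := by
  obtain ⟨g, hgq, hg⟩ := h.isParamAt.exists_inverse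
  rw [h.eq_base] at hgq hg
  have h1 : ∀ᶠ y in 𝓝 x, y ∈ coordDom IL F N x₀ ∧ IsAdaptedParam IL JM ι χ x₀ y ψ ∧
      g (ι y) = (extChartAt IL x₀ y, 0) := by
    have hl := hg.self_of_nhds.left
    rw [hgq] at hl
    filter_upwards [(isOpen_coordDom (IL := IL) (F := F) (N := N) x₀).mem_nhds hx,
      h.eventually hx, (tendsto_zeroCoord hx).eventually hl] with y h2 h3 h4
    rw [h3.eq_base] at h4
    exact ⟨h2, h3, h4⟩
  -- as `ι` is an embedding, a property of the points of `L` near `x` holds at the points of `L` that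
  -- lie in a neighbourhood of `ι x` in `M`
  rw [hι.isSmoothEmbedding.isEmbedding.isInducing.nhds_eq_comap x, eventually_comap] at h1
  obtain ⟨U, hU, hUo, hxU⟩ := mem_nhds_iff.1 (hg.and h1)
  refine ⟨U, hUo, hxU, _, isMinimalConnectionOn_paramConnection JM hUo fun y hy ↦ (hU hy).1,
    fun y hy X hX hXL u ↦ ?_⟩
  obtain ⟨hgy, hy'⟩ := hU hy
  obtain ⟨h2, h3, h4⟩ := hy' y rfl
  exact h3.paramConnection_mem_range h2 hι hχ hgy h4 hX hXL u

end IsAdaptedParam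

/-- The comparison of the two normal bundle structures, for a submanifold that has tubular maps. -/
theorem exists_nbi_nbii [T2Space L] [SigmaCompactSpace L] (hι : IsPHSubmanifold JL JM ι)
    (hχ : IsNormalBundle IL IM F ι χ)
    (htub : ∀ x₀ : L, ∃ O : Set (TotalSpace F N), IsOpen O ∧ zeroSection F N x₀ ∈ O ∧
      ∃ φ : TotalSpace F N → M, IsTubularMapOn IL JM ι χ O φ) :
    ∃ J₁ J₂ : AlmostComplexStructure (IL.prod 𝓘(ℝ, F)) (TotalSpace F N),
      (∀ K, IsNBI JL JM ι χ K ↔ K = J₁) ∧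
      (∀ K, IsNBII JM ι χ K ↔ K = J₂) ∧
      IsPHVectorBundle JL J₂ ∧
      (∀ K, IsNormallyIntegrableForm JL J₂ K ↔ K = J₁) := by
  have hψ (x₀ x : L) (hx : x ∈ coordDom IL F N x₀) :
      ∃ ψ : EL × F → M, IsAdaptedParam IL JM ι χ x₀ x ψ := by
    obtain ⟨O, hO, hxO, φ, hφ⟩ := htub x
    exact ⟨_, hφ.isAdaptedParam hO hι hχ hx hxO⟩
  have hself (x : L) : x ∈ coordDom IL F N x := mem_coordDom_self x
  obtain ⟨J₂, hJ₂⟩ := exists_isLinearization hι hχ htub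
  have hPH := hJ₂.isPHVectorBundle hψ
  obtain ⟨J₁, hJ₁⟩ := hPH.exists_integrable
  refine ⟨J₁, J₂, ?_, hJ₂.isNBII_iff hι hχ htub, hPH, hPH.isNormallyIntegrableForm_iff hJ₁⟩
  refine isNBI_iff hι hχ (fun x ↦ hψ x x (hself x))
    (fun x ψ h a ↦ hJ₂.bundleEndo_integrable hPH hJ₁ h (hself x) a) fun x ↦ ?_
  obtain ⟨ψ, h⟩ := hψ x x (hself x)
  exact h.exists_isMinimalConnectionOn (hself x) hι hχ

end TotallyGeodesic


/-! ### Existence of tubular maps -/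

section ComplexSplitting
variable {E F : Type*} [NormedAddCommGroup E] [NormedSpace ℝ E] [NormedAddCommGroup F]
  [NormedSpace ℝ F]

/-- The complex linear part `½ (S - J S j)`, where `j = Q J S`, of a right inverse `S` of `Q`. -/
def complexSplit (J : E →L[ℝ] E) (Q : E →L[ℝ] F) (S : F →L[ℝ] E) : F →L[ℝ] E :=
  (1 / 2 : ℝ) • (S - J ∘L S ∘L Q ∘L J ∘L S)

variable {J : E →L[ℝ] E} {Q : E →L[ℝ] F} {S : F →L[ℝ] E}

theorem complexSplit_apply (w : F) :
    complexSplit J Q S w = (1 / 2 : ℝ) • (S w - J (S (Q (J (S w))))) := rfl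

/-- `Q J S` is the endomorphism that `J` induces on the quotient by the invariant kernel of `Q`. -/
theorem quotient_endo_apply (hQS : ∀ w, Q (S w) = w) (hJQ : ∀ v, Q v = 0 → Q (J v) = 0) (v : E) :
    Q (J (S (Q v))) = Q (J v) := by
  have := hJQ (S (Q v) - v) (by rw [map_sub, hQS, sub_self])
  rwa [map_sub, map_sub, sub_eq_zero] at this

theorem quotient_endo_sq (hJ : ∀ v, J (J v) = -v) (hQS : ∀ w, Q (S w) = w)
    (hJQ : ∀ v, Q v = 0 → Q (J v) = 0) (w : F) : Q (J (S (Q (J (S w))))) = -w := by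
  rw [quotient_endo_apply hQS hJQ, hJ, map_neg, hQS]

theorem comp_complexSplit (hJ : ∀ v, J (J v) = -v) (hQS : ∀ w, Q (S w) = w)
    (hJQ : ∀ v, Q v = 0 → Q (J v) = 0) (w : F) : Q (complexSplit J Q S w) = w := by
  rw [complexSplit_apply, map_smul, map_sub, hQS, quotient_endo_sq hJ hQS hJQ]
  module

/-- `complexSplit` intertwines the quotient structure `Q J S` with `J`. -/
theorem complexSplit_quotient_endo (hJ : ∀ v, J (J v) = -v) (hQS : ∀ w, Q (S w) = w)
    (hJQ : ∀ v, Q v = 0 → Q (J v) = 0) (w : F) :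
    complexSplit J Q S (Q (J (S w))) = J (complexSplit J Q S w) := by
  rw [complexSplit_apply, complexSplit_apply, quotient_endo_sq hJ hQS hJQ]
  simp only [map_smul, map_sub, map_neg, hJ]
  module

end ComplexSplitting

theorem contMDiffAt_clm_of_apply {E₁ : Type*} [NormedAddCommGroup E₁] [NormedSpace ℝ E₁]
    {H₁ : Type*} [TopologicalSpace H₁] {I₁ : ModelWithCorners ℝ E₁ H₁} {P : Type*}
    [TopologicalSpace P] [ChartedSpace H₁ P] {E F : Type*} [NormedAddCommGroup E] [NormedSpace ℝ E]
    [FiniteDimensional ℝ E] [NormedAddCommGroup F] [NormedSpace ℝ F] {f : P → E →L[ℝ] F} {x : P}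
    (h : ∀ v, ContMDiffAt I₁ 𝓘(ℝ, F) ∞ (fun y ↦ f y v) x) :
    ContMDiffAt I₁ 𝓘(ℝ, E →L[ℝ] F) ∞ f x := by
  let d := Module.finrank ℝ E
  have hd : d = Module.finrank ℝ (Fin d → ℝ) := (Module.finrank_fin_fun ℝ).symm
  let e₁ := ContinuousLinearEquiv.ofFinrankEq hd
  let e₂ := (e₁.arrowCongr (1 : F ≃L[ℝ] F)).trans (ContinuousLinearEquiv.piRing (Fin d))
  have h1 : ContMDiffAt I₁ 𝓘(ℝ, Fin d → F) ∞ (fun y ↦ e₂ (f y)) x :=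
    contMDiffAt_pi_space.2 fun i ↦ h _
  have h2 := e₂.symm.contDiff.contMDiff.contMDiffAt.comp (n := ∞) x h1
  refine h2.congr_of_eventuallyEq (Eventually.of_forall fun y ↦ ?_)
  simp

section TubularExistence
variable {EL : Type*} [NormedAddCommGroup EL] [NormedSpace ℝ EL] [FiniteDimensional ℝ EL]
  {HL : Type*} [TopologicalSpace HL] {IL : ModelWithCorners ℝ EL HL} [IL.Boundaryless]
  {L : Type*} [TopologicalSpace L] [ChartedSpace HL L]
  {F : Type*} [NormedAddCommGroup F] [NormedSpace ℝ F] [FiniteDimensional ℝ F]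
  {N : L → Type*} [TopologicalSpace (TotalSpace F N)]
  [∀ x, AddCommGroup (N x)] [∀ x, Module ℝ (N x)] [∀ x, TopologicalSpace (N x)]
  [FiberBundle F N] [VectorBundle ℝ F N] [IsManifold IL ∞ L] [ContMDiffVectorBundle ∞ F N IL]
  [∀ x, IsTopologicalAddGroup (N x)] [∀ x, ContinuousSMul ℝ (N x)]
  {EM : Type*} [NormedAddCommGroup EM] [NormedSpace ℝ EM] [FiniteDimensional ℝ EM]
  {HM : Type*} [TopologicalSpace HM] {IM : ModelWithCorners ℝ EM HM} [IM.Boundaryless]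
  {M : Type*} [TopologicalSpace M] [ChartedSpace HM M] [IsManifold IM ∞ M]
  {x₀ x : L} {φ : TotalSpace F N → M}
  {JL : AlmostComplexStructure IL L} {JM : AlmostComplexStructure IM M} {ι : L → M}
  {χ : Π x : L, TangentSpace IM (ι x) →L[ℝ] N x} {p m : M}

theorem mem_coordDom_tangent (hm : m ∈ (extChartAt IM p).source) :
    m ∈ coordDom IM EM (TangentSpace IM : M → Type _) p :=
  ⟨hm, by simpa using hm⟩

theorem fiberCoord_tangent (hm : m ∈ (extChartAt IM p).source) :
    fiberCoord EM (N := (TangentSpace IM : M → Type _)) p m = chartDeriv IM p m :=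
  TangentBundle.continuousLinearMapAt_trivializationAt (by simpa using hm)

/-- For the tangent bundle, the fibre coordinate is the differential of the chart. -/
theorem fiberCoordSymm_tangent (hm : m ∈ (extChartAt IM p).source) (v : TangentSpace IM m) :
    fiberCoordSymm EM (TangentSpace IM : M → Type _) p m (chartDeriv IM p m v) = v := by
  rw [← fiberCoord_tangent hm]
  exact fiberCoordSymm_coord (mem_coordDom_tangent hm) v

/-- A vector field with constant coefficients in a chart is smooth. -/
theorem contMDiffOn_fiberCoordSymm_tangent (v : EM) :
    ContMDiffOn IM IM.tangent ∞
      (T% (fun m : M ↦ (fiberCoordSymm EM (TangentSpace IM : M → Type _) p m v :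
        TangentSpace IM m))) (extChartAt IM p).source := by
  intro m hm
  refine ContMDiffAt.contMDiffWithinAt ?_
  refine (contMDiffAt_section_iff_localSection (mem_coordDom_tangent hm)).2 ?_
  refine contMDiffAt_const (c := v) |>.congr_of_eventuallyEq ?_
  filter_upwards [(isOpen_extChartAt_source p).mem_nhds hm] with y hy
  exact fiberCoord_symm (mem_coordDom_tangent hy) v

variable (IM F) in
/-- The projection `χ` to the normal bundle, in the chart of `M` centred at `p` and the
trivialization of the normal bundle centred at `x₀`. -/
def localProj (χ : Π x : L, TangentSpace IM (ι x) →L[ℝ] N x) (x₀ : L) (p : M) (x : L) :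
    EM →L[ℝ] F :=
  fiberCoord F x₀ x ∘L χ x ∘L fiberCoordSymm EM (TangentSpace IM : M → Type _) p (ι x)

theorem localProj_chartDeriv (hx : ι x ∈ (extChartAt IM p).source) (v : TangentSpace IM (ι x)) :
    localProj F IM χ x₀ p x (chartDeriv IM p (ι x) v) = fiberCoord F x₀ x (χ x v) := by
  have h1 : localProj F IM χ x₀ p x (chartDeriv IM p (ι x) v) = fiberCoord F x₀ x (χ x
    (fiberCoordSymm EM (TangentSpace IM : M → Type _) p (ι x) (chartDeriv IM p (ι x) v))) := rfl
  rw [h1, fiberCoordSymm_tangent hx]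

theorem IsNormalBundle.contMDiffAt_localProj (hχ : IsNormalBundle IL IM F ι χ)
    (hx : x ∈ coordDom IL F N x₀) (hι : ContinuousAt ι x) (hxp : ι x ∈ (extChartAt IM p).source) :
    ContMDiffAt IL 𝓘(ℝ, EM →L[ℝ] F) ∞ (localProj F IM χ x₀ p) x := by
  refine contMDiffAt_clm_of_apply fun v ↦ ?_
  have h1 := hχ.smooth (extChartAt IM p).source _ (isOpen_extChartAt_source p)
    (contMDiffOn_fiberCoordSymm_tangent v)
  have h2 := h1.contMDiffAt (hι.preimage_mem_nhds ((isOpen_extChartAt_source p).mem_nhds hxp))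
  exact (contMDiffAt_section_iff_localSection hx).1 h2

/-- The structure `JM` along the submanifold, in the chart of `M` centred at `p`. -/
def localEndo (JM : AlmostComplexStructure IM M) (ι : L → M) (p : M) (x : L) : EM →L[ℝ] EM :=
  pullEndo IM (extChartAt IM p).symm JM (extChartAt IM p (ι x))

theorem localEndo_chartDeriv (hx : ι x ∈ (extChartAt IM p).source) (v : TangentSpace IM (ι x)) :
    localEndo JM ι p x (chartDeriv IM p (ι x) v) = chartDeriv IM p (ι x) (JM (ι x) v) :=
  (chartDeriv_endo hx JM v).symm

theorem localEndo_sq (hx : ι x ∈ (extChartAt IM p).source) (v : EM) :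
    localEndo JM ι p x (localEndo JM ι p x v) = -v :=
  (isParamAt_extChartAt_symm p ((extChartAt IM p).map_source hx)).pullEndo_sq JM v

theorem contMDiffAt_localEndo (hι : ContMDiffAt IL IM ∞ ι x)
    (hx : ι x ∈ (extChartAt IM p).source) :
    ContMDiffAt IL 𝓘(ℝ, EM →L[ℝ] EM) ∞ (localEndo JM ι p) x := by
  have h1 := (isParamAt_extChartAt_symm p
    ((extChartAt IM p).map_source hx)).contDiffAt_pullEndo_acs JM
  exact h1.contMDiffAt.comp x ((contMDiffAt_extChartAt' (by simpa using hx)).comp x hι)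

theorem localProj_localEndo (hι : IsPHSubmanifold JL JM ι) (hχ : IsNormalBundle IL IM F ι χ)
    (hx : x ∈ coordDom IL F N x₀) (hxp : ι x ∈ (extChartAt IM p).source) (v : EM)
    (hv : localProj F IM χ x₀ p x v = 0) :
    localProj F IM χ x₀ p x (localEndo JM ι p x v) = 0 := by
  obtain ⟨v, rfl⟩ := (chartDeriv_isInvertible hxp).bijective.surjective v
  rw [localProj_chartDeriv hxp] at hv
  rw [localEndo_chartDeriv hxp, localProj_chartDeriv hxp]
  have h1 : χ x v = 0 := fiberCoord_injective hx (hv.trans (map_zero _).symm)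
  obtain ⟨u, hu⟩ := (SetLike.ext_iff.1 (hχ.ker_eq x) v).1 h1
  have h2 : χ x (JM (ι x) v) = 0 := by
    refine (SetLike.ext_iff.1 (hχ.ker_eq x) _).2 ⟨JL x u, ?_⟩
    have h3 : mfderiv IL IM ι x u = v := hu
    rw [← h3]
    exact hι.comm x u
  rw [h2, map_zero]

/-- The fibre derivative along the zero section of a map that is affine along the fibres in a
chart. -/
theorem chartDeriv_mfderiv_vert (hφ : ContMDiffAt (IL.prod 𝓘(ℝ, F)) IM ∞ φ (zeroSection F N x))
    (hm : φ (zeroSection F N x) = m) (hmp : m ∈ (extChartAt IM p).source) {w : N x} {c b : EM}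
    (h : ∀ᶠ t : ℝ in 𝓝 0, extChartAt IM p (φ ⟨x, t • w⟩) = c + t • b) :
    chartDeriv IM p m (mfderiv (IL.prod 𝓘(ℝ, F)) IM φ (zeroSection F N x)
      (vert IL F (0 : N x) w) : EM) = b := by
  subst hm
  have hx : x ∈ coordDom IL F N x := mem_coordDom_self x
  have h1 := mfderiv_eq_paramDeriv hx (a := (0 : N x)) hφ (vert IL F (0 : N x) w)
  rw [totalDeriv_vert hx] at h1
  have h2 : (localMap IL x φ (extChartAt IL x x, fiberCoord F x x 0)) = φ (zeroSection F N x) :=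
    localMap_apply hx φ (0 : N x)
  have h3 := IsParamAt.hasFDerivAt_chart
    ((contMDiffAt_localMap hx hφ).mdifferentiableAt (by simp)) p (by rw [h2]; exact hmp)
  have hline : HasDerivAt (fun t : ℝ ↦ (extChartAt IL x x, fiberCoord F x x (t • w)))
      ((0 : EL), fiberCoord F x x w) 0 := by
    have := (hasDerivAt_id (0 : ℝ)).smul_const (fiberCoord F x x w)
    simp only [map_smul]
    exact (hasDerivAt_const (0 : ℝ) (extChartAt IL x x)).prodMk (by simpa using this)
  have h4 := HasFDerivAt.comp_hasDerivAt
    (l := fun y ↦ extChartAt IM p (localMap IL x φ y)) (0 : ℝ) (by rw [zero_smul]; exact h3) hline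
  have h5 : HasDerivAt (fun t : ℝ ↦ c + t • b) b 0 := by
    have := ((hasDerivAt_id (0 : ℝ)).smul_const b).const_add c
    simpa using this
  have h6 : (fun y ↦ extChartAt IM p (localMap IL x φ y)) ∘
      (fun t : ℝ ↦ (extChartAt IL x x, fiberCoord F x x (t • w))) =ᶠ[𝓝 0]
      fun t ↦ c + t • b := by
    filter_upwards [h] with t ht
    simp only [Function.comp_apply]
    rw [localMap_apply hx φ (t • w), ht]
  have h7 := (h4.congr_of_eventuallyEq h6.symm).unique h5
  refine Eq.trans ?_ h7
  rw [ContinuousLinearMap.comp_apply, h2]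
  exact congrArg (fun V : EM ↦ chartDeriv IM p (φ (zeroSection F N x)) V) h1

/-- Near each of its points, a pseudoholomorphic submanifold has a tubular map. In a chart of `M`,
it is `x + S_x w`, where `S` is a complex linear right inverse of the projection to the normal
bundle. -/
theorem exists_isTubularMapOn (hι : IsPHSubmanifold JL JM ι) (hχ : IsNormalBundle IL IM F ι χ)
    (x₀ : L) : ∃ O : Set (TotalSpace F N), IsOpen O ∧ zeroSection F N x₀ ∈ O ∧
      ∃ φ : TotalSpace F N → M, IsTubularMapOn IL JM ι χ O φ := by
  have hιs : ContMDiff IL IM ∞ ι := hι.isSmoothEmbedding.contMDiff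
  have hx₀ : x₀ ∈ coordDom IL F N x₀ := mem_coordDom_self x₀
  set p := ι x₀ with hp
  let Q : L → EM →L[ℝ] F := localProj F IM χ x₀ p
  let J : L → EM →L[ℝ] EM := localEndo JM ι p
  have hps : ι x₀ ∈ (extChartAt IM p).source := mem_extChartAt_source p
  -- a right inverse of `Q x₀`
  obtain ⟨S₀, hS₀⟩ : ∃ S₀ : F →ₗ[ℝ] EM, (Q x₀).toLinearMap ∘ₗ S₀ = LinearMap.id := by
    refine LinearMap.exists_rightInverse_of_surjective _ (LinearMap.range_eq_top.2 fun w ↦ ?_)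
    obtain ⟨V, hV⟩ := hχ.surjective x₀ (fiberCoordSymm F N x₀ x₀ w)
    refine ⟨chartDeriv IM p (ι x₀) V, ?_⟩
    exact (localProj_chartDeriv hps V).trans (by rw [hV, fiberCoord_symm hx₀])
  let S' : F →L[ℝ] EM := LinearMap.toContinuousLinearMap S₀
  have hQS' : Q x₀ ∘L S' = ContinuousLinearMap.id ℝ F :=
    ContinuousLinearMap.ext fun w ↦ congrArg (fun f : F →ₗ[ℝ] F ↦ f w) hS₀
  have hQ (x : L) (hx : x ∈ coordDom IL F N x₀) (hxp : ι x ∈ (extChartAt IM p).source) :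
      ContMDiffAt IL 𝓘(ℝ, EM →L[ℝ] F) ∞ Q x :=
    hχ.contMDiffAt_localProj hx hιs.continuous.continuousAt hxp
  have hinv : ∀ᶠ x in 𝓝 x₀, (Q x ∘L S').IsInvertible := by
    have h1 : ContinuousAt (fun x ↦ Q x ∘L S') x₀ :=
      ((hQ x₀ hx₀ hps).clm_comp contMDiffAt_const).continuousAt
    have h2 := (ContinuousLinearEquiv.refl ℝ F).nhds
    have h3 : Q x₀ ∘L S' = (ContinuousLinearEquiv.refl ℝ F : F →L[ℝ] F) := hQS'
    filter_upwards [h1.preimage_mem_nhds (by rw [h3]; exact h2)] with x ⟨e, he⟩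
    exact ⟨e, he⟩
  obtain ⟨W, hW, hWo, hxW⟩ := mem_nhds_iff.1 (((isOpen_coordDom (IL := IL) (F := F) (N := N)
    x₀).mem_nhds hx₀ |> eventually_mem_set.2).and ((hιs.continuous.continuousAt.preimage_mem_nhds
      ((isOpen_extChartAt_source p).mem_nhds hps) |> eventually_mem_set.2).and hinv))
  -- a smooth right inverse of `Q`, and its complex linear part
  let S₁ (x : L) : F →L[ℝ] EM := S' ∘L (Q x ∘L S').inverse
  have hQS₁ (x : L) (hx : x ∈ W) (w : F) : Q x (S₁ x w) = w := (hW hx).2.2.self_apply_inverse w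
  let S (x : L) : F →L[ℝ] EM := complexSplit (J x) (Q x) (S₁ x)
  have hJJ (x : L) (hx : x ∈ W) (v : EM) : J x (J x v) = -v := localEndo_sq (hW hx).2.1 v
  have hJQ (x : L) (hx : x ∈ W) (v : EM) (hv : Q x v = 0) : Q x (J x v) = 0 :=
    localProj_localEndo hι hχ (hW hx).1 (hW hx).2.1 v hv
  have hSs (x : L) (hx : x ∈ W) : ContMDiffAt IL 𝓘(ℝ, F →L[ℝ] EM) ∞ S x := by
    have h1 := hQ x (hW hx).1 (hW hx).2.1
    have h2 : ContMDiffAt IL 𝓘(ℝ, EM →L[ℝ] EM) ∞ J x :=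
      contMDiffAt_localEndo hιs.contMDiffAt (hW hx).2.1
    have h3 : ContMDiffAt IL 𝓘(ℝ, F →L[ℝ] F) ∞ (fun x ↦ (Q x ∘L S').inverse) x :=
      ((hW hx).2.2.contDiffAt_map_inverse (n := ∞)).contMDiffAt.comp x
        (h1.clm_comp contMDiffAt_const)
    have h4 : ContMDiffAt IL 𝓘(ℝ, F →L[ℝ] EM) ∞ S₁ x :=
      (contMDiffAt_const (c := S')).clm_comp h3
    have h5 := h4.sub (h2.clm_comp (h4.clm_comp (h1.clm_comp (h2.clm_comp h4))))
    have h6 : ContMDiffAt IL 𝓘(ℝ, ℝ) ∞ (fun _ : L ↦ (1 / 2 : ℝ)) x := contMDiffAt_const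
    exact h6.smul h5
  -- the tubular map in the chart of `M`
  let μ (q : TotalSpace F N) : EM :=
    extChartAt IM p (ι q.1) + S q.1 (fiberCoord F x₀ q.1 q.2)
  have hμs (q : TotalSpace F N) (hq : q.1 ∈ W) :
      ContMDiffAt (IL.prod 𝓘(ℝ, F)) 𝓘(ℝ, EM) ∞ μ q := by
    have hπ : ContMDiffAt (IL.prod 𝓘(ℝ, F)) IL ∞ (TotalSpace.proj : TotalSpace F N → L) q :=
      contMDiffAt_proj N
    have h1 : ContMDiffAt (IL.prod 𝓘(ℝ, F)) 𝓘(ℝ, F) ∞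
        (fun q : TotalSpace F N ↦ fiberCoord F x₀ q.1 q.2) q := by
      have h2 := (contDiff_snd (𝕜 := ℝ) (E := EL) (F := F) (n := ∞)).contMDiff.contMDiffAt.comp q
        (contMDiffAt_extChartAt' (I := IL.prod 𝓘(ℝ, F)) (n := ∞) (x := zeroSection F N x₀)
          (x' := q) (by simpa using mem_extChartAt_zeroSection_source.2 (hW hq).1))
      refine h2.congr_of_eventuallyEq ?_
      filter_upwards [hπ.continuousAt.preimage_mem_nhds
        ((isOpen_coordDom (IL := IL) (F := F) (N := N) x₀).mem_nhds (hW hq).1)] with y hy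
      exact (congrArg Prod.snd (extChartAt_zeroSection_apply (IL := IL) hy y.2)).symm
    exact ((contMDiffAt_extChartAt' (by simpa using (hW hq).2.1)).comp q
      (hιs.contMDiffAt.comp q hπ)).add (((hSs _ hq).comp q hπ).clm_apply h1)
  have hπc : Continuous (TotalSpace.proj : TotalSpace F N → L) :=
    (contMDiff_proj N (IB := IL) (n := ∞)).continuous
  have hμ0 (x : L) : μ (zeroSection F N x) = extChartAt IM p (ι x) := by
    simp [μ, zeroSection]
  let O : Set (TotalSpace F N) := TotalSpace.proj ⁻¹' W ∩ μ ⁻¹' (extChartAt IM p).target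
  have hO : IsOpen O := ContinuousOn.isOpen_inter_preimage
    (fun q hq ↦ (hμs q hq).continuousAt.continuousWithinAt) (hWo.preimage hπc)
    (isOpen_extChartAt_target p)
  let φ : TotalSpace F N → M := fun q ↦ (extChartAt IM p).symm (μ q)
  have hφs (q : TotalSpace F N) (hq : q ∈ O) : ContMDiffAt (IL.prod 𝓘(ℝ, F)) IM ∞ φ q :=
    ContMDiffAt.comp q (isParamAt_extChartAt_symm p hq.2).smooth (hμs q hq.1)
  have hφ0 (x : L) (hx : zeroSection F N x ∈ O) : φ (zeroSection F N x) = ι x := by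
    have hx' : x ∈ W := hx.1
    have h1 : φ (zeroSection F N x) = (extChartAt IM p).symm (μ (zeroSection F N x)) := rfl
    rw [h1, hμ0, (extChartAt IM p).left_inv (hW hx').2.1]
  have hd (x : L) (hx : zeroSection F N x ∈ O) (w : N x) :
      chartDeriv IM p (ι x) (mfderiv (IL.prod 𝓘(ℝ, F)) IM φ (zeroSection F N x)
        (vert IL F (0 : N x) w) : EM) = S x (fiberCoord F x₀ x w) := by
    have hx' : x ∈ W := hx.1
    refine chartDeriv_mfderiv_vert (hφs _ hx) (hφ0 x hx) (hW hx').2.1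
      (c := extChartAt IM p (ι x)) ?_
    have h1 : Continuous fun t : ℝ ↦ extChartAt IM p (ι x) + t • S x (fiberCoord F x₀ x w) := by
      fun_prop
    have h2 : ∀ᶠ t : ℝ in 𝓝 0, extChartAt IM p (ι x) + t • S x (fiberCoord F x₀ x w)
        ∈ (extChartAt IM p).target := by
      refine h1.continuousAt.preimage_mem_nhds ((isOpen_extChartAt_target p).mem_nhds ?_)
      rw [zero_smul, add_zero]
      exact (extChartAt IM p).map_source (hW hx').2.1
    filter_upwards [h2] with t ht
    have h3 : μ ⟨x, t • w⟩ = extChartAt IM p (ι x) + t • S x (fiberCoord F x₀ x w) := by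
      simp only [μ, map_smul]
    have h4 : φ ⟨x, t • w⟩ = (extChartAt IM p).symm (μ ⟨x, t • w⟩) := rfl
    rw [h4, h3, (extChartAt IM p).right_inv ht]
  refine ⟨O, hO, ⟨hxW, ?_⟩, φ, fun q hq ↦ (hφs q hq).contMDiffWithinAt, hφ0, ?_, ?_⟩
  · change μ (zeroSection F N x₀) ∈ (extChartAt IM p).target
    rw [hμ0]
    exact (extChartAt IM p).map_source hps
  · intro x hx w
    have hx' : x ∈ W := hx.1
    apply fiberCoord_injective (hW hx').1
    have h1 := localProj_chartDeriv (F := F) (χ := χ) (x₀ := x₀) (hW hx').2.1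
      (mfderiv (IL.prod 𝓘(ℝ, F)) IM φ (zeroSection F N x) (vert IL F (0 : N x) w) : EM)
    rw [hd x hx] at h1
    exact h1.symm.trans (comp_complexSplit (hJJ x hx') (hQS₁ x hx') (hJQ x hx') _)
  · intro x hx w
    have hx' : x ∈ W := hx.1
    -- `J` maps the image of `w` to that of `j w`, where `j = Q J S₁` is the quotient structure
    refine ⟨fiberCoordSymm F N x₀ x (Q x (J x (S₁ x (fiberCoord F x₀ x w)))), ?_⟩
    have key (m : M) (hm : m = ι x) (V V' : EM) (hV : chartDeriv IM p (ι x) V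
        = S x (fiberCoord F x₀ x w)) (hV' : chartDeriv IM p (ι x) V'
        = J x (S x (fiberCoord F x₀ x w))) : (JM m V : EM) = V' := by
      subst hm
      apply (chartDeriv_isInvertible (hW hx').2.1).bijective.injective
      exact (localEndo_chartDeriv (hW hx').2.1 V).symm.trans ((congrArg (J x) hV).trans hV'.symm)
    refine key _ (hφ0 x hx) _ _ (hd x hx w) ?_
    rw [hd x hx, fiberCoord_symm (hW hx').1]
    exact complexSplit_quotient_endo (hJJ x hx') (hQS₁ x hx') (hJQ x hx') _

end TubularExistence


/-! ### The zero section of a pseudoholomorphic vector bundle -/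

section ZeroSection
variable {EL : Type*} [NormedAddCommGroup EL] [NormedSpace ℝ EL] [FiniteDimensional ℝ EL]
  {HL : Type*} [TopologicalSpace HL] {IL : ModelWithCorners ℝ EL HL} [IL.Boundaryless]
  {L : Type*} [TopologicalSpace L] [ChartedSpace HL L]
  {F : Type*} [NormedAddCommGroup F] [NormedSpace ℝ F] [FiniteDimensional ℝ F]
  {N : L → Type*} [TopologicalSpace (TotalSpace F N)]
  [∀ x, AddCommGroup (N x)] [∀ x, Module ℝ (N x)] [∀ x, TopologicalSpace (N x)]
  [FiberBundle F N] [VectorBundle ℝ F N] [IsManifold IL ∞ L] [ContMDiffVectorBundle ∞ F N IL]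
  [∀ x, IsTopologicalAddGroup (N x)] [∀ x, ContinuousSMul ℝ (N x)]
  {x₀ x : L} {JL : AlmostComplexStructure IL L}
  {K : AlmostComplexStructure (IL.prod 𝓘(ℝ, F)) (TotalSpace F N)}

variable (IL F N) in
theorem isImmersion_zeroSection :
    IsImmersion IL (IL.prod 𝓘(ℝ, F)) ∞ (zeroSection F N) := by
  refine IsImmersionOfComplement.isImmersion (F := F) fun x ↦ ?_
  refine IsImmersionAtOfComplement.mk_of_continuousAt
    (contMDiff_zeroSection_total IL F N).continuous.continuousAt
    (ContinuousLinearEquiv.refl ℝ (EL × F))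
    ((chartAt HL x).restr (trivializationAt F N x).baseSet)
    (chartAt (ModelProd HL F) (zeroSection F N x)) ?_ (mem_chart_source _ _) ?_
    (IsManifold.chart_mem_maximalAtlas _) ?_
  · rw [OpenPartialHomeomorph.restr_source' _ _ (trivializationAt F N x).open_baseSet]
    exact ⟨mem_chart_source HL x, FiberBundle.mem_baseSet_trivializationAt' x⟩
  · exact restr_mem_maximalAtlas (contDiffGroupoid ∞ IL) (IsManifold.chart_mem_maximalAtlas x)
      (trivializationAt F N x).open_baseSet
  · intro z hz
    set c := (chartAt HL x).restr (trivializationAt F N x).baseSet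
    obtain ⟨y, hy, rfl⟩ : ∃ y ∈ (c.extend IL).source, c.extend IL y = z :=
      ⟨_, (c.extend IL).map_target hz, (c.extend IL).right_inv hz⟩
    rw [c.extend_source, OpenPartialHomeomorph.restr_source' _ _
      (trivializationAt F N x).open_baseSet] at hy
    have hy' : y ∈ coordDom IL F N x := ⟨by simpa using hy.1, hy.2⟩
    have h1 := extChartAt_zeroSection_apply hy' (0 : N y)
    have h2 : (c.extend IL).symm (c.extend IL y) = y := (c.extend IL).left_inv (by
      rwa [c.extend_source, OpenPartialHomeomorph.restr_source' _ _
        (trivializationAt F N x).open_baseSet])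
    simp only [Function.comp_apply, h2]
    rw [map_zero] at h1
    exact h1

variable (IL F N) in
theorem isSmoothEmbedding_zeroSection :
    IsSmoothEmbedding IL (IL.prod 𝓘(ℝ, F)) ∞ (zeroSection F N) where
  isImmersion := isImmersion_zeroSection IL F N
  isEmbedding := Topology.IsEmbedding.of_leftInverse (f := TotalSpace.proj) (fun _ ↦ rfl)
    (contMDiff_proj N (IB := IL) (n := ∞)).continuous
    (contMDiff_zeroSection_total IL F N).continuous

theorem totalDeriv_zeroSection (hx : x ∈ coordDom IL F N x₀) (u : TangentSpace IL x) :
    totalDeriv F N IL x₀ (zeroSection F N x)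
      (mfderiv IL (IL.prod 𝓘(ℝ, F)) (zeroSection F N) x u) = (chartDeriv IL x₀ x u, 0) := by
  have h0 : MDiffAt (T% (fun y ↦ (0 : N y))) x :=
    (contMDiff_zeroSection_total IL F N x).mdifferentiableAt (by simp)
  refine (totalDeriv_section hx h0 u).trans (Prod.ext rfl ?_)
  have h1 : localSection F x₀ (fun y ↦ (0 : N y)) = fun _ ↦ (0 : F) :=
    funext fun y ↦ map_zero _
  have h2 : mfderiv IL 𝓘(ℝ, F) (localSection F x₀ (fun y ↦ (0 : N y))) x = 0 := by
    rw [h1, mfderiv_const]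
  exact congrArg (fun g : TangentSpace IL x →L[ℝ] F ↦ g u) h2

theorem fiberCoord_zeroSectionNormalProj_self (x : L)
    (v : TangentSpace (IL.prod 𝓘(ℝ, F)) (zeroSection F N x)) :
    fiberCoord F x x (zeroSectionNormalProj IL F N x v)
      = (totalDeriv F N IL x (zeroSection F N x) v).2 := by
  have hx : x ∈ coordDom IL F N x := mem_coordDom_self x
  refine (fiberCoord_symm hx _).trans ?_
  have h3 : HasMFDerivAt (IL.prod 𝓘(ℝ, F)) 𝓘(ℝ, EL × F)
      (extChartAt (IL.prod 𝓘(ℝ, F)) (zeroSection F N x)) (zeroSection F N x)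
      (totalDeriv F N IL x (zeroSection F N x)) :=
    (mdifferentiableAt_extChartAt (I := IL.prod 𝓘(ℝ, F)) (x := zeroSection F N x)
      (y := zeroSection F N x) (mem_chart_source _ _)).hasMFDerivAt
  have h4 := (hasFDerivAt_snd (𝕜 := ℝ) (E := EL) (F := F)
    (p := extChartAt (IL.prod 𝓘(ℝ, F)) (zeroSection F N x) (zeroSection F N x))).hasMFDerivAt.comp
      (zeroSection F N x) h3
  have h5 : (fun p : TotalSpace F N ↦ (trivializationAt F N x p).2) =ᶠ[𝓝 (zeroSection F N x)]
      Prod.snd ∘ extChartAt (IL.prod 𝓘(ℝ, F)) (zeroSection F N x) := by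
    filter_upwards [(contMDiffAt_proj N (IB := IL) (n := ∞)).continuousAt.preimage_mem_nhds
      ((isOpen_coordDom (IL := IL) (F := F) (N := N) x).mem_nhds hx)] with y hy
    exact (trivializationAt_snd hy y.2).trans
      (congrArg Prod.snd (extChartAt_zeroSection_apply (IL := IL) hy y.2)).symm
  exact congrArg (fun g : TangentSpace (IL.prod 𝓘(ℝ, F)) (zeroSection F N x) →L[ℝ] F ↦ g v)
    (h4.congr_of_eventuallyEq h5).mfderiv

theorem zeroSectionNormalProj_mfderiv (u : TangentSpace IL x) :
    zeroSectionNormalProj IL F N x (mfderiv IL (IL.prod 𝓘(ℝ, F)) (zeroSection F N) x u) = 0 := by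
  have hx : x ∈ coordDom IL F N x := mem_coordDom_self x
  apply fiberCoord_injective hx
  rw [fiberCoord_zeroSectionNormalProj_self, totalDeriv_zeroSection hx, map_zero]

theorem zeroSectionNormalProj_vert (w : N x) :
    zeroSectionNormalProj IL F N x (vert IL F (0 : N x) w) = w := by
  have hx : x ∈ coordDom IL F N x := mem_coordDom_self x
  apply fiberCoord_injective hx
  exact (fiberCoord_zeroSectionNormalProj_self x _).trans
    (congrArg Prod.snd (totalDeriv_vert hx (0 : N x) w))

/-- Along the zero section, the tangent space of the total space is the sum of the tangent space of
the base and of the fibre. -/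
theorem exists_sub_mfderiv_zeroSection_eq_vert
    (v : TangentSpace (IL.prod 𝓘(ℝ, F)) (zeroSection F N x)) :
    ∃ (u : TangentSpace IL x) (w : N x),
      v - mfderiv IL (IL.prod 𝓘(ℝ, F)) (zeroSection F N) x u = vert IL F (0 : N x) w := by
  have hx : x ∈ coordDom IL F N x := mem_coordDom_self x
  obtain ⟨u, hu⟩ := (chartDeriv_isInvertible hx.1).bijective.surjective
    (totalDeriv F N IL x (zeroSection F N x) v).1
  refine ⟨u, fiberCoordSymm F N x x (totalDeriv F N IL x (zeroSection F N x) v).2, ?_⟩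
  apply totalDeriv_injective hx (0 : N x)
  refine Eq.trans (map_sub (totalDeriv F N IL x (zeroSection F N x)) _ _) ?_
  refine Eq.trans ?_ (totalDeriv_vert hx (0 : N x) _).symm
  rw [totalDeriv_zeroSection hx, hu, fiberCoord_symm hx]
  refine Prod.ext (sub_self _) (sub_zero _)

theorem fiberCoord_zeroSectionNormalProj (hx : x ∈ coordDom IL F N x₀)
    (v : TangentSpace (IL.prod 𝓘(ℝ, F)) (zeroSection F N x)) :
    fiberCoord F x₀ x (zeroSectionNormalProj IL F N x v)
      = (totalDeriv F N IL x₀ (zeroSection F N x) v).2 := by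
  obtain ⟨u, w, h⟩ := exists_sub_mfderiv_zeroSection_eq_vert v
  have h1 := (map_sub (totalDeriv F N IL x₀ (zeroSection F N x)) _ _).symm.trans
    ((congrArg (totalDeriv F N IL x₀ (zeroSection F N x)) h).trans (totalDeriv_vert hx (0 : N x) w))
  have h2 := (map_sub (zeroSectionNormalProj IL F N x) _ _).symm.trans
    ((congrArg (zeroSectionNormalProj IL F N x) h).trans (zeroSectionNormalProj_vert w))
  rw [zeroSectionNormalProj_mfderiv, sub_zero] at h2
  rw [totalDeriv_zeroSection hx] at h1
  have h3 := congrArg Prod.snd h1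
  rw [h2]
  exact h3.symm.trans (sub_zero _)

variable (IL F N) in
/-- A vector bundle is the normal bundle of its zero section. -/
theorem isNormalBundle_zeroSection :
    IsNormalBundle IL (IL.prod 𝓘(ℝ, F)) F (zeroSection F N) (zeroSectionNormalProj IL F N) where
  surjective x w := ⟨vert IL F (0 : N x) w, zeroSectionNormalProj_vert w⟩
  ker_eq x := by
    refine SetLike.ext fun v ↦ ⟨fun hv ↦ ?_, ?_⟩
    · obtain ⟨u, w, h⟩ := exists_sub_mfderiv_zeroSection_eq_vert v
      have h1 : zeroSectionNormalProj IL F N x v = 0 := hv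
      have h2 := (map_sub (zeroSectionNormalProj IL F N x) _ _).symm.trans
        ((congrArg (zeroSectionNormalProj IL F N x) h).trans (zeroSectionNormalProj_vert w))
      rw [zeroSectionNormalProj_mfderiv, sub_zero, h1] at h2
      subst h2
      exact ⟨u, (sub_eq_zero.1 (h.trans (vertHom IL F (0 : N x)).map_zero)).symm⟩
    · rintro ⟨u, rfl⟩
      exact zeroSectionNormalProj_mfderiv u
  smooth U X hU hX x hxU := by
    have hx : x ∈ coordDom IL F N x := mem_coordDom_self x
    have h0 := (contMDiff_zeroSection_total IL F N).contMDiffAt (x := x)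
    have hs : zeroSection F N x
        ∈ (extChartAt (IL.prod 𝓘(ℝ, F)) (zeroSection F N x)).source := mem_extChartAt_source _
    have h1 := (contMDiffAt_section_iff_localSection (mem_coordDom_tangent hs)).1
      (hX.contMDiffAt (hU.mem_nhds hxU))
    have h2 := contDiff_snd (𝕜 := ℝ) (E := EL) (F := F) (n := ∞) |>.contMDiff.contMDiffAt.comp x
      (h1.comp x h0)
    refine ContMDiffAt.contMDiffWithinAt
      ((contMDiffAt_section_iff_localSection hx).2 (h2.congr_of_eventuallyEq ?_))
    filter_upwards [(isOpen_coordDom (IL := IL) (F := F) (N := N) x).mem_nhds hx] with y hy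
    refine (fiberCoord_zeroSectionNormalProj hy _).trans (congrArg Prod.snd ?_)
    have h3 := fiberCoord_tangent (m := zeroSection F N y)
      ((mem_extChartAt_zeroSection_source (IL := IL) (p := zeroSection F N y)).2 hy)
    exact (congrArg (fun g : TangentSpace (IL.prod 𝓘(ℝ, F)) (zeroSection F N y) →L[ℝ] EL × F ↦
      g (X (zeroSection F N y))) h3).symm

namespace IsPHVectorBundle

theorem isPHSubmanifold_zeroSection (hK : IsPHVectorBundle JL K) :
    IsPHSubmanifold JL K (zeroSection F N) where
  isSmoothEmbedding := isSmoothEmbedding_zeroSection IL F N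
  comm x u := by
    have hx : x ∈ coordDom IL F N x := mem_coordDom_self x
    apply totalDeriv_injective hx (0 : N x)
    refine (totalDeriv_zeroSection hx _).trans (Eq.symm ?_)
    refine (totalDeriv_bundleEndo hx K (0 : N x) _).trans ?_
    rw [(hK.isFiberLinearAt hx).apply hx, chartDeriv_baseEndo hx]
    have h1 := totalDeriv_zeroSection hx u
    refine (congrArg (fun p : EL × F ↦ (baseEndo x JL (extChartAt IL x x) p.1,
      mixedBlock (bundleEndo x K) (extChartAt IL x x) (fiberCoord F x x (0 : N x)) p.1
        + fiberBlock (bundleEndo x K) (extChartAt IL x x) p.2)) h1).trans ?_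
    simp

/-- The identity of the total space is a tubular map of the zero section. -/
theorem isTubularMapOn_id (hK : IsPHVectorBundle JL K) :
    IsTubularMapOn IL K (zeroSection F N) (zeroSectionNormalProj IL F N) Set.univ id where
  smooth := contMDiff_id.contMDiffOn
  zero _ _ := rfl
  proj x _ w := by
    rw [mfderiv_id]
    exact zeroSectionNormalProj_vert w
  invariant x _ w := by
    obtain ⟨j, -, hj⟩ := hK.fiber x
    refine ⟨j w, ?_⟩
    rw [mfderiv_id]
    exact hj 0 w

/-- A pseudoholomorphic vector bundle structure is invariant under the dilatations of the fibres,
so it is the NB-II structure of its zero section. -/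
theorem isNBII_zeroSection (hK : IsPHVectorBundle JL K) :
    IsNBII K (zeroSection F N) (zeroSectionNormalProj IL F N) K := by
  intro x₀
  refine ⟨Set.univ, isOpen_univ, trivial, id, hK.isTubularMapOn_id, fun x _ a v ↦ ?_⟩
  have hx : x ∈ coordDom IL F N x := mem_coordDom_self x
  refine (hK.isTubularMapOn_id.tendsto_iff isOpen_univ hK.isPHSubmanifold_zeroSection
    (isNormalBundle_zeroSection IL F N) hx trivial a v _).2 ?_
  rw [totalDeriv_bundleEndo hx, (hK.isFiberLinearAt hx).eq_linearModel hx]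
  rfl

end IsPHVectorBundle
end ZeroSection

end

theorem theoremt14
    {EL : Type*} [NormedAddCommGroup EL] [NormedSpace ℝ EL] [FiniteDimensional ℝ EL]
    {HL : Type*} [TopologicalSpace HL] {IL : ModelWithCorners ℝ EL HL} [IL.Boundaryless]
    {L : Type*} [TopologicalSpace L] [ChartedSpace HL L] [IsManifold IL ∞ L]
    [T2Space L] [SigmaCompactSpace L]
    {F : Type*} [NormedAddCommGroup F] [NormedSpace ℝ F] [FiniteDimensional ℝ F]
    {N : L → Type*} [TopologicalSpace (TotalSpace F N)]
    [∀ x, AddCommGroup (N x)] [∀ x, Module ℝ (N x)] [∀ x, TopologicalSpace (N x)]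
    [∀ x, IsTopologicalAddGroup (N x)] [∀ x, ContinuousSMul ℝ (N x)]
    [FiberBundle F N] [VectorBundle ℝ F N] [ContMDiffVectorBundle ∞ F N IL]
    (JL : AlmostComplexStructure IL L) :
    -- the NB-I structure of the zero section of a pseudoholomorphic vector bundle
    (∀ Jhat : AlmostComplexStructure (IL.prod 𝓘(ℝ, F)) (TotalSpace F N),
      IsPHVectorBundle JL Jhat →
        IsPHSubmanifold JL Jhat (zeroSection F N) ∧
        IsNormalBundle IL (IL.prod 𝓘(ℝ, F)) F (zeroSection F N) (zeroSectionNormalProj IL F N) ∧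
        ∃ J₀ : AlmostComplexStructure (IL.prod 𝓘(ℝ, F)) (TotalSpace F N),
          (∀ K, IsNormallyIntegrableForm JL Jhat K ↔ K = J₀) ∧
          (∀ K, IsNBI JL Jhat (zeroSection F N) (zeroSectionNormalProj IL F N) K ↔ K = J₀)) ∧
    -- the relation between NB-II and NB-I for an arbitrary pseudoholomorphic submanifold
    (∀ {EM : Type*} [NormedAddCommGroup EM] [NormedSpace ℝ EM] [FiniteDimensional ℝ EM]
      {HM : Type*} [TopologicalSpace HM] {IM : ModelWithCorners ℝ EM HM} [IM.Boundaryless]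
      {M : Type*} [TopologicalSpace M] [ChartedSpace HM M] [IsManifold IM ∞ M]
      [T2Space M] [SigmaCompactSpace M]
      (JM : AlmostComplexStructure IM M) (ι : L → M)
      (χ : Π x : L, TangentSpace IM (ι x) →L[ℝ] N x),
      IsPHSubmanifold JL JM ι → IsNormalBundle IL IM F ι χ →
        ∃ J₁ J₂ : AlmostComplexStructure (IL.prod 𝓘(ℝ, F)) (TotalSpace F N),
          (∀ K, IsNBI JL JM ι χ K ↔ K = J₁) ∧
          (∀ K, IsNBII JM ι χ K ↔ K = J₂) ∧
          IsPHVectorBundle JL J₂ ∧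
          (∀ K, IsNormallyIntegrableForm JL J₂ K ↔ K = J₁)) := by
  refine ⟨fun Jhat hJhat ↦ ?_, fun JM ι χ hι hχ ↦
    exists_nbi_nbii hι hχ (exists_isTubularMapOn hι hχ)⟩
  have hι := hJhat.isPHSubmanifold_zeroSection
  have hχ := isNormalBundle_zeroSection IL F N
  obtain ⟨J₁, J₂, hI, hII, -, hnif⟩ := exists_nbi_nbii hι hχ fun x₀ ↦
    ⟨Set.univ, isOpen_univ, trivial, id, hJhat.isTubularMapOn_id⟩
  -- `Jhat` is its own NB-II structure, so `J₁` is the normally integrable form of `Jhat`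
  obtain rfl : Jhat = J₂ := (hII _).1 hJhat.isNBII_zeroSection
  exact ⟨hι, hχ, J₁, hnif, hI⟩
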